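/- **Definitions.** A $B$-hypergraph $\mathcal D=(V,\mathcal A)$ has a finite family $\mathcal A$ of hyperarcs $A=(T(A),h(A))$ with a finite tail set $T(A)\subseteq V$ and a single head $h(A)\in V$; parallel hyperarcs are allowed, and hyperarcs keep their identity when their tails are modified. Put $m=|\mathcal A|$, $n=|V|$ and $\|\mathcal A\|=\sum_{A\in\mathcal A}(1+|T(A)|)$. For $S\subseteq V$ and $Q\subseteq\mathcal A$, the vertices $B$-connected from $S$ by $Q$ form the smallest set that contains $S$ and contains $h(A)$ for each $A\in Q$ whose tails it contains. For finite $S,T\subseteq V$, an $S$-$T$ hyperpath is an inclusion-wise minimal $Q\subseteq\mathcal A$ by which every vertex of $T$ is $B$-connected from $S$. Such a hyperpath is ordered as $(A_1,\dots,A_k)$ if $T(A_i)\subseteq S\cup\{h(A_1),\dots,h(A_{i-1})\}$ for all $i$. **Algorithm.** $\mathrm{Enum}(\mathcal D,S,T,P)$: If $T=\emptyset$, output $P$ and return. If $\mathcal D$ has no $S$-$T$ hyperpath, return. Otherwise choose an ordered $S$-$T$ hyperpath $(A_1,\dots,A_k)$, with $A_k=(T_k,h_k)$. Call $\mathrm{Enum}(\mathcal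 D-A_k,S,T,P)$. Then call $\mathrm{Enum}(\mathcal D',S,T',P\cup\{A_k\})$, where $T'=(T\cup T_k)\setminus(S\cup\{h_k\})$ and $\mathcal D'$ arises from $\mathcal D$ by deleting the vertex $h_k$ and all hyperarcs with head $h_k$ and replacing $h_k$ by $T_k$ in the tail sets of all other hyperarcs that contain it. **Theorem.** 1. Let $\mathcal D$ be a $B$-hypergraph and let $S,T$ be finite vertex sets such that $T=\emptyset$ or $T\not\subseteq S$. Then $\mathrm{Enum}(\mathcal D,S,T,\emptyset)$ terminates, and, whichever ordered hyperpaths it chooses, it outputs every $S$-$T$ hyperpath of $\mathcal D$ exactly once and outputs nothing else. 2. The algorithm can be implemented with $O(m^2\|\mathcal A\|)$ delay and $O(m\|\mathcal A\|)$ space. Precisely, there are a word RAM program and a constant $C$ such that for every $B$-hypergraph with finite $V$ and all disjoint $S,T\subseteq V$ the program halts, and its sequence of outputs is the output sequence of an execution of $\mathrm{Enum}(\mathcal D,S,T,\emptyset)$, each output listing the hyperarcs of the hyperpath without repetition. At most $C(m^2\|\mathcal A\|+1)$ steps pass before the first output is completed, between the completions of consecutive outputs, and between the last output and termination (or in total,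 if there is no output). The program uses, besides its read-only input, a fixed number of registers and of work arrays with $C(m\|\mathcal A\|+1)$ cells each, and all words are at most $(n+\|\mathcal A\|+2)^C$. The input consists of the lists of heads and tails of the hyperarcs, the characteristic vector of $S$, and the list of $T$, together with the numbers $n$, $m$, $|T|$. (The summands $1$ matter only if $m=0$.) -/

import Mathlib

/-! ## Directed hypergraphs all of whose hyperarcs have a single head -/

/-- A `B`-hypergraph with finitely many hyperarcs on vertices of type `V`. A hyperarc is a label
`a ∈ arcs` with tail set `tail a` and head `head a`; two labels may carry the same tail set and
head, so parallel hyperarcs are allowed, and hyperarcs keep their identity when the tails are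
modified. -/
structure BHypergraph (V ι : Type*) where
  arcs : Finset ι
  tail : ι → Finset V
  head : ι → V

namespace BHypergraph

variable {V ι : Type*}

/-- `D.BConnected Q S v`: the vertex `v` is `B`-connected from the vertex set `S` by means of
the hyperarcs in `Q`. -/
inductive BConnected (D : BHypergraph V ι) (Q : Finset ι) (S : Finset V) : V → Prop
  | base {v : V} (hv : v ∈ S) : BConnected D Q S v
  | step {a : ι} (ha : a ∈ Q) (htail : ∀ v ∈ D.tail a, BConnected D Q S v) :
      BConnected D Q S (D.head a)

/-- `Q` is an `S`-`T` hyperpath of `D`: an inclusion-wise minimal set of hyperarcs of `D` by means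
of which every vertex of `T` is `B`-connected from `S`. -/
def IsHyperpath (D : BHypergraph V ι) (S T : Finset V) (Q : Finset ι) : Prop :=
  Minimal (fun R : Finset ι => R ⊆ D.arcs ∧ ∀ t ∈ T, D.BConnected R S t) Q

/-- The total size `∑ A, (|H(A)| + |T(A)|)` of the hyperarcs. -/
def size (D : BHypergraph V ι) : ℕ := ∑ a ∈ D.arcs, (1 + (D.tail a).card)

variable [DecidableEq V] [DecidableEq ι]

/-- `(A₁, …, A_k)` is an `S`-`T` hyperpath, listed without repetition in an order in which the
tails of each `A_i` are contained in `S ∪ {H(A₁), …, H(A_{i-1})}`. -/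
def IsOrderedHyperpath (D : BHypergraph V ι) (S T : Finset V) (L : List ι) : Prop :=
  L.Nodup ∧ D.IsHyperpath S T L.toFinset ∧
    ∀ (L₁ L₂ : List ι) (a : ι), L = L₁ ++ a :: L₂ →
      ∀ v ∈ D.tail a, v ∈ S ∨ ∃ b ∈ L₁, D.head b = v

/-- Removal of the hyperarc `a`. -/
def delete (D : BHypergraph V ι) (a : ι) : BHypergraph V ι where
  arcs := D.arcs.erase a
  tail := D.tail
  head := D.head

/-- Contraction of the hyperarc `a = (T_a, h)`: all hyperarcs with head `h` are removed, and in the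
tails of the others `h` is replaced by `T_a`. (When `h ∉ T_a`, the vertex `h` does not occur in the
result, so it is implicitly removed from the vertex set.) -/
def contract (D : BHypergraph V ι) (a : ι) : BHypergraph V ι where
  arcs := D.arcs.filter (fun b => D.head b ≠ D.head a)
  tail := fun b =>
    if D.head a ∈ D.tail b then (D.tail b).erase (D.head a) ∪ D.tail a else D.tail b
  head := D.head

/-- The new target set `(T ∪ T_a) \ (S ∪ {h})` that goes with the contraction of `a = (T_a, h)`. -/
def newTargets (D : BHypergraph V ι) (S T : Finset V) (a : ι) : Finset V :=
  (T ∪ D.tail a) \ (S ∪ {D.head a})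

/-- `EnumHyperpaths S D T P out`: the recursive procedure called with `(D, S, T, P)` can output
exactly the sequence `out` of sets of hyperarcs, in this order, and return. The only freedom is
the choice of the `S`-`T` hyperpath `(A₁, …, A_k)`, whose last hyperarc `A_k = a` is branched on. -/
inductive EnumHyperpaths (S : Finset V) :
    BHypergraph V ι → Finset V → Finset ι → List (Finset ι) → Prop
  | output (D : BHypergraph V ι) (P : Finset ι) : EnumHyperpaths S D ∅ P [P]
  | none (D : BHypergraph V ι) (T : Finset V) (P : Finset ι) (hT : T ≠ ∅)
      (hno : ¬ ∃ Q, D.IsHyperpath S T Q) : EnumHyperpaths S D T P []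
  | branch (D : BHypergraph V ι) (T : Finset V) (P : Finset ι) (L : List ι) (a : ι)
      (out₀ out₁ : List (Finset ι)) (hT : T ≠ ∅) (hL : D.IsOrderedHyperpath S T (L ++ [a]))
      (h₀ : EnumHyperpaths S (D.delete a) T P out₀)
      (h₁ : EnumHyperpaths S (D.contract a) (D.newTargets S T a) (P ∪ {a}) out₁) :
      EnumHyperpaths S D T P (out₀ ++ out₁)

/-- `RecCall S X Y`: the procedure called with the hypergraph and target set `Y` can directly call
itself with the hypergraph and target set `X`. -/
inductive RecCall (S : Finset V) :
    BHypergraph V ι × Finset V → BHypergraph V ι × Finset V → Prop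
  | without (D : BHypergraph V ι) (T : Finset V) (L : List ι) (a : ι) (hT : T ≠ ∅)
      (hL : D.IsOrderedHyperpath S T (L ++ [a])) : RecCall S (D.delete a, T) (D, T)
  | using (D : BHypergraph V ι) (T : Finset V) (L : List ι) (a : ι) (hT : T ≠ ∅)
      (hL : D.IsOrderedHyperpath S T (L ++ [a])) :
      RecCall S (D.contract a, D.newTargets S T a) (D, T)

end BHypergraph

/-! ## A random access machine with bounded words and bounded memory

Programs are structured programs over natural number registers, a fixed number of read-only input
arrays, and a fixed number of work arrays. All registers and cells are initially zero. -/

namespace WordRAM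

/-- Expressions; registers and arrays are named by numerals. -/
inductive Expr
  | const (k : ℕ)
  | reg (x : ℕ)
  /-- cell of a read-only input array -/
  | input (A : ℕ) (i : Expr)
  /-- cell of a work array -/
  | work (A : ℕ) (i : Expr)
  | add (e f : Expr)
  | sub (e f : Expr)
  | mul (e f : Expr)
  | lt (e f : Expr)
  | eq (e f : Expr)

/-- Programs. A solution is printed word by word with `emit`; `flush` marks its end. -/
inductive Cmd
  | skip
  | assign (x : ℕ) (e : Expr)
  | store (A : ℕ) (i e : Expr)
  | emit (e : Expr)
  | flush
  | seq (c d : Cmd)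
  | ite (e : Expr) (c d : Cmd)
  | loop (e : Expr) (c : Cmd)

/-- The contents of registers and work arrays, together with the number of steps made so far
(`time`), the words printed since the last completed output (`buffer`), and the completed outputs
with the times of their completion, in chronological order (`log`). Programs cannot read the last
three. -/
structure State where
  reg : ℕ → ℕ
  work : ℕ → ℕ → ℕ
  time : ℕ
  buffer : List ℕ
  log : List (ℕ × List ℕ)

def State.init : State where
  reg := fun _ => 0
  work := fun _ _ => 0
  time := 0
  buffer := []
  log := []

/-- The resources of a machine: every work array has `cells` cells, with addresses
`0, …, cells - 1`, and every word is a natural number at most `maxWord`. -/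
structure Limits where
  cells : ℕ
  maxWord : ℕ

/-- Value of an expression. Input cells past the end of an input array read as `0`. -/
def Expr.eval (inp : ℕ → List ℕ) (σ : State) : Expr → ℕ
  | .const k => k
  | .reg x => σ.reg x
  | .input A i => (inp A).getD (i.eval inp σ) 0
  | .work A i => σ.work A (i.eval inp σ)
  | .add e f => e.eval inp σ + f.eval inp σ
  | .sub e f => e.eval inp σ - f.eval inp σ
  | .mul e f => e.eval inp σ * f.eval inp σ
  | .lt e f => if e.eval inp σ < f.eval inp σ then 1 else 0
  | .eq e f => if e.eval inp σ = f.eval inp σ then 1 else 0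

/-- Number of steps taken by the evaluation of an expression: one per constant, register access,
array access and operation. -/
def Expr.cost : Expr → ℕ
  | .const _ => 1
  | .reg _ => 1
  | .input _ i => 1 + i.cost
  | .work _ i => 1 + i.cost
  | .add e f => 1 + e.cost + f.cost
  | .sub e f => 1 + e.cost + f.cost
  | .mul e f => 1 + e.cost + f.cost
  | .lt e f => 1 + e.cost + f.cost
  | .eq e f => 1 + e.cost + f.cost

/-- The evaluation respects the limits: all values that occur, also the intermediate ones, fit into
a word, and all work cells that are read exist. -/
def Expr.Safe (M : Limits) (inp : ℕ → List ℕ) (σ : State) : Expr → Prop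
  | .const k => k ≤ M.maxWord
  | .reg x => σ.reg x ≤ M.maxWord
  | .input A i => i.Safe M inp σ ∧ (Expr.input A i).eval inp σ ≤ M.maxWord
  | .work A i =>
      i.Safe M inp σ ∧ i.eval inp σ < M.cells ∧ (Expr.work A i).eval inp σ ≤ M.maxWord
  | .add e f => e.Safe M inp σ ∧ f.Safe M inp σ ∧ (Expr.add e f).eval inp σ ≤ M.maxWord
  | .sub e f => e.Safe M inp σ ∧ f.Safe M inp σ ∧ (Expr.sub e f).eval inp σ ≤ M.maxWord
  | .mul e f => e.Safe M inp σ ∧ f.Safe M inp σ ∧ (Expr.mul e f).eval inp σ ≤ M.maxWord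
  | .lt e f => e.Safe M inp σ ∧ f.Safe M inp σ ∧ (Expr.lt e f).eval inp σ ≤ M.maxWord
  | .eq e f => e.Safe M inp σ ∧ f.Safe M inp σ ∧ (Expr.eq e f).eval inp σ ≤ M.maxWord

/-- `σ.tick k`: let `k` steps pass. -/
def State.tick (σ : State) (k : ℕ) : State := { σ with time := σ.time + k }

def State.setReg (σ : State) (x v : ℕ) : State := { σ with reg := Function.update σ.reg x v }

def State.setWork (σ : State) (A i v : ℕ) : State :=
  { σ with work := Function.update σ.work A (Function.update (σ.work A) i v) }

def State.print (σ : State) (v : ℕ) : State := { σ with buffer := σ.buffer ++ [v] }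

def State.complete (σ : State) : State :=
  { σ with buffer := [], log := σ.log ++ [(σ.time, σ.buffer)] }

/-- `Exec M inp c σ σ'`: on the input `inp`, the program `c` started in state `σ` halts in state
`σ'`, and never exceeds the limits `M` on the way. -/
inductive Exec (M : Limits) (inp : ℕ → List ℕ) : Cmd → State → State → Prop
  | skip (σ : State) : Exec M inp .skip σ (σ.tick 1)
  | assign (σ : State) (x : ℕ) (e : Expr) (he : e.Safe M inp σ) :
      Exec M inp (.assign x e) σ ((σ.setReg x (e.eval inp σ)).tick (1 + e.cost))
  | store (σ : State) (A : ℕ) (i e : Expr) (hi : i.Safe M inp σ) (he : e.Safe M inp σ)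
      (hcell : i.eval inp σ < M.cells) :
      Exec M inp (.store A i e) σ
        ((σ.setWork A (i.eval inp σ) (e.eval inp σ)).tick (1 + i.cost + e.cost))
  | emit (σ : State) (e : Expr) (he : e.Safe M inp σ) :
      Exec M inp (.emit e) σ ((σ.print (e.eval inp σ)).tick (1 + e.cost))
  | flush (σ : State) : Exec M inp .flush σ (σ.tick 1).complete
  | seq (σ σ₁ σ₂ : State) (c d : Cmd) (hc : Exec M inp c σ σ₁) (hd : Exec M inp d σ₁ σ₂) :
      Exec M inp (.seq c d) σ σ₂
  | iteTrue (σ σ₁ : State) (e : Expr) (c d : Cmd) (he : e.Safe M inp σ)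
      (hne : e.eval inp σ ≠ 0) (hc : Exec M inp c (σ.tick (1 + e.cost)) σ₁) :
      Exec M inp (.ite e c d) σ σ₁
  | iteFalse (σ σ₁ : State) (e : Expr) (c d : Cmd) (he : e.Safe M inp σ)
      (hz : e.eval inp σ = 0) (hd : Exec M inp d (σ.tick (1 + e.cost)) σ₁) :
      Exec M inp (.ite e c d) σ σ₁
  | loopTrue (σ σ₁ σ₂ : State) (e : Expr) (c : Cmd) (he : e.Safe M inp σ)
      (hne : e.eval inp σ ≠ 0) (hc : Exec M inp c (σ.tick (1 + e.cost)) σ₁)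
      (hloop : Exec M inp (.loop e c) σ₁ σ₂) : Exec M inp (.loop e c) σ σ₂
  | loopFalse (σ : State) (e : Expr) (c : Cmd) (he : e.Safe M inp σ)
      (hz : e.eval inp σ = 0) : Exec M inp (.loop e c) σ (σ.tick (1 + e.cost))

/-- A run that ended in state `σ` had delay at most `d`: at most `d` steps were made before the
first output was completed, between the completions of two consecutive outputs, and between the
last output and termination (or in total, if there was no output). -/
def State.DelayAtMost (σ : State) (d : ℕ) : Prop :=
  List.IsChain (fun s t : ℕ => t ≤ s + d) (0 :: (σ.log.map Prod.fst ++ [σ.time]))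

end WordRAM

/-- The input arrays for a hypergraph with vertices `0, …, n - 1` and hyperarcs `0, …, m - 1` and
vertex sets `S`, `T`: array `0` is `[n, m, |T|]`, array `1` lists the heads, array `2` the positions
in array `3` at which the tails of the hyperarcs `0, …, m - 1` start (followed by the length of
array `3`), array `3` is the concatenation of the tail sets, array `4` is the characteristic vector
of `S`, and array `5` lists `T`. -/
def BHypergraph.encode {n m : ℕ} (D : BHypergraph (Fin n) (Fin m)) (S T : Finset (Fin n)) :
    ℕ → List ℕ
  | 0 => [n, m, T.card]
  | 1 => List.ofFn fun a : Fin m => (D.head a : ℕ)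
  | 2 => List.ofFn fun k : Fin (m + 1) =>
      ∑ a ∈ Finset.univ.filter (fun a : Fin m => (a : ℕ) < (k : ℕ)), (D.tail a).card
  | 3 => (List.finRange m).flatMap fun a => ((D.tail a).sort (· ≤ ·)).map Fin.val
  | 4 => List.ofFn fun v : Fin n => if v ∈ S then 1 else 0
  | 5 => (T.sort (· ≤ ·)).map Fin.val
  | _ => []

/-- The list `w` of words lists every element of the set `P` of hyperarcs exactly once, and nothing
else. -/
def ListsArcs {m : ℕ} (w : List ℕ) (P : Finset (Fin m)) : Prop :=
  w.Nodup ∧ ∀ k : ℕ, k ∈ w ↔ ∃ a ∈ P, (a : ℕ) = k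

/-! Correctness. Let `a` be the last hyperarc of an ordered hyperpath. By minimality the earlier
hyperarcs do not connect `T`, and the only vertex they can miss is `head a`; hence `head a` is a
target, outside `S`, and not a tail of `a` (`IsOrderedHyperpath.branches`). Hyperpaths avoiding `a`
are those of `D.delete a`. For hyperpaths through `a`, two facts matter: the hyperarcs of a
hyperpath have distinct heads (`IsHyperpath.unique_head`), and a set `Q` of hyperarcs of the
contraction connects the new targets there exactly if `Q ∪ {a}` connects `T` in `D`
(`Branches.connects_contract_iff`). So they correspond to the hyperpaths of the contraction, and
each hyperpath arises in exactly one branch. Both branches have fewer hyperarcs.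

Finding a hyperpath. A forward search lists hyperarcs with new heads until it is stuck; a backward
pass keeps those whose heads are needed. Heads in the list are distinct, so every kept hyperarc is
forced and the result is minimal (`Reaching.isPath_prune`).

Implementation. Contractions are never built. A call is described in the original hypergraph by the
set `P` of contracted hyperarcs and the set `A` that consists of `P` and the current hyperarcs
(`Node`). A hyperpath `K` for the original targets inside `A` contains `P`, and `K` without `P` is
an ordered hyperpath of the current call (`Node.isOrderedHyperpath`). Its last hyperarc is branched
on; if none is left, `K` is output. A stack of at most `m` decisions determines `A` and `P`, which
are recomputed in every round, at a cost of `O(m‖A‖ + 1)` per round.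

Delay. A hyperpath through `a` survives the contraction of `a` (`IsPath.connects_of_mem`), so every
call that has a hyperpath outputs something, and a call without output is one failed round. Hence
`O(m + 1)` rounds pass between outputs (`explore`).

Space. Arrays indexed by vertices would need `n` cells. Vertices are therefore renamed by numbers up
to `m + 1` (`cls`); outside `S` only vertices that are no heads are confused, and these can never be
reached. -/

set_option linter.unusedSectionVars false

namespace BHypergraph

/-! ### `B`-connectivity and ordered lists of hyperarcs -/

section Connectivity

variable {V ι : Type*} {D D' : BHypergraph V ι} {Q R A : Finset ι} {S T : Finset V} {v : V}

theorem BConnected.mono (h : Q ⊆ R) (hv : D.BConnected Q S v) : D.BConnected R S v := by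
  induction hv with
  | base hv => exact .base hv
  | step ha _ ih => exact .step (h ha) ih

theorem BConnected.mem_or_exists (hv : D.BConnected Q S v) :
    v ∈ S ∨ ∃ a ∈ Q, D.head a = v ∧ ∀ u ∈ D.tail a, D.BConnected Q S u := by
  cases hv with
  | base hv => exact .inl hv
  | step ha h => exact .inr ⟨_, ha, rfl, h⟩

/-- Every vertex of `T` is `B`-connected from `S` by means of the hyperarcs in `Q`. -/
def Connects (D : BHypergraph V ι) (S T : Finset V) (Q : Finset ι) : Prop :=
  ∀ t ∈ T, D.BConnected Q S t

theorem Connects.mono (h : Q ⊆ R) (hQ : D.Connects S T Q) : D.Connects S T R :=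
  fun t ht => (hQ t ht).mono h

theorem connects_empty_arcs : D.Connects S T ∅ ↔ T ⊆ S := by
  refine ⟨fun h t ht => ?_, fun h t ht => .base (h ht)⟩
  rcases (h t ht).mem_or_exists with h | ⟨a, ha, _⟩
  · exact h
  · simp at ha

theorem IsHyperpath.connects (h : D.IsHyperpath S T Q) : D.Connects S T Q := h.prop.2

theorem IsHyperpath.subset_arcs (h : D.IsHyperpath S T Q) : Q ⊆ D.arcs := h.prop.1

theorem IsHyperpath.eq_of_subset (h : D.IsHyperpath S T Q) (hR : R ⊆ Q) (hc : D.Connects S T R) :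
    R = Q :=
  hR.antisymm (h.2 ⟨hR.trans h.subset_arcs, hc⟩ hR)

theorem isHyperpath_iff : D.IsHyperpath S T Q ↔
    Q ⊆ D.arcs ∧ D.Connects S T Q ∧ ∀ R ⊆ Q, D.Connects S T R → Q ⊆ R :=
  ⟨fun h => ⟨h.subset_arcs, h.connects, fun _ hR hc => (h.eq_of_subset hR hc).ge⟩,
    fun h => ⟨⟨h.1, h.2.1⟩, fun _ hR hRQ => h.2.2 _ hRQ hR.2⟩⟩

/-- The tails of every hyperarc of the list are in `S` or heads of earlier hyperarcs. -/
def Ordered (D : BHypergraph V ι) (S : Finset V) (L : List ι) : Prop :=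
  ∀ (L₁ L₂ : List ι) (a : ι), L = L₁ ++ a :: L₂ →
    ∀ v ∈ D.tail a, v ∈ S ∨ ∃ b ∈ L₁, D.head b = v

theorem ordered_nil : D.Ordered S [] := by
  intro L₁ L₂ a h
  simp at h

theorem ordered_concat {L : List ι} {b : ι} : D.Ordered S (L ++ [b]) ↔
    D.Ordered S L ∧ ∀ v ∈ D.tail b, v ∈ S ∨ v ∈ L.map D.head := by
  refine ⟨fun h => ⟨?_, ?_⟩, fun ⟨h, hb⟩ => ?_⟩
  · rintro L₁ L₂ a rfl
    exact h L₁ (L₂ ++ [b]) a (by simp)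
  · intro v hv
    simpa using h L [] b rfl v hv
  · intro L₁ L₂ a hL
    rcases List.eq_nil_or_concat' L₂ with rfl | ⟨L₃, c, rfl⟩
    · obtain ⟨rfl, h2⟩ := List.append_inj' hL rfl
      cases h2
      simpa using hb
    · have h2 : L ++ [b] = (L₁ ++ a :: L₃) ++ [c] := by simpa using hL
      exact h _ _ _ (List.append_inj' h2 rfl).1

theorem Ordered.bConnected_head {L : List ι} (h : D.Ordered S L) (hL : ∀ b ∈ L, b ∈ Q) :
    ∀ b ∈ L, D.BConnected Q S (D.head b) := by
  induction L using List.reverseRecOn with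
  | nil => simp
  | append_singleton L b ih =>
    rw [ordered_concat] at h
    have ih := ih h.1 (fun c hc => hL c (by simp [hc]))
    intro c hc
    rcases List.mem_append.1 hc with hc | hc
    · exact ih c hc
    · obtain rfl := List.mem_singleton.1 hc
      refine .step (hL c (by simp)) fun v hv => ?_
      rcases h.2 v hv with hv | hv
      · exact .base hv
      · obtain ⟨d, hd, rfl⟩ := List.mem_map.1 hv
        exact ih d hd

end Connectivity

variable {V ι : Type*} [DecidableEq V] [DecidableEq ι]
variable {D : BHypergraph V ι} {Q R A : Finset ι} {S T : Finset V} {v : V} {a b : ι} {L : List ι}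

/-! ### Forward search and backward selection of a minimal connecting set -/

section Forward

/-- Append `b` to the list `L` if it is a hyperarc in `A` that reaches a new vertex. -/
def fire (D : BHypergraph V ι) (S : Finset V) (A : Finset ι) (L : List ι) (b : ι) : List ι :=
  if b ∈ A ∧ ¬ (D.head b ∈ S ∨ D.head b ∈ L.map D.head) ∧
    ∀ v ∈ D.tail b, v ∈ S ∨ v ∈ L.map D.head then L ++ [b] else L

/-- A list of hyperarcs in `A` that reach new vertices one after the other. -/
structure Reaching (D : BHypergraph V ι) (S : Finset V) (A : Finset ι) (L : List ι) : Prop where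
  mem : ∀ b ∈ L, b ∈ A
  head_notMem : ∀ b ∈ L, D.head b ∉ S
  nodup : (L.map D.head).Nodup
  ordered : D.Ordered S L

theorem Reaching.nil : D.Reaching S A [] := ⟨by simp, by simp, by simp, ordered_nil⟩

theorem Reaching.fire (h : D.Reaching S A L) (b : ι) : D.Reaching S A (D.fire S A L b) := by
  unfold BHypergraph.fire
  split_ifs with hb
  · obtain ⟨hA, hh, ht⟩ := hb
    push Not at hh
    refine ⟨?_, ?_, ?_, ordered_concat.2 ⟨h.ordered, ht⟩⟩
    · intro c hc
      rcases List.mem_append.1 hc with hc | hc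
      · exact h.mem c hc
      · rwa [List.mem_singleton.1 hc]
    · intro c hc
      rcases List.mem_append.1 hc with hc | hc
      · exact h.head_notMem c hc
      · rw [List.mem_singleton.1 hc]; exact hh.1
    · rw [List.map_append, List.nodup_append]
      refine ⟨h.nodup, by simp, ?_⟩
      rintro x hx y hy rfl
      simp only [List.map_cons, List.map_nil, List.mem_singleton] at hy
      exact hh.2 (hy ▸ hx)
  · exact h

theorem Reaching.foldl_fire (E : List ι) (h : D.Reaching S A L) :
    D.Reaching S A (E.foldl (D.fire S A) L) := by
  induction E generalizing L with
  | nil => exact h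
  | cons b E ih => exact ih (h.fire b)

/-- The hyperarcs that reach new vertices in `k` rounds through the list `E`. -/
def forward (D : BHypergraph V ι) (S : Finset V) (A : Finset ι) (E : List ι) (k : ℕ) : List ι :=
  (fun L => E.foldl (D.fire S A) L)^[k] []

theorem forward_succ (E : List ι) (k : ℕ) :
    D.forward S A E (k + 1) = E.foldl (D.fire S A) (D.forward S A E k) :=
  Function.iterate_succ_apply' _ _ _

theorem reaching_forward (E : List ι) (k : ℕ) : D.Reaching S A (D.forward S A E k) := by
  induction k with
  | zero => exact .nil
  | succ k ih => rw [forward_succ]; exact ih.foldl_fire E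

theorem length_le_foldl_fire (E : List ι) : L.length ≤ (E.foldl (D.fire S A) L).length := by
  induction E generalizing L with
  | nil => exact le_rfl
  | cons b E ih =>
    refine le_trans ?_ (ih (L := D.fire S A L b))
    unfold fire
    split_ifs <;> simp

/-- The first hyperarc that fires appends an entry, and later steps never shorten the list. So a
pass that does not lengthen the list certifies that no hyperarc can fire. -/
theorem foldl_fire_cases (E : List ι) :
    ((∀ b ∈ E, D.fire S A L b = L) ∧ E.foldl (D.fire S A) L = L) ∨
      L.length < (E.foldl (D.fire S A) L).length := by
  induction E with
  | nil => simp
  | cons b E ih =>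
    by_cases hb : D.fire S A L b = L
    · simpa [hb] using ih
    · right
      refine lt_of_lt_of_le ?_ (length_le_foldl_fire (L := D.fire S A L b) E)
      unfold fire at hb ⊢
      split_ifs at hb ⊢ <;> simp_all

/-- Every round before the list becomes stationary adds a hyperarc of `A`. After `A.card` rounds the
list is therefore stationary, or it is long enough to contain all of `A`; either way no hyperarc of
`A` reaches anything new. -/
theorem forward_closed (E : List ι) (hE : ∀ b ∈ A, b ∈ E) {k : ℕ} (hk : A.card ≤ k) (hb : b ∈ A)
    (ht : ∀ v ∈ D.tail b, v ∈ S ∨ v ∈ (D.forward S A E k).map D.head) :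
    D.head b ∈ S ∨ D.head b ∈ (D.forward S A E k).map D.head := by
  have key : ∀ k, (∀ b ∈ E, D.fire S A (D.forward S A E k) b = D.forward S A E k) ∨
      k ≤ (D.forward S A E k).length := by
    intro k
    induction k with
    | zero => simp
    | succ k ih =>
      rw [forward_succ]
      rcases foldl_fire_cases (D := D) (S := S) (A := A) (L := D.forward S A E k) E with h | h
      · rw [h.2]; exact .inl h.1
      · rcases ih with ih | ih
        · exfalso
          -- Since no hyperarc fires on the old list, a whole pass leaves it unchanged, against the
          -- growth in `h`.
          have : ∀ E' : List ι, (∀ b ∈ E', b ∈ E) →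
              E'.foldl (D.fire S A) (D.forward S A E k) = D.forward S A E k := by
            intro E' hE'
            induction E' with
            | nil => rfl
            | cons c E' ih' =>
              rw [List.foldl_cons, ih c (hE' c (by simp)), ih' fun d hd => hE' d (by simp [hd])]
          rw [this E fun _ h => h] at h
          exact lt_irrefl _ h
        · right; omega
  have hr := reaching_forward (D := D) (S := S) (A := A) E k
  rcases key k with h | h
  · by_contra hh
    have := h b (hE b hb)
    rw [fire, if_pos ⟨hb, hh, ht⟩] at this
    simpa using congrArg List.length this
  · right
    have hsub : (D.forward S A E k).toFinset ⊆ A := fun c hc => hr.mem c (List.mem_toFinset.1 hc)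
    have hcard := List.toFinset_card_of_nodup (List.Nodup.of_map _ hr.nodup)
    have := Finset.eq_of_subset_of_card_le hsub (by omega)
    exact List.mem_map_of_mem (List.mem_toFinset.1 (this.ge hb))

theorem bConnected_iff_forward (E : List ι) (hE : ∀ b ∈ A, b ∈ E) {k : ℕ} (hk : A.card ≤ k) :
    D.BConnected A S v ↔ v ∈ S ∨ v ∈ (D.forward S A E k).map D.head := by
  constructor
  · intro h
    induction h with
    | base h => exact .inl h
    | step ha _ ih => exact forward_closed E hE hk ha ih
  · have hr := reaching_forward (D := D) (S := S) (A := A) E k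
    rintro (h | h)
    · exact .base h
    · obtain ⟨b, hb, rfl⟩ := List.mem_map.1 h
      exact hr.ordered.bConnected_head hr.mem b hb

/-- Select, from the end of the list, the hyperarcs that are needed to reach the vertices in `N`. -/
def pruneStep (D : BHypergraph V ι) (b : ι) (p : Finset V × List ι) : Finset V × List ι :=
  if D.head b ∈ p.1 then (p.1 ∪ D.tail b, b :: p.2) else p

theorem pruneStep_of_mem {N : Finset V} {K : List ι} (h : D.head b ∈ N) :
    D.pruneStep b (N, K) = (N ∪ D.tail b, b :: K) := if_pos h

theorem pruneStep_of_notMem {N : Finset V} {K : List ι} (h : D.head b ∉ N) :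
    D.pruneStep b (N, K) = (N, K) := if_neg h

/-- The decisions depend only on the needed vertices and not on the list collected so far. This
turns the accumulator into the recursion `prune_concat`, on which all inductions from the end of the
list rest. -/
theorem foldr_pruneStep_snd (N : Finset V) (K : List ι) :
    (L.foldr D.pruneStep (N, K)).2 = (L.foldr D.pruneStep (N, [])).2 ++ K := by
  induction L using List.reverseRecOn generalizing N K with
  | nil => simp
  | append_singleton L b ih =>
    simp only [List.foldr_append, List.foldr_cons, List.foldr_nil]
    by_cases h : D.head b ∈ N
    · rw [pruneStep_of_mem h, pruneStep_of_mem h, ih _ (b :: K), ih _ [b]]; simp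
    · rw [pruneStep_of_notMem h, pruneStep_of_notMem h, ih _ K]

/-- The hyperarcs of `L` that are needed to reach the vertices in `N`. -/
def prune (D : BHypergraph V ι) (L : List ι) (N : Finset V) : List ι :=
  (L.foldr D.pruneStep (N, [])).2

theorem prune_concat (N : Finset V) : D.prune (L ++ [b]) N =
    if D.head b ∈ N then D.prune L (N ∪ D.tail b) ++ [b] else D.prune L N := by
  unfold prune
  simp only [List.foldr_append, List.foldr_cons, List.foldr_nil]
  split_ifs with h
  · rw [pruneStep_of_mem h, foldr_pruneStep_snd]
  · rw [pruneStep_of_notMem h]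

theorem prune_sublist (N : Finset V) : (D.prune L N).Sublist L := by
  induction L using List.reverseRecOn generalizing N with
  | nil => simp [prune]
  | append_singleton L b ih =>
    rw [prune_concat]
    split_ifs
    · exact (ih _).append (List.Sublist.refl _)
    · exact (ih _).trans (List.sublist_append_left _ _)

theorem Reaching.of_concat (h : D.Reaching S A (L ++ [b])) : D.Reaching S A L :=
  ⟨fun c hc => h.mem c (by simp [hc]), fun c hc => h.head_notMem c (by simp [hc]),
    by have := h.nodup; rw [List.map_append] at this; exact this.of_append_left,
    (ordered_concat.1 h.ordered).1⟩

/-- If the last hyperarc is dropped, its head is not needed, so the needed vertex `v` is a different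
one and was reached by the prefix. -/
theorem Reaching.mem_prune (h : D.Reaching S A L) {N : Finset V} (hv : v ∈ N)
    (hr : v ∈ S ∨ v ∈ L.map D.head) : v ∈ S ∨ v ∈ (D.prune L N).map D.head := by
  induction L using List.reverseRecOn generalizing N v with
  | nil => simp_all
  | append_singleton L b ih =>
    rw [prune_concat]
    have hr : (v ∈ S ∨ v ∈ L.map D.head) ∨ v = D.head b := by simpa [or_assoc] using hr
    split_ifs with hb
    · rcases hr with hr | rfl
      · have := ih h.of_concat (N := N ∪ D.tail b) (by simp [hv]) hr
        rw [List.map_append, List.mem_append]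
        tauto
      · simp
    · rcases hr with hr | rfl
      · exact ih h.of_concat hv hr
      · exact absurd hv hb

theorem Reaching.prune (h : D.Reaching S A L) (N : Finset V) : D.Reaching S A (D.prune L N) := by
  refine ⟨fun c hc => h.mem c ((prune_sublist N).subset hc),
    fun c hc => h.head_notMem c ((prune_sublist N).subset hc),
    h.nodup.sublist ((prune_sublist N).map _), ?_⟩
  induction L using List.reverseRecOn generalizing N with
  | nil => simpa [BHypergraph.prune] using ordered_nil
  | append_singleton L b ih =>
    rw [prune_concat]
    split_ifs
    · refine ordered_concat.2 ⟨ih h.of_concat _, fun v hv => ?_⟩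
      exact h.of_concat.mem_prune (by simp [hv]) ((ordered_concat.1 h.ordered).2 v hv)
    · exact ih h.of_concat _

/-- The source of minimality. A needed head lies outside `S`, so `R` must contain a hyperarc with
this head, and by `hR` it can only be the kept one. Its tails are connected by `R` too, so they can
be added to the needed vertices and the induction goes on towards the front. -/
theorem Reaching.prune_subset (h : D.Reaching S A L) {N : Finset V}
    (hR : ∀ c ∈ R, ∀ b ∈ L, D.head c = D.head b → c = b) (hN : D.Connects S N R) :
    (D.prune L N).toFinset ⊆ R := by
  induction L using List.reverseRecOn generalizing N with
  | nil => simp [BHypergraph.prune]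
  | append_singleton L b ih =>
    have hR' : ∀ c ∈ R, ∀ b ∈ L, D.head c = D.head b → c = b :=
      fun c hc d hd => hR c hc d (by simp [hd])
    rw [prune_concat]
    split_ifs with hb
    · rcases (hN _ hb).mem_or_exists with hS | ⟨c, hc, hcb, ht⟩
      · exact absurd hS (h.head_notMem b (by simp))
      · obtain rfl := hR c hc b (by simp) hcb
        have := ih h.of_concat hR' (N := N ∪ D.tail c) (fun t ht' => by
          rcases Finset.mem_union.1 ht' with h' | h'
          · exact hN t h'
          · exact ht t h')
        intro x hx
        simp only [List.toFinset_append, Finset.mem_union, List.mem_toFinset,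
          List.mem_singleton] at hx
        rcases hx with hx | rfl
        · exact this (List.mem_toFinset.2 hx)
        · exact hc
    · exact ih h.of_concat hR' hN

theorem Reaching.head_inj (h : D.Reaching S A L) (ha : a ∈ L) (hb : b ∈ L)
    (hab : D.head a = D.head b) : a = b :=
  List.inj_on_of_nodup_map h.nodup ha hb hab

/-- The hyperarcs selected from a list that reaches all targets form an inclusion-wise minimal set
that connects the targets. -/
structure IsPath (D : BHypergraph V ι) (S T : Finset V) (A : Finset ι) (K : List ι) : Prop
    extends D.Reaching S A K where
  connects : D.Connects S T K.toFinset
  minimal : ∀ R ⊆ K.toFinset, D.Connects S T R → K.toFinset ⊆ R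

theorem Reaching.isPath_prune (h : D.Reaching S A L)
    (hT : ∀ t ∈ T, t ∈ S ∨ t ∈ L.map D.head) : D.IsPath S T A (D.prune L T) := by
  refine ⟨h.prune T, fun t ht => ?_, fun R hR hc => h.prune_subset (fun c hc b hb hcb => ?_) hc⟩
  · rcases h.mem_prune ht (hT t ht) with hS | hm
    · exact .base hS
    · obtain ⟨b, hb, rfl⟩ := List.mem_map.1 hm
      exact (h.prune T).ordered.bConnected_head (by simp) b hb
  · exact h.head_inj ((prune_sublist T).subset (List.mem_toFinset.1 (hR hc))) hb hcb

theorem exists_isPath (h : D.Connects S T A) : ∃ K, D.IsPath S T A K :=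
  ⟨_, (reaching_forward A.toList A.card).isPath_prune fun t ht =>
    (bConnected_iff_forward A.toList (by simp) le_rfl).1 (h t ht)⟩

theorem IsPath.nodup_list {K : List ι} (h : D.IsPath S T A K) : K.Nodup :=
  List.Nodup.of_map _ h.nodup

theorem IsPath.isOrderedHyperpath {K : List ι} (h : D.IsPath S T D.arcs K) :
    D.IsOrderedHyperpath S T K :=
  ⟨h.nodup_list, isHyperpath_iff.2
    ⟨fun c hc => h.mem c (List.mem_toFinset.1 hc), h.connects, h.minimal⟩, h.ordered⟩

end Forward

/-! ### Deletion, contraction, and correctness of the enumeration -/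

section Branching

theorem exists_isHyperpath_iff : (∃ Q, D.IsHyperpath S T Q) ↔ D.Connects S T D.arcs := by
  refine ⟨fun ⟨Q, h⟩ => h.connects.mono h.subset_arcs, fun h => ?_⟩
  obtain ⟨K, hK⟩ := exists_isPath h
  exact ⟨_, hK.isOrderedHyperpath.2.1⟩

/-- The properties of a hyperarc `a` that branching on it relies on. -/
structure Branches (D : BHypergraph V ι) (S T : Finset V) (a : ι) : Prop where
  mem : a ∈ D.arcs
  head_mem : D.head a ∈ T
  head_notMem : D.head a ∉ S
  head_notMem_tail : D.head a ∉ D.tail a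

/-- Everything follows from `hnew`: dropping `a` can lose no vertex except `head a`, yet by
minimality it loses a target. -/
theorem IsOrderedHyperpath.branches (h : D.IsOrderedHyperpath S T (L ++ [a])) :
    D.Branches S T a := by
  obtain ⟨hnd, hp, ho⟩ := h
  have ho : D.Ordered S (L ++ [a]) := ho
  rw [ordered_concat] at ho
  have haL : a ∉ L := by
    rw [List.nodup_append] at hnd
    exact fun h => hnd.2.2 a h a (by simp) rfl
  have hL : ∀ b ∈ L, D.BConnected L.toFinset S (D.head b) :=
    ho.1.bConnected_head (by simp)
  have hS : ∀ v, v ∈ S ∨ v ∈ L.map D.head → D.BConnected L.toFinset S v := by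
    rintro v (hv | hv)
    · exact .base hv
    · obtain ⟨b, hb, rfl⟩ := List.mem_map.1 hv
      exact hL b hb
  have hno : ¬ D.Connects S T L.toFinset := fun hc => by
    have := hp.eq_of_subset (R := L.toFinset) (by simp) hc
    have : a ∈ L.toFinset := this ▸ (by simp)
    exact haL (List.mem_toFinset.1 this)
  have hall : ∀ v, D.BConnected (L ++ [a]).toFinset S v →
      D.BConnected L.toFinset S v ∨ v = D.head a := by
    intro v hv
    rcases hv.mem_or_exists with h | ⟨b, hb, rfl, -⟩
    · exact .inl (.base h)
    · simp only [List.toFinset_append, Finset.mem_union, List.mem_toFinset,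
        List.mem_singleton] at hb
      rcases hb with hb | rfl
      · exact .inl (hL b hb)
      · exact .inr rfl
  have hnew : ¬ D.BConnected L.toFinset S (D.head a) := fun hc => hno fun t ht => by
    rcases hall t (hp.connects t ht) with h | rfl
    · exact h
    · exact hc
  refine ⟨hp.subset_arcs (by simp), ?_, fun h => hnew (.base h), fun h => hnew (hS _ (ho.2 _ h))⟩
  by_contra hT
  refine hno fun t ht => ?_
  rcases hall t (hp.connects t ht) with h | rfl
  · exact h
  · exact absurd ht hT

theorem mem_contract_arcs : b ∈ (D.contract a).arcs ↔ b ∈ D.arcs ∧ D.head b ≠ D.head a := by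
  simp [contract]

theorem contract_tail_of_mem (h : D.head a ∈ D.tail b) :
    (D.contract a).tail b = (D.tail b).erase (D.head a) ∪ D.tail a := if_pos h

theorem contract_tail_of_notMem (h : D.head a ∉ D.tail b) :
    (D.contract a).tail b = D.tail b := if_neg h

/-- Derivations are translated by letting the set `tail a` play the role of `head a`. From the
contraction back to `D` this requires all of `tail a` to be derivable first, which holds because the
tails of `a` outside `S` are among the new targets. -/
theorem Branches.connects_contract_iff (h : D.Branches S T a) (hQ : Q ⊆ (D.contract a).arcs) :
    (D.contract a).Connects S (D.newTargets S T a) Q ↔ D.Connects S T (Q ∪ {a}) := by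
  constructor
  · intro hc
    have key : ∀ v, (D.contract a).BConnected Q S v →
        (∀ u ∈ D.tail a, D.BConnected (Q ∪ {a}) S u) → D.BConnected (Q ∪ {a}) S v := by
      intro v hv ha
      induction hv with
      | base h => exact .base h
      | @step b hb _ ih =>
        refine .step (Finset.mem_union_left _ hb) fun v hv => ?_
        by_cases hab : D.head a ∈ D.tail b
        · by_cases hva : v = D.head a
          · exact hva ▸ .step (by simp) ha
          · exact ih v (by rw [contract_tail_of_mem hab]; simp [hva, hv])
        · exact ih v (by rwa [contract_tail_of_notMem hab])
    -- This avoids circularity: either a derivation never uses a modified tail set, and then it is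
    -- valid in `D`, or before the first such use all of `tail a` has been derived in `D`.
    have key2 : ∀ v, (D.contract a).BConnected Q S v → D.BConnected (Q ∪ {a}) S v ∨
        ∃ b ∈ Q, D.head a ∈ D.tail b ∧ ∀ u ∈ D.tail a, D.BConnected (Q ∪ {a}) S u := by
      intro v hv
      induction hv with
      | base h => exact .inl (.base h)
      | @step b hb _ ih =>
        by_cases hex : ∃ b ∈ Q, D.head a ∈ D.tail b ∧
          ∀ u ∈ D.tail a, D.BConnected (Q ∪ {a}) S u
        · exact .inr hex
        have ih : ∀ v ∈ (D.contract a).tail b, D.BConnected (Q ∪ {a}) S v :=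
          fun v hv => (ih v hv).resolve_right hex
        by_cases hab : D.head a ∈ D.tail b
        · exact .inr ⟨b, hb, hab, fun u hu => ih u (by rw [contract_tail_of_mem hab]; simp [hu])⟩
        · exact .inl (.step (Finset.mem_union_left _ hb) fun v hv =>
            ih v (by rwa [contract_tail_of_notMem hab]))
    have htail : ∀ u ∈ D.tail a, D.BConnected (Q ∪ {a}) S u := by
      intro u hu
      by_cases huS : u ∈ S
      · exact .base huS
      · have hua : u ≠ D.head a := fun h' => h.head_notMem_tail (h' ▸ hu)
        rcases key2 u (hc u (by simp [newTargets, hu, huS, hua])) with h' | ⟨b, -, -, h'⟩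
        · exact h'
        · exact h' u hu
    intro t ht
    by_cases htS : t ∈ S
    · exact .base htS
    · by_cases hta : t = D.head a
      · exact hta ▸ .step (by simp) htail
      · exact key t (hc t (by simp [newTargets, ht, htS, hta])) htail
  · intro hc
    -- Reaching `head a` in `D` corresponds to reaching all of `tail a` in the contraction, since no
    -- hyperarc of `Q` has this head.
    have key : ∀ v, D.BConnected (Q ∪ {a}) S v →
        (v ≠ D.head a → (D.contract a).BConnected Q S v) ∧
        (v = D.head a → ∀ u ∈ D.tail a, (D.contract a).BConnected Q S u) := by
      intro v hv
      induction hv with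
      | base hv => exact ⟨fun _ => .base hv, fun hva => absurd (hva ▸ hv) h.head_notMem⟩
      | @step b hb _ ih =>
        rcases Finset.mem_union.1 hb with hb | hb
        · refine ⟨fun _ => .step (D := D.contract a) hb fun v hv => ?_,
            fun hba => absurd hba (mem_contract_arcs.1 (hQ hb)).2⟩
          by_cases hab : D.head a ∈ D.tail b
          · rw [contract_tail_of_mem hab] at hv
            rcases Finset.mem_union.1 hv with hv | hv
            · exact (ih v (Finset.mem_of_mem_erase hv)).1 (Finset.ne_of_mem_erase hv)
            · exact (ih _ hab).2 rfl v hv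
          · rw [contract_tail_of_notMem hab] at hv
            exact (ih v hv).1 fun hva => hab (hva ▸ hv)
        · obtain rfl := Finset.mem_singleton.1 hb
          exact ⟨fun hne => absurd rfl hne, fun _ u hu =>
            (ih u hu).1 fun hva => h.head_notMem_tail (hva ▸ hu)⟩
    intro t ht
    simp only [newTargets, Finset.mem_sdiff, Finset.mem_union, Finset.mem_singleton,
      not_or] at ht
    rcases ht.1 with ht' | ht'
    · exact (key t (hc t ht')).1 ht.2.2
    · obtain ⟨c, hcQ, hca, hct⟩ := (hc _ h.head_mem).mem_or_exists.resolve_left h.head_notMem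
      -- As `head a` is itself a target, its derivation in `D` yields the tails of `a`, the targets
      -- added by the contraction.
      exact (key _ (hc _ h.head_mem)).2 rfl t ht'

theorem Branches.mem_of_connects (h : D.Branches S T a) {Q : Finset ι}
    (hQ : ∀ b ∈ Q, D.head b = D.head a → b = a) (hc : D.Connects S T Q) : a ∈ Q := by
  obtain ⟨c, hcQ, hca, -⟩ := (hc _ h.head_mem).mem_or_exists.resolve_left h.head_notMem
  exact hQ c hcQ hca ▸ hcQ

theorem bConnected_delete_iff : (D.delete a).BConnected R S v ↔ D.BConnected R S v := by
  constructor <;> intro h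
  · induction h with
    | base h => exact .base h
    | step h _ ih => exact .step (D := D) h ih
  · induction h with
    | base h => exact .base h
    | step h _ ih => exact .step (D := D.delete a) h ih

theorem isHyperpath_delete_iff : (D.delete a).IsHyperpath S T Q ↔ D.IsHyperpath S T Q ∧ a ∉ Q := by
  have hC : ∀ {R}, (D.delete a).Connects S T R ↔ D.Connects S T R :=
    fun {R} => forall₂_congr fun _ _ => bConnected_delete_iff
  simp only [isHyperpath_iff, hC]
  simp only [delete, Finset.subset_erase]
  tauto

/-- Searching and pruning inside `Q` gives a connecting list with distinct heads; by minimality it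
exhausts `Q`. -/
theorem IsHyperpath.unique_head (h : D.IsHyperpath S T Q) (ha : a ∈ Q) (hb : b ∈ Q)
    (hab : D.head b = D.head a) : b = a := by
  obtain ⟨K, hK⟩ := exists_isPath h.connects
  have := h.eq_of_subset (fun c hc => hK.mem c (List.mem_toFinset.1 hc)) hK.connects
  rw [← this, List.mem_toFinset] at ha hb
  exact hK.head_inj hb ha hab

/-- The map `R ↦ R ∪ {a}` preserves inclusion and connection, so minimality carries over. It misses
no hyperpath through `a`, because such a hyperpath contains no other hyperarc with head `head a`. -/
theorem Branches.isHyperpath_iff_exists (h : D.Branches S T a) : D.IsHyperpath S T Q ∧ a ∈ Q ↔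
    ∃ R, (D.contract a).IsHyperpath S (D.newTargets S T a) R ∧ R ∪ {a} = Q := by
  constructor
  · rintro ⟨hQ, ha⟩
    have hsub : Q.erase a ⊆ (D.contract a).arcs := fun b hb =>
      mem_contract_arcs.2 ⟨hQ.subset_arcs (Finset.mem_of_mem_erase hb), fun hh =>
        Finset.ne_of_mem_erase hb (hQ.unique_head ha (Finset.mem_of_mem_erase hb) hh)⟩
    have hun : Q.erase a ∪ {a} = Q := by
      ext x; by_cases hx : x = a <;> simp [hx, ha]
    refine ⟨Q.erase a, isHyperpath_iff.2 ⟨hsub, ?_, fun R hR hc => ?_⟩, hun⟩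
    · rw [h.connects_contract_iff hsub, hun]
      exact hQ.connects
    · rw [h.connects_contract_iff (hR.trans hsub)] at hc
      have := hQ.eq_of_subset (R := R ∪ {a}) (hun ▸ Finset.union_subset_union_left hR) hc
      intro x hx
      have hx' : x ∈ R ∪ {a} := this ▸ Finset.mem_of_mem_erase hx
      simpa [Finset.ne_of_mem_erase hx] using hx'
  · rintro ⟨R, hR, rfl⟩
    have huniq : ∀ b ∈ R ∪ {a}, D.head b = D.head a → b = a := by
      intro b hb hba
      rcases Finset.mem_union.1 hb with hb | hb
      · exact absurd hba (mem_contract_arcs.1 (hR.subset_arcs hb)).2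
      · exact Finset.mem_singleton.1 hb
    refine ⟨isHyperpath_iff.2 ⟨fun b hb => ?_, (h.connects_contract_iff hR.subset_arcs).1
      hR.connects, fun Q hQ hc => ?_⟩, by simp⟩
    · rcases Finset.mem_union.1 hb with hb | hb
      · exact (mem_contract_arcs.1 (hR.subset_arcs hb)).1
      · exact Finset.mem_singleton.1 hb ▸ h.mem
    · have ha := h.mem_of_connects (fun b hb => huniq b (hQ hb)) hc
      have hsub : Q.erase a ⊆ R := fun b hb => by
        simpa [Finset.ne_of_mem_erase hb] using hQ (Finset.mem_of_mem_erase hb)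
      have hun : Q.erase a ∪ {a} = Q := by
        ext x; by_cases hx : x = a <;> simp [hx, ha]
      have := hR.eq_of_subset hsub
        ((h.connects_contract_iff (hsub.trans hR.subset_arcs)).2 (by rwa [hun]))
      rw [← this, hun]

/-- New targets avoid `S`, so the hypothesis on the initial target set reproduces itself under
contraction. -/
theorem newTargets_eq_empty (h : D.newTargets S T a ⊆ S) : D.newTargets S T a = ∅ := by
  refine Finset.eq_empty_of_forall_notMem fun v hv => ?_
  have := h hv
  simp only [newTargets, Finset.mem_sdiff, Finset.mem_union, not_or] at hv
  exact hv.2.1 this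

theorem card_delete_lt (h : a ∈ D.arcs) : (D.delete a).arcs.card < D.arcs.card :=
  Finset.card_erase_lt_of_mem h

theorem card_contract_lt (h : a ∈ D.arcs) : (D.contract a).arcs.card < D.arcs.card := by
  refine Finset.card_lt_card ⟨Finset.filter_subset _ _, fun hs => ?_⟩
  exact (mem_contract_arcs.1 (hs h)).2 rfl

theorem acc_recCall (D : BHypergraph V ι) (S T : Finset V) : Acc (RecCall S) (D, T) := by
  induction hn : D.arcs.card using Nat.strong_induction_on generalizing D T with
  | _ n ih =>
    subst hn
    refine ⟨_, fun y hy => ?_⟩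
    rcases hy with ⟨_, _, L, a, hT, hL⟩ | ⟨_, _, L, a, hT, hL⟩
    · exact ih _ (card_delete_lt hL.branches.mem) _ _ rfl
    · exact ih _ (card_contract_lt hL.branches.mem) _ _ rfl

theorem exists_ordered_concat (hT : T ⊆ S → T = ∅) (hne : T ≠ ∅)
    (h : ∃ Q, D.IsHyperpath S T Q) : ∃ L a, D.IsOrderedHyperpath S T (L ++ [a]) := by
  obtain ⟨K, hK⟩ := exists_isPath (exists_isHyperpath_iff.1 h)
  have hK := hK.isOrderedHyperpath
  rcases List.eq_nil_or_concat' K with rfl | ⟨L, a, rfl⟩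
  · exact absurd (hT (connects_empty_arcs.1 hK.2.1.connects)) hne
  · exact ⟨L, a, hK⟩

theorem exists_enumHyperpaths (D : BHypergraph V ι) (S T : Finset V) (P : Finset ι)
    (hT : T ⊆ S → T = ∅) : ∃ out, EnumHyperpaths S D T P out := by
  induction hn : D.arcs.card using Nat.strong_induction_on generalizing D T P with
  | _ n ih =>
    subst hn
    by_cases hne : T = ∅
    · subst hne
      exact ⟨_, EnumHyperpaths.output D P⟩
    by_cases hex : ∃ Q, D.IsHyperpath S T Q
    · obtain ⟨L, a, hL⟩ := exists_ordered_concat hT hne hex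
      obtain ⟨o₀, h₀⟩ := ih _ (card_delete_lt hL.branches.mem) (D.delete a) T P hT rfl
      obtain ⟨o₁, h₁⟩ := ih _ (card_contract_lt hL.branches.mem) (D.contract a)
        (D.newTargets S T a) (P ∪ {a}) newTargets_eq_empty rfl
      exact ⟨_, .branch D T P L a o₀ o₁ hne hL h₀ h₁⟩
    · exact ⟨_, .none D T P hne hex⟩

theorem isHyperpath_empty_targets : D.IsHyperpath S ∅ Q ↔ Q = ∅ := by
  rw [isHyperpath_iff]
  constructor
  · intro h
    exact Finset.subset_empty.1 (h.2.2 ∅ (by simp) (by simp [Connects]))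
  · rintro rfl
    simp [Connects]

/-- Since `P` is disjoint from the current hyperarcs, an output shows whether its hyperpath contains
`a`. Hence the outputs of the two recursive calls are disjoint. -/
theorem EnumHyperpaths.correct {P : Finset ι} {out : List (Finset ι)}
    (h : EnumHyperpaths S D T P out) (hP : Disjoint P D.arcs) :
    out.Nodup ∧ ∀ R, R ∈ out ↔ ∃ Q, D.IsHyperpath S T Q ∧ P ∪ Q = R := by
  induction h with
  | output D P => simp [isHyperpath_empty_targets, eq_comm]
  | none D T P hT hno =>
    refine ⟨by simp, fun R => ⟨by simp, ?_⟩⟩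
    rintro ⟨Q, hQ, -⟩
    exact absurd ⟨Q, hQ⟩ hno
  | branch D T P L a o₀ o₁ hT hL h₀ h₁ ih₀ ih₁ =>
    have hb := hL.branches
    have haP : a ∉ P := fun h => Finset.disjoint_left.1 hP h hb.mem
    obtain ⟨hn₀, hm₀⟩ := ih₀ (hP.mono_right (Finset.erase_subset _ _))
    obtain ⟨hn₁, hm₁⟩ := ih₁ (by
      rw [Finset.disjoint_union_left, Finset.disjoint_singleton_left]
      exact ⟨hP.mono_right (Finset.filter_subset _ _), fun h => (mem_contract_arcs.1 h).2 rfl⟩)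
    refine ⟨List.nodup_append.2 ⟨hn₀, hn₁, ?_⟩, fun R => ?_⟩
    · rintro R h0 _ h1 rfl
      obtain ⟨Q, hQ, rfl⟩ := (hm₀ R).1 h0
      obtain ⟨Q', hQ', heq⟩ := (hm₁ _).1 h1
      have : a ∈ P ∪ Q := heq ▸ (by simp)
      exact (Finset.mem_union.1 this).elim haP (isHyperpath_delete_iff.1 hQ).2
    · rw [List.mem_append, hm₀, hm₁]
      constructor
      · rintro (⟨Q, hQ, rfl⟩ | ⟨Q, hQ, rfl⟩)
        · exact ⟨Q, (isHyperpath_delete_iff.1 hQ).1, rfl⟩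
        · exact ⟨Q ∪ {a}, (hb.isHyperpath_iff_exists.2 ⟨Q, hQ, rfl⟩).1, by
            rw [Finset.union_assoc, Finset.union_comm {a}]⟩
      · rintro ⟨Q, hQ, rfl⟩
        by_cases ha : a ∈ Q
        · obtain ⟨R, hR, rfl⟩ := hb.isHyperpath_iff_exists.1 ⟨hQ, ha⟩
          exact .inr ⟨R, hR, by rw [Finset.union_assoc, Finset.union_comm {a}]⟩
        · exact .inl ⟨Q, isHyperpath_delete_iff.2 ⟨hQ, ha⟩, rfl⟩

end Branching

/-! ### Recursive calls described inside the original hypergraph -/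

section Nodes

/-- `Node D₀ T₀ S D T P A`: in a call of the procedure with hypergraph `D`, target set `T` and
output prefix `P`, reached from `D₀` and `T₀`, the hyperpaths can be found among the subsets of `A`
in the original hypergraph. -/
structure Node (D₀ : BHypergraph V ι) (T₀ S : Finset V) (D : BHypergraph V ι) (T : Finset V)
    (P A : Finset ι) : Prop where
  head : D.head = D₀.head
  arcs : A = P ∪ D.arcs
  disj : Disjoint P D.arcs
  head_ne : ∀ b ∈ D.arcs, ∀ p ∈ P, D.head b ≠ D.head p
  targets : T ⊆ S → T = ∅
  connects_iff : ∀ Q ⊆ D.arcs, D.Connects S T Q ↔ D₀.Connects S T₀ (Q ∪ P)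
  subset : ∀ R ⊆ A, D₀.Connects S T₀ R → P ⊆ R
  ordered : ∀ L : List ι, D₀.Reaching S A L → P ⊆ L.toFinset →
    D.Ordered S (L.filter (· ∉ P))

variable {D₀ : BHypergraph V ι} {T₀ : Finset V} {P : Finset ι}

theorem Node.root (hT : T ⊆ S → T = ∅) : Node D T S D T ∅ D.arcs where
  head := rfl
  arcs := by simp
  disj := by simp
  head_ne := by simp
  targets := hT
  connects_iff := by simp
  subset := by simp
  ordered := fun L hL _ => by simpa using hL.ordered

theorem Node.delete (h : Node D₀ T₀ S D T P A) (ha : a ∈ D.arcs) :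
    Node D₀ T₀ S (D.delete a) T P (A.erase a) where
  head := h.head
  arcs := by
    have : a ∉ P := fun h' => Finset.disjoint_left.1 h.disj h' ha
    rw [h.arcs, Finset.erase_union_distrib, Finset.erase_eq_of_notMem this]
    rfl
  disj := h.disj.mono_right (Finset.erase_subset _ _)
  head_ne := fun b hb => h.head_ne b (Finset.mem_of_mem_erase hb)
  targets := h.targets
  connects_iff := fun Q hQ => by
    rw [← h.connects_iff Q (hQ.trans (Finset.erase_subset _ _))]
    exact forall₂_congr fun _ _ => bConnected_delete_iff
  subset := fun R hR => h.subset R (hR.trans (Finset.erase_subset _ _))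
  ordered := fun L hL hP => h.ordered L
    ⟨fun b hb => Finset.mem_of_mem_erase (hL.mem b hb), hL.head_notMem, hL.nodup, hL.ordered⟩ hP

/-- A hyperarc with tail `head a` comes after `a`, the only hyperarc of the list with this head. The
tails of `a` that replace `head a` were therefore available in time, without the help of `a`. -/
theorem Ordered.contract (ho : D.Ordered S L) (hS : ∀ b ∈ L, D.head b ∉ S)
    (hn : (L.map D.head).Nodup) (ha : a ∈ L) :
    (D.contract a).Ordered S (L.filter (· ≠ a)) := by
  have hinj : ∀ b ∈ L, D.head b = D.head a → b = a := fun b hb hba =>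
    List.inj_on_of_nodup_map hn hb ha hba
  -- The second claim about prefixes provides the vertices that replace `head a` in later tails.
  have key : ∀ L₁ L₂, L = L₁ ++ L₂ → (D.contract a).Ordered S (L₁.filter (· ≠ a)) ∧
      (a ∈ L₁ → ∀ v ∈ D.tail a, v ∈ S ∨ v ∈ (L₁.filter (· ≠ a)).map D.head) := by
    intro L₁
    induction L₁ using List.reverseRecOn with
    | nil => exact fun _ _ => ⟨by simpa using ordered_nil, by simp⟩
    | append_singleton L₁ b ih =>
      intro L₂ hL
      obtain ⟨ih₁, ih₂⟩ := ih (b :: L₂) (by simpa using hL)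
      have htail : ∀ v ∈ D.tail b, v ∈ S ∨ ∃ c ∈ L₁, D.head c = v :=
        ho L₁ L₂ b (by simpa using hL)
      have hmem : ∀ c ∈ L₁, c ∈ L := fun c hc => by simp [hL, hc]
      have hbL : b ∈ L := by simp [hL]
      have hfil : ∀ v ≠ D.head a, v ∈ D.tail b →
          v ∈ S ∨ v ∈ (L₁.filter (· ≠ a)).map D.head := by
        intro v hva hv
        rcases htail v hv with h | ⟨c, hc, rfl⟩
        · exact .inl h
        · refine .inr (List.mem_map_of_mem (List.mem_filter.2 ⟨hc, ?_⟩))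
          simpa using fun h : c = a => hva (h ▸ rfl)
      by_cases hba : b = a
      · subst hba
        refine ⟨by simpa using ih₁, fun _ v hv => ?_⟩
        have hvb : v ≠ D.head b := by
          rintro rfl
          rcases htail _ hv with h | ⟨c, hc, hcb⟩
          · exact hS b hbL h
          · obtain rfl := hinj c (hmem c hc) hcb
            rw [hL] at hn
            simp only [List.map_append, List.append_assoc, List.nodup_append] at hn
            exact hn.2.2 _ (List.mem_map_of_mem hc) (D.head c) (by simp) rfl
        simpa using hfil v hvb hv
      · have hfe : (L₁ ++ [b]).filter (· ≠ a) = L₁.filter (· ≠ a) ++ [b] := by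
          simp [List.filter_append, hba]
        rw [hfe]
        refine ⟨ordered_concat.2 ⟨ih₁, fun v hv => ?_⟩, fun ha₁ v hv => ?_⟩
        · show v ∈ S ∨ v ∈ (L₁.filter (· ≠ a)).map D.head
          by_cases hab : D.head a ∈ D.tail b
          · rw [contract_tail_of_mem hab] at hv
            rcases Finset.mem_union.1 hv with hv | hv
            · exact hfil v (Finset.ne_of_mem_erase hv) (Finset.mem_of_mem_erase hv)
            · refine ih₂ ?_ v hv
              rcases htail _ hab with h | ⟨c, hc, hca⟩
              · exact absurd h (hS a ha)
              · exact hinj c (hmem c hc) hca ▸ hc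
          · rw [contract_tail_of_notMem hab] at hv
            exact hfil v (fun h => hab (h ▸ hv)) hv
        · have : a ∈ L₁ := by simpa [Ne.symm hba] using ha₁
          rw [List.map_append, List.mem_append]
          have := ih₂ this v hv
          tauto
  exact (key L [] (by simp)).1

/-- In the original hypergraph, contracting `a` means to remove all other hyperarcs with its head
but to keep `a`. As `head a` has to be reached, every connecting subset of what remains contains
`a`, which extends `subset`. -/
theorem Node.contract (h : Node D₀ T₀ S D T P A) (ha : D.Branches S T a) :
    Node D₀ T₀ S (D.contract a) (D.newTargets S T a) (P ∪ {a})
      (insert a (A.filter fun b => D₀.head b ≠ D₀.head a)) where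
  head := h.head
  arcs := by
    ext b
    have h₁ := h.head_ne a ha.mem
    simp only [h.arcs, Finset.mem_insert, Finset.mem_filter, Finset.mem_union,
      Finset.mem_singleton, mem_contract_arcs, ← h.head]
    by_cases hb : b ∈ P
    · have := h₁ b hb
      tauto
    · tauto
  disj := by
    rw [Finset.disjoint_union_left, Finset.disjoint_singleton_left]
    exact ⟨h.disj.mono_right (Finset.filter_subset _ _), fun h => (mem_contract_arcs.1 h).2 rfl⟩
  head_ne := fun b hb p hp => by
    rw [mem_contract_arcs] at hb
    rcases Finset.mem_union.1 hp with hp | hp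
    · exact h.head_ne b hb.1 p hp
    · exact Finset.mem_singleton.1 hp ▸ hb.2
  targets := newTargets_eq_empty
  connects_iff := fun Q hQ => by
    have hsub : Q ∪ {a} ⊆ D.arcs :=
      Finset.union_subset (hQ.trans (Finset.filter_subset _ _)) (by simpa using ha.mem)
    rw [ha.connects_contract_iff hQ, h.connects_iff _ hsub, Finset.union_assoc,
      Finset.union_comm {a}]
  subset := fun R hR hc => by
    have hRA : R ⊆ A := fun b hb => by
      rcases Finset.mem_insert.1 (hR hb) with rfl | h'
      · rw [h.arcs]; exact Finset.mem_union_right _ ha.mem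
      · exact (Finset.mem_filter.1 h').1
    have hPR := h.subset R hRA hc
    refine Finset.union_subset hPR (Finset.singleton_subset_iff.2 ?_)
    have hsub : R \ P ⊆ D.arcs := fun b hb => by
      have := hRA (Finset.mem_sdiff.1 hb).1
      rw [h.arcs] at this
      exact (Finset.mem_union.1 this).resolve_left (Finset.mem_sdiff.1 hb).2
    refine (Finset.mem_sdiff.1 (ha.mem_of_connects (fun b hb hba => ?_) ((h.connects_iff _ hsub).2
      (by rwa [Finset.sdiff_union_of_subset hPR])))).1
    rcases Finset.mem_insert.1 (hR (Finset.mem_sdiff.1 hb).1) with rfl | h'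
    · rfl
    · exact absurd (h.head ▸ hba) (Finset.mem_filter.1 h').2
  ordered := fun L hL hP => by
    have haP : a ∉ P := fun h' => Finset.disjoint_left.1 h.disj h' ha.mem
    have hRA : D₀.Reaching S A L := ⟨fun b hb => by
      rcases Finset.mem_insert.1 (hL.mem b hb) with rfl | h'
      · rw [h.arcs]; exact Finset.mem_union_right _ ha.mem
      · exact (Finset.mem_filter.1 h').1, hL.head_notMem, hL.nodup, hL.ordered⟩
    have ho := h.ordered L hRA (Finset.union_subset_left hP)
    have haL : a ∈ L := List.mem_toFinset.1 (hP (by simp))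
    have := ho.contract (a := a) (fun b hb => h.head ▸ hL.head_notMem b (List.mem_filter.1 hb).1)
      (by rw [h.head]; exact hL.nodup.sublist (List.filter_sublist.map _))
      (List.mem_filter.2 ⟨haL, by simpa using haP⟩)
    rw [List.filter_filter] at this
    convert this using 2
    ext b
    by_cases hb : b = a <;> by_cases hbP : b ∈ P <;> simp [hb, hbP]

theorem Node.not_connects (h : Node D₀ T₀ S D T P A) (hc : ¬ D₀.Connects S T₀ A) :
    T ≠ ∅ ∧ ¬ ∃ Q, D.IsHyperpath S T Q := by
  rw [exists_isHyperpath_iff, h.connects_iff _ subset_rfl, Finset.union_comm, ← h.arcs]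
  refine ⟨?_, hc⟩
  rintro rfl
  refine hc (Connects.mono ?_ ((h.connects_iff ∅ (by simp)).1 (by simp [Connects])))
  rw [h.arcs]
  simp

variable {K : List ι}

theorem Node.subset_path (h : Node D₀ T₀ S D T P A) (hK : D₀.IsPath S T₀ A K) :
    P ⊆ K.toFinset :=
  h.subset _ (fun b hb => hK.mem b (List.mem_toFinset.1 hb)) hK.connects

/-- If `R` is a part of `K` without `P` and connects the current targets, then `R ∪ P ⊆ K` connects
the original ones, so minimality of `K` gives `R ∪ P = K`. -/
theorem Node.isOrderedHyperpath (h : Node D₀ T₀ S D T P A) (hK : D₀.IsPath S T₀ A K) :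
    D.IsOrderedHyperpath S T (K.filter (· ∉ P)) := by
  have hP := h.subset_path hK
  have hsub : (K.filter (· ∉ P)).toFinset ⊆ D.arcs := fun b hb => by
    simp only [List.mem_toFinset, List.mem_filter, decide_eq_true_eq] at hb
    have := hK.mem b hb.1
    rw [h.arcs] at this
    exact (Finset.mem_union.1 this).resolve_left hb.2
  refine ⟨hK.nodup_list.filter _, isHyperpath_iff.2 ⟨hsub, ?_, fun R hR hc => ?_⟩,
    h.ordered K hK.toReaching hP⟩
  · rw [h.connects_iff _ hsub]
    refine hK.connects.mono fun b hb => ?_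
    simp only [Finset.mem_union, List.mem_toFinset, List.mem_filter, decide_eq_true_eq]
    have := List.mem_toFinset.1 hb
    tauto
  · rw [h.connects_iff _ (hR.trans hsub)] at hc
    have := hK.minimal (R ∪ P) (Finset.union_subset (fun b hb => ?_) hP) hc
    · intro b hb
      simp only [List.mem_toFinset, List.mem_filter, decide_eq_true_eq] at hb
      exact (Finset.mem_union.1 (this (List.mem_toFinset.2 hb.1))).resolve_right hb.2
    · have := hR hb
      simp only [List.mem_toFinset, List.mem_filter] at this ⊢
      exact this.1

theorem Node.eq_empty_of_filter_eq_nil (h : Node D₀ T₀ S D T P A) (hK : D₀.IsPath S T₀ A K)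
    (hn : K.filter (· ∉ P) = []) : T = ∅ ∧ K.toFinset = P := by
  have ho := (h.isOrderedHyperpath hK).2.1.connects
  rw [hn, List.toFinset_nil, connects_empty_arcs] at ho
  refine ⟨h.targets ho, Finset.Subset.antisymm (fun b hb => ?_) (h.subset_path hK)⟩
  simpa using List.filter_eq_nil_iff.1 hn b (List.mem_toFinset.1 hb)

theorem Node.ne_empty_of_filter (h : Node D₀ T₀ S D T P A) (hK : D₀.IsPath S T₀ A K)
    (hn : K.filter (· ∉ P) = L ++ [a]) : T ≠ ∅ := by
  rintro rfl
  have ho := h.isOrderedHyperpath hK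
  rw [hn] at ho
  simpa using ho.branches.head_mem

/-- Heads on `K` are distinct, so `K` survives the removal of the other hyperarcs with head `head
a`. The delay bound rests on this: the call that uses `a` is never in vain. -/
theorem IsPath.connects_of_mem (hK : D.IsPath S T A K) (ha : a ∈ K) :
    D.Connects S T (insert a (A.filter fun b => D.head b ≠ D.head a)) := by
  refine hK.connects.mono fun b hb => ?_
  have hb := List.mem_toFinset.1 hb
  rw [Finset.mem_insert, Finset.mem_filter]
  by_cases hba : b = a
  · exact .inl hba
  · exact .inr ⟨hK.mem b hb, fun hh => hba (hK.head_inj hb ha hh)⟩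

end Nodes

end BHypergraph

/-! ### Program logic for the word RAM -/

namespace WordRAM

variable {M : Limits} {inp : ℕ → List ℕ}

/-- Value of an expression, given the contents of the registers and the work arrays. -/
def Expr.val (inp : ℕ → List ℕ) (r : ℕ → ℕ) (w : ℕ → ℕ → ℕ) : Expr → ℕ
  | .const k => k
  | .reg x => r x
  | .input A i => (inp A).getD (i.val inp r w) 0
  | .work A i => w A (i.val inp r w)
  | .add e f => e.val inp r w + f.val inp r w
  | .sub e f => e.val inp r w - f.val inp r w
  | .mul e f => e.val inp r w * f.val inp r w
  | .lt e f => if e.val inp r w < f.val inp r w then 1 else 0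
  | .eq e f => if e.val inp r w = f.val inp r w then 1 else 0

/-- A sufficient condition for the safety of an expression if all input words, registers and cells
fit into words. -/
def Expr.Ok (M : Limits) (inp : ℕ → List ℕ) (r : ℕ → ℕ) (w : ℕ → ℕ → ℕ) : Expr → Prop
  | .const k => k ≤ M.maxWord
  | .reg _ => True
  | .input _ i => i.Ok M inp r w
  | .work _ i => i.Ok M inp r w ∧ i.val inp r w < M.cells
  | .add e f => e.Ok M inp r w ∧ f.Ok M inp r w ∧ e.val inp r w + f.val inp r w ≤ M.maxWord
  | .sub e f => e.Ok M inp r w ∧ f.Ok M inp r w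
  | .mul e f => e.Ok M inp r w ∧ f.Ok M inp r w ∧ e.val inp r w * f.val inp r w ≤ M.maxWord
  | .lt e f => e.Ok M inp r w ∧ f.Ok M inp r w
  | .eq e f => e.Ok M inp r w ∧ f.Ok M inp r w

theorem Expr.eval_eq_val (e : Expr) (σ : State) : e.eval inp σ = e.val inp σ.reg σ.work := by
  induction e <;> simp_all [Expr.eval, Expr.val]

/-- All input words fit into words. -/
structure InputFits (M : Limits) (inp : ℕ → List ℕ) : Prop where
  one_le : 1 ≤ M.maxWord
  le : ∀ A i, (inp A).getD i 0 ≤ M.maxWord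

/-- The contents of all registers and cells fit into words. -/
structure Fits (M : Limits) (r : ℕ → ℕ) (w : ℕ → ℕ → ℕ) : Prop where
  reg : ∀ x, r x ≤ M.maxWord
  work : ∀ A i, w A i ≤ M.maxWord

theorem Expr.Ok.val_le {r : ℕ → ℕ} {w : ℕ → ℕ → ℕ} {e : Expr} (hi : InputFits M inp)
    (hf : Fits M r w) (h : e.Ok M inp r w) : e.val inp r w ≤ M.maxWord := by
  have := hi.one_le
  induction e with
  | const k => exact h
  | reg x => exact hf.reg x
  | input A i => exact hi.le _ _
  | work A i => exact hf.work _ _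
  | add e f => exact h.2.2
  | sub e f ihe => exact (Nat.sub_le _ _).trans (ihe h.1)
  | mul e f => exact h.2.2
  | lt e f | eq e f => simp only [Expr.val]; split_ifs <;> omega

theorem Expr.Ok.safe {e : Expr} {σ : State} (hi : InputFits M inp) (hf : Fits M σ.reg σ.work)
    (h : e.Ok M inp σ.reg σ.work) : e.Safe M inp σ := by
  induction e with
  | const k => exact h
  | reg x => exact hf.reg x
  | input A i ih =>
    exact ⟨ih h, by rw [eval_eq_val]; exact Expr.Ok.val_le (e := .input A i) hi hf h⟩
  | work A i ih =>
    exact ⟨ih h.1, by rw [eval_eq_val]; exact h.2, by rw [eval_eq_val]; exact hf.work _ _⟩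
  | add e f ihe ihf =>
    exact ⟨ihe h.1, ihf h.2.1, by rw [eval_eq_val]; exact h.2.2⟩
  | sub e f ihe ihf =>
    exact ⟨ihe h.1, ihf h.2, by rw [eval_eq_val]; exact Expr.Ok.val_le (e := .sub e f) hi hf h⟩
  | mul e f ihe ihf =>
    exact ⟨ihe h.1, ihf h.2.1, by rw [eval_eq_val]; exact h.2.2⟩
  | lt e f ihe ihf =>
    exact ⟨ihe h.1, ihf h.2, by rw [eval_eq_val]; exact Expr.Ok.val_le (e := .lt e f) hi hf h⟩
  | eq e f ihe ihf =>
    exact ⟨ihe h.1, ihf h.2, by rw [eval_eq_val]; exact Expr.Ok.val_le (e := .eq e f) hi hf h⟩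

/-- Started with registers `r` and work arrays `w` whose contents fit into words, the command `c`
halts without printing anything, and `Q` holds for the resulting registers and work arrays and the
number of steps. -/
def Does (M : Limits) (inp : ℕ → List ℕ) (c : Cmd) (r : ℕ → ℕ) (w : ℕ → ℕ → ℕ)
    (Q : (ℕ → ℕ) → (ℕ → ℕ → ℕ) → ℕ → Prop) : Prop :=
  InputFits M inp → Fits M r w → ∀ (τ : ℕ) (buf : List ℕ) (lg : List (ℕ × List ℕ)),
    ∃ r' w' t, Exec M inp c ⟨r, w, τ, buf, lg⟩ ⟨r', w', τ + t, buf, lg⟩ ∧ Fits M r' w' ∧ Q r' w' t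

variable {r : ℕ → ℕ} {w : ℕ → ℕ → ℕ} {Q Q' : (ℕ → ℕ) → (ℕ → ℕ → ℕ) → ℕ → Prop} {c d : Cmd}
  {e i : Expr} {x A : ℕ}

theorem Does.mono (h : Does M inp c r w Q) (hQ : ∀ r' w' t, Q r' w' t → Q' r' w' t) :
    Does M inp c r w Q' := fun hi hf τ buf lg =>
  let ⟨r', w', t, he, hf', hq⟩ := h hi hf τ buf lg
  ⟨r', w', t, he, hf', hQ _ _ _ hq⟩

theorem does_skip (h : Q r w 1) : Does M inp .skip r w Q := fun _ hf _ _ _ =>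
  ⟨r, w, 1, .skip _, hf, h⟩

theorem does_assign (he : e.Ok M inp r w)
    (h : Q (Function.update r x (e.val inp r w)) w (1 + e.cost)) :
    Does M inp (.assign x e) r w Q := fun hi hf τ buf lg => by
  refine ⟨_, w, _, ?_, ⟨fun y => ?_, hf.work⟩, h⟩
  · have := Exec.assign (M := M) (inp := inp) ⟨r, w, τ, buf, lg⟩ x e (he.safe hi hf)
    rwa [Expr.eval_eq_val] at this
  · by_cases hy : y = x
    · subst hy; simpa using he.val_le hi hf
    · simpa [hy] using hf.reg y

theorem does_store (hi' : i.Ok M inp r w) (he : e.Ok M inp r w) (hc : i.val inp r w < M.cells)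
    (h : Q r (Function.update w A (Function.update (w A) (i.val inp r w) (e.val inp r w)))
      (1 + i.cost + e.cost)) :
    Does M inp (.store A i e) r w Q := fun hi hf τ buf lg => by
  refine ⟨r, _, _, ?_, ⟨hf.reg, fun B j => ?_⟩, h⟩
  · have := Exec.store (M := M) (inp := inp) ⟨r, w, τ, buf, lg⟩ A i e (hi'.safe hi hf)
      (he.safe hi hf) (by rwa [Expr.eval_eq_val])
    rwa [Expr.eval_eq_val, Expr.eval_eq_val] at this
  · by_cases hB : B = A
    · subst hB
      by_cases hj : j = i.val inp r w
      · subst hj; simpa using he.val_le hi hf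
      · simpa [hj] using hf.work B j
    · simpa [hB] using hf.work B j

theorem does_seq
    (h : Does M inp c r w fun r₁ w₁ t₁ => Does M inp d r₁ w₁ fun r₂ w₂ t₂ => Q r₂ w₂ (t₁ + t₂)) :
    Does M inp (.seq c d) r w Q := fun hi hf τ buf lg => by
  obtain ⟨r₁, w₁, t₁, h₁, hf₁, hd⟩ := h hi hf τ buf lg
  obtain ⟨r₂, w₂, t₂, h₂, hf₂, hq⟩ := hd hi hf₁ (τ + t₁) buf lg
  exact ⟨r₂, w₂, t₁ + t₂, by rw [← Nat.add_assoc]; exact .seq _ _ _ _ _ h₁ h₂, hf₂, hq⟩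

theorem does_ite (he : e.Ok M inp r w)
    (hc : e.val inp r w ≠ 0 → Does M inp c r w fun r' w' t => Q r' w' (1 + e.cost + t))
    (hd : e.val inp r w = 0 → Does M inp d r w fun r' w' t => Q r' w' (1 + e.cost + t)) :
    Does M inp (.ite e c d) r w Q := fun hi hf τ buf lg => by
  have hs := Expr.Ok.safe (σ := ⟨r, w, τ, buf, lg⟩) hi hf he
  have hv := Expr.eval_eq_val (inp := inp) e ⟨r, w, τ, buf, lg⟩
  by_cases hz : e.val inp r w = 0
  · obtain ⟨r', w', t, h', hf', hq⟩ := hd hz hi hf (τ + (1 + e.cost)) buf lg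
    exact ⟨r', w', _, .iteFalse _ _ _ _ _ hs (hv.trans hz) (by rwa [← Nat.add_assoc]), hf', hq⟩
  · obtain ⟨r', w', t, h', hf', hq⟩ := hc hz hi hf (τ + (1 + e.cost)) buf lg
    exact ⟨r', w', _, .iteTrue _ _ _ _ _ hs (hv ▸ hz) (by rwa [← Nat.add_assoc]), hf', hq⟩

/-- Run `body` with register `x` counting from `s` up to, but not including, `N`. -/
def forLoop (x : ℕ) (s N : Expr) (body : Cmd) : Cmd :=
  .seq (.assign x s)
    (.loop (.lt (.reg x) N) (.seq body (.assign x (.add (.reg x) (.const 1)))))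

/-- Rule for counting loops, with an invariant `I` and a potential `φ` that bounds the time. -/
theorem does_for {s N : Expr} {body : Cmd} (I : ℕ → (ℕ → ℕ) → (ℕ → ℕ → ℕ) → Prop) (a n : ℕ)
    (φ : ℕ → ℕ) (hs : s.Ok M inp r w) (hsa : s.val inp r w = a) (han : a ≤ n)
    (hn : n ≤ M.maxWord) (h0 : I a (Function.update r x a) w)
    (hN : ∀ i r w, I i r w → N.Ok M inp r w ∧ N.val inp r w = n)
    (hbody : ∀ i r w, a ≤ i → i < n → r x = i → I i r w → Does M inp body r w fun r' w' t =>
      r' x = i ∧ I (i + 1) (Function.update r' x (i + 1)) w' ∧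
        φ i + t + 7 + N.cost ≤ φ (i + 1))
    (hQ : ∀ r' w' t, r' x = n → I n r' w' → φ a + t ≤ φ n + 4 + N.cost + s.cost → Q r' w' t) :
    Does M inp (forLoop x s N body) r w Q := by
  -- Besides the body, a turn costs `3 + N.cost` for the test and `4` for the increment, whence `7 +
  -- N.cost` in `hbody`. The final test and the initial assignment add `4 + N.cost + s.cost`.
  have loop : ∀ k i r w, a ≤ i → i + k = n → r x = i → I i r w →
      Does M inp (.loop (.lt (.reg x) N) (.seq body (.assign x (.add (.reg x) (.const 1))))) r w
        fun r' w' t => r' x = n ∧ I n r' w' ∧ φ i + t ≤ φ n + 3 + N.cost := by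
    intro k
    induction k with
    | zero =>
      intro i r w ha hk hx hI hi hf τ buf lg
      obtain ⟨hok, hv⟩ := hN i r w hI
      obtain rfl : i = n := by omega
      refine ⟨r, w, 3 + N.cost, ?_, hf, hx, hI, by omega⟩
      have := Exec.loopFalse (M := M) (inp := inp) ⟨r, w, τ, buf, lg⟩ (.lt (.reg x) N)
        (.seq body (.assign x (.add (.reg x) (.const 1))))
        (Expr.Ok.safe (σ := ⟨r, w, τ, buf, lg⟩) hi hf ⟨trivial, hok⟩)
        (by rw [Expr.eval_eq_val]; simp [Expr.val, hv, hx])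
      have hc : 1 + (Expr.lt (.reg x) N).cost = 3 + N.cost := by simp [Expr.cost]; omega
      rwa [hc] at this
    | succ k ih =>
      intro i r w ha hk hx hI hi hf τ buf lg
      obtain ⟨hok, hv⟩ := hN i r w hI
      obtain ⟨r₁, w₁, t₁, h₁, hf₁, hx₁, hI₁, ht₁⟩ :=
        hbody i r w ha (by omega) hx hI hi hf (τ + (3 + N.cost)) buf lg
      have hinc : Does M inp (.assign x (.add (.reg x) (.const 1))) r₁ w₁ fun r' w' t =>
          r' = Function.update r₁ x (i + 1) ∧ w' = w₁ ∧ t = 4 :=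
        does_assign ⟨trivial, hi.one_le, by simp only [Expr.val]; omega⟩
          ⟨by simp only [Expr.val, hx₁], rfl, rfl⟩
      obtain ⟨r₂, w₂, t₂, h₂, hf₂, rfl, rfl, rfl⟩ := hinc hi hf₁ (τ + (3 + N.cost) + t₁) buf lg
      obtain ⟨r₃, w₃, t₃, h₃, hf₃, hx₃, hI₃, ht₃⟩ := ih (i + 1) _ _ (by omega) (by omega)
        (by simp) hI₁ hi hf₂ (τ + (3 + N.cost) + t₁ + 4) buf lg
      refine ⟨r₃, w₃, 3 + N.cost + t₁ + 4 + t₃, ?_, hf₃, hx₃, hI₃, by omega⟩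
      have hc : 1 + (Expr.lt (.reg x) N).cost = 3 + N.cost := by simp [Expr.cost]; omega
      refine Exec.loopTrue (σ₁ :=
        ⟨Function.update r₁ x (i + 1), w₂, τ + (3 + N.cost) + t₁ + 4, buf, lg⟩) _ _ _ _ ?_ ?_ ?_ ?_
      · exact Expr.Ok.safe (σ := ⟨r, w, τ, buf, lg⟩) hi hf ⟨trivial, hok⟩
      · rw [Expr.eval_eq_val]; simp only [Expr.val, hv, hx]; rw [if_pos (by omega)]; simp
      · rw [hc]; exact .seq _ _ _ _ _ h₁ h₂
      · convert h₃ using 2; omega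
  refine does_seq (does_assign hs ?_)
  rw [hsa]
  refine (loop (n - a) a _ _ le_rfl (by omega) (by simp) h0).mono fun r' w' t h => ?_
  exact hQ r' w' _ h.1 h.2.1 (by omega)

/-- Set the cells `0, …, N - 1` of the work array `A` to `v`. -/
def fill (x : ℕ) (N : Expr) (A v : ℕ) : Cmd :=
  forLoop x (.const 0) N (.store A (.reg x) (.const v))

theorem does_fill {N : Expr} {n v : ℕ}
    (hN : ∀ r' w', (∀ y < x, r' y = r y) → N.Ok M inp r' w' ∧ N.val inp r' w' = n)
    (hv : v ≤ M.maxWord) (hc : n ≤ M.cells) (hn : n ≤ M.maxWord)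
    (hQ : ∀ r' t, (∀ y < x, r' y = r y) → t ≤ (10 + N.cost) * n + 5 + N.cost →
      Q r' (Function.update w A fun k => if k < n then v else w A k) t) :
    Does M inp (fill x N A v) r w Q := by
  refine does_for (fun i r' w' => (∀ y < x, r' y = r y) ∧
    w' = Function.update w A fun k => if k < i then v else w A k) 0 n
    (fun i => (10 + N.cost) * i) (by simp [Expr.Ok]) rfl (Nat.zero_le _) hn ?_ ?_ ?_ ?_
  · refine ⟨fun y hy => by simp [hy.ne], by simp⟩
  · exact fun i r' w' h => hN r' w' h.1
  · rintro i r' w' - hin rfl ⟨hr, rfl⟩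
    refine does_store trivial hv (by simp only [Expr.val]; omega)
      ⟨rfl, ⟨fun y hy => by simp [hy.ne, hr y hy], ?_⟩, by simp only [Expr.cost]; ring_nf; omega⟩
    simp only [Function.update_self, Function.update_idem, Expr.val]
    congr 1
    funext k
    rcases lt_trichotomy k (r' x) with h | h | h
    · simp [h, h.ne, Nat.lt_succ_of_lt h]
    · simp [h]
    · rw [Function.update_of_ne h.ne', if_neg (by omega), if_neg (by omega)]
  · rintro r' w' t - ⟨hr, rfl⟩ ht
    exact hQ r' t hr (by simp only [Expr.cost] at ht; omega)

/-- Set the cells of the work array `A` to `1` whose addresses are in the cells `s, …, N - 1` of the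
work array `B`. -/
def mark (x : ℕ) (s N : Expr) (A B : ℕ) : Cmd :=
  forLoop x s N (.store A (.work B (.reg x)) (.const 1))

open Classical in
theorem does_mark {s N : Expr} {a n B : ℕ} (hAB : B ≠ A) (hs : s.Ok M inp r w)
    (hsa : s.val inp r w = a) (han : a ≤ n)
    (hN : ∀ r' w', (∀ y < x, r' y = r y) → N.Ok M inp r' w' ∧ N.val inp r' w' = n)
    (hc : n ≤ M.cells) (hn : n ≤ M.maxWord) (h1 : 1 ≤ M.maxWord)
    (hB : ∀ q, a ≤ q → q < n → w B q < M.cells)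
    (hQ : ∀ r' t, (∀ y < x, r' y = r y) →
      (11 + N.cost) * a + t ≤ (11 + N.cost) * n + 4 + N.cost + s.cost →
      Q r' (Function.update w A fun k => if ∃ q, a ≤ q ∧ q < n ∧ w B q = k then 1 else w A k) t) :
    Does M inp (mark x s N A B) r w Q := by
  refine does_for (fun i r' w' => (∀ y < x, r' y = r y) ∧
    w' = Function.update w A fun k => if ∃ q, a ≤ q ∧ q < i ∧ w B q = k then 1 else w A k) a n
    (fun i => (11 + N.cost) * i) hs hsa han hn ?_ ?_ ?_ ?_
  · refine ⟨fun y hy => by simp [hy.ne], ?_⟩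
    conv_lhs => rw [← Function.update_eq_self A w]
    congr 1
    funext k
    rw [if_neg (by rintro ⟨q, h1, h2, -⟩; omega)]
  · exact fun i r' w' h => hN r' w' h.1
  · rintro i r' w' hai hin rfl ⟨hr, rfl⟩
    refine does_store ⟨trivial, by simp only [Expr.val]; omega⟩ h1
      (by simp only [Expr.val, Function.update_of_ne hAB]; exact hB _ hai hin)
      ⟨rfl, ⟨fun y hy => by simp [hy.ne, hr y hy], ?_⟩, by simp only [Expr.cost]; ring_nf; omega⟩
    simp only [Function.update_self, Function.update_idem, Expr.val, Function.update_of_ne hAB]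
    congr 1
    funext k
    by_cases hk : k = w B (r' x)
    · subst hk
      rw [Function.update_self, if_pos ⟨_, hai, Nat.lt_succ_self _, rfl⟩]
    · rw [Function.update_of_ne hk]
      refine if_congr ⟨fun ⟨q, h1, h2, h3⟩ => ⟨q, h1, by omega, h3⟩, fun ⟨q, h1, h2, h3⟩ =>
        ⟨q, h1, ?_, h3⟩⟩ rfl rfl
      rcases Nat.lt_succ_iff_lt_or_eq.1 h2 with h | rfl
      · exact h
      · exact absurd h3.symm hk
  · rintro r' w' t - ⟨hr, rfl⟩ ht
    exact hQ r' t hr (by omega)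

theorem ite_ne_zero_iff {p : Prop} [Decidable p] : (if p then 1 else 0) ≠ 0 ↔ p := by
  split_ifs with h <;> simp [h]

theorem ite_le_one {p : Prop} [Decidable p] : (if p then 1 else 0) ≤ 1 := by
  split_ifs <;> simp

theorem ite_eq_one_iff {p : Prop} [Decidable p] : (if p then 1 else 0) = 1 ↔ p := by
  split_ifs with h <;> simp [h]

/-- Set register `y` to `0` if one of the cells of the work array `A` is `0` whose addresses are in
the cells `s, …, N - 1` of the work array `B`. -/
def testAll (x : ℕ) (s N : Expr) (y A B : ℕ) : Cmd :=
  forLoop x s N (.assign y (.mul (.reg y) (.work A (.work B (.reg x)))))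

open Classical in
-- Multiplication serves as conjunction: all factors are `0` or `1`, so the register remains a truth
-- value. Its initial value, the truth value of `p`, lets the caller include a condition tested
-- before.
theorem does_testAll {s N : Expr} {a n B y : ℕ} {p : Prop} [Decidable p] (hyx : y < x)
    (hs : s.Ok M inp r w) (hsa : s.val inp r w = a) (han : a ≤ n)
    (hN : ∀ r' w', (∀ z < x, z ≠ y → r' z = r z) → N.Ok M inp r' w' ∧ N.val inp r' w' = n)
    (hc : n ≤ M.cells) (hn : n ≤ M.maxWord) (h1 : 1 ≤ M.maxWord)
    (hB : ∀ q, a ≤ q → q < n → w B q < M.cells ∧ w A (w B q) ≤ 1)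
    (hy : r y = if p then 1 else 0)
    (hQ : ∀ r' t, (∀ z < x, z ≠ y → r' z = r z) →
      (r' y ≠ 0 ↔ p ∧ ∀ q, a ≤ q → q < n → w A (w B q) = 1) →
      (13 + N.cost) * a + t ≤ (13 + N.cost) * n + 4 + N.cost + s.cost → Q r' w t) :
    Does M inp (testAll x s N y A B) r w Q := by
  refine does_for (fun i r' w' => (∀ z < x, z ≠ y → r' z = r z) ∧
    (r' y = if p ∧ ∀ q, a ≤ q → q < i → w A (w B q) = 1 then 1 else 0) ∧ w' = w) a n
    (fun i => (13 + N.cost) * i) hs hsa han hn ?_ ?_ ?_ ?_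
  · refine ⟨fun z hz _ => by simp [hz.ne], ?_, rfl⟩
    rw [Function.update_of_ne hyx.ne, hy]
    exact if_congr ⟨fun h => ⟨h, fun q _ _ => by omega⟩, fun h => h.1⟩ rfl rfl
  · exact fun i r' w' h => hN r' w' h.1
  · rintro i r' w₁ hai hin rfl ⟨hr, hy', rfl⟩
    have hBi := hB _ hai hin
    have hr1 : r' y ≤ 1 := by rw [hy']; split_ifs <;> omega
    refine does_assign ⟨trivial, ⟨⟨trivial, by simp only [Expr.val]; omega⟩, hBi.1⟩, ?_⟩
      ⟨by simp [hyx.ne'], ⟨fun z hz hzy => by simp [hz.ne, hzy, hr z hz hzy], ?_, rfl⟩,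
        by simp only [Expr.cost]; ring_nf; omega⟩
    · simp only [Expr.val]
      exact (Nat.mul_le_mul hr1 hBi.2).trans h1
    · rw [Function.update_of_ne hyx.ne, Function.update_self]
      simp only [Expr.val]
      rw [hy']
      by_cases h0 : w₁ A (w₁ B (r' x)) = 1
      · rw [h0, mul_one]
        refine if_congr (and_congr_right fun _ => ⟨fun h q h1 h2 => ?_, fun h q h1 h2 =>
          h q h1 (by omega)⟩) rfl rfl
        rcases Nat.lt_succ_iff_lt_or_eq.1 h2 with h' | rfl
        · exact h q h1 h'
        · exact h0
      · have : w₁ A (w₁ B (r' x)) = 0 := by omega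
        rw [this, mul_zero, if_neg]
        exact fun h => h0 (h.2 _ hai (Nat.lt_succ_self _))
  · rintro r' _ t - ⟨hr, hy', rfl⟩ ht
    exact hQ r' t hr (by rw [hy', ite_ne_zero_iff]) (by omega)

end WordRAM

/-! ### Input arrays and short names for vertices -/

namespace BHypergraph

section Encoding

variable {n m : ℕ} (D : BHypergraph (Fin n) (Fin m)) (S T : Finset (Fin n))

/-- The position at which the tails of the hyperarc `k` start. -/
def start (k : ℕ) : ℕ :=
  ∑ a ∈ Finset.univ.filter (fun a : Fin m => (a : ℕ) < k), (D.tail a).card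

theorem start_zero : D.start 0 = 0 := by simp [start]

theorem start_succ (b : Fin m) : D.start (b + 1) = D.start b + (D.tail b).card := by
  have : Finset.univ.filter (fun a : Fin m => (a : ℕ) < b + 1) =
      insert b (Finset.univ.filter (fun a : Fin m => (a : ℕ) < b)) := by
    ext a
    simp only [Finset.mem_filter, Finset.mem_univ, true_and, Finset.mem_insert, Fin.ext_iff]
    omega
  rw [start, this, Finset.sum_insert (by simp), add_comm, start]

theorem start_mono {j k : ℕ} (h : j ≤ k) : D.start j ≤ D.start k :=
  Finset.sum_le_sum_of_subset fun a ha => by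
    simp only [Finset.mem_filter, Finset.mem_univ, true_and] at ha ⊢
    omega

theorem size_eq (h : D.arcs = Finset.univ) : D.size = m + D.start m := by
  have : Finset.univ.filter (fun a : Fin m => (a : ℕ) < m) = Finset.univ := by
    ext a; simp
  rw [size, h, start, this, Finset.sum_add_distrib]
  simp

theorem encode_head (a : Fin m) : (D.encode S T 1).getD a 0 = D.head a := by
  simp [encode, List.getD_eq_getElem?_getD]

theorem encode_start {k : ℕ} (hk : k ≤ m) : (D.encode S T 2).getD k 0 = D.start k := by
  have : k < m + 1 := by omega
  show (List.ofFn fun k : Fin (m + 1) => D.start k).getD k 0 = _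
  rw [List.getD_eq_getElem _ _ (by simpa using this), List.getElem_ofFn]

theorem encode_mem (v : Fin n) : (D.encode S T 4).getD v 0 = if v ∈ S then 1 else 0 := by
  simp [encode, List.getD_eq_getElem?_getD]

theorem encode_target_mem {i : ℕ} (hi : i < T.card) :
    ∃ t ∈ T, (D.encode S T 5).getD i 0 = (t : ℕ) := by
  have hl : i < (T.sort (· ≤ ·)).length := by simpa using hi
  refine ⟨(T.sort (· ≤ ·))[i], ?_, ?_⟩
  · rw [← Finset.mem_sort (· ≤ ·)]; exact List.getElem_mem hl
  · simp [encode, List.getD_eq_getElem?_getD, hi]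

theorem exists_encode_target {t : Fin n} (ht : t ∈ T) :
    ∃ i < T.card, (D.encode S T 5).getD i 0 = (t : ℕ) := by
  rw [← Finset.mem_sort (· ≤ ·)] at ht
  obtain ⟨i, hi, rfl⟩ := List.getElem_of_mem ht
  have hi' : i < T.card := by simpa using hi
  exact ⟨i, hi', by simp [encode, List.getD_eq_getElem?_getD, hi']⟩

/-- A block begins after the total length of the earlier blocks; the induction splits off the first
block. -/
theorem getD_flatMap_finRange {m : ℕ} (g : Fin m → List ℕ) (b : Fin m) {j : ℕ}
    (hj : j < (g b).length) :
    ((List.finRange m).flatMap g).getD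
      (∑ a ∈ Finset.univ.filter (fun a : Fin m => (a : ℕ) < b), (g a).length + j) 0 =
      (g b).getD j 0 := by
  induction m with
  | zero => exact b.elim0
  | succ m ih =>
    rw [List.finRange_succ, List.flatMap_cons, Finset.sum_filter, Fin.sum_univ_succ]
    refine Fin.cases (fun hj => ?_) (fun b hj => ?_) b hj
    · rw [List.getD_append _ _ _ _ (by simpa using hj)]; simp
    · have := ih (fun a => g a.succ) b hj
      rw [Finset.sum_filter] at this
      rw [List.flatMap_map, if_pos (by simp), List.getD_append_right _ _ _ _ (by omega)]
      rw [← this]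
      congr 1
      simp only [Fin.val_succ, Nat.add_lt_add_iff_right]
      omega

theorem encode_tail_aux (b : Fin m) {j : ℕ} (hj : j < (D.tail b).card) :
    (D.encode S T 3).getD (D.start b + j) 0 =
      (((D.tail b).sort (· ≤ ·)).map Fin.val).getD j 0 := by
  have := getD_flatMap_finRange (fun a => ((D.tail a).sort (· ≤ ·)).map Fin.val) b
    (j := j) (by simpa using hj)
  simpa [encode, start] using this

theorem encode_tail_mem (b : Fin m) {q : ℕ} (h₁ : D.start b ≤ q) (h₂ : q < D.start (b + 1)) :
    ∃ u ∈ D.tail b, (D.encode S T 3).getD q 0 = (u : ℕ) := by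
  obtain ⟨j, rfl⟩ := Nat.exists_eq_add_of_le h₁
  rw [start_succ] at h₂
  have hj : j < (D.tail b).card := by omega
  have hl : j < ((D.tail b).sort (· ≤ ·)).length := by simpa using hj
  rw [D.encode_tail_aux S T b hj]
  refine ⟨((D.tail b).sort (· ≤ ·))[j], ?_, ?_⟩
  · rw [← Finset.mem_sort (· ≤ ·)]; exact List.getElem_mem hl
  · simp [List.getD_eq_getElem?_getD, hj]

theorem exists_encode_tail (b : Fin m) {u : Fin n} (hu : u ∈ D.tail b) :
    ∃ q, D.start b ≤ q ∧ q < D.start (b + 1) ∧ (D.encode S T 3).getD q 0 = (u : ℕ) := by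
  rw [← Finset.mem_sort (· ≤ ·)] at hu
  obtain ⟨j, hj, rfl⟩ := List.getElem_of_mem hu
  have hj' : j < (D.tail b).card := by simpa using hj
  refine ⟨D.start b + j, by omega, by rw [start_succ]; omega, ?_⟩
  rw [D.encode_tail_aux S T b hj']
  simp [List.getD_eq_getElem?_getD, hj']

/-- Targets outside `S` must be heads. So with more than `m` targets there is no hyperpath, and the
program can stop before it reads the list of targets; otherwise their names fit into `m` cells. -/
theorem card_le_of_disjoint_of_forall {D : BHypergraph (Fin n) (Fin m)} {S T : Finset (Fin n)}
    (hd : Disjoint S T) {Q : Finset (Fin m)} (h : D.Connects S T Q) : T.card ≤ m := by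
  have : T ⊆ Finset.univ.image D.head := fun t ht => by
    rcases (h t ht).mem_or_exists with hS | ⟨a, -, ha, -⟩
    · exact absurd ht (Finset.disjoint_left.1 hd hS)
    · exact Finset.mem_image.2 ⟨a, Finset.mem_univ _, ha⟩
  simpa using (Finset.card_le_card this).trans Finset.card_image_le

theorem encode_le (A i : ℕ) : (D.encode S T A).getD i 0 ≤ n + m + D.start m + 1 := by
  by_cases hi : i < (D.encode S T A).length
  swap
  · rw [List.getD_eq_default _ _ (by omega)]; omega
  have hmem := List.getElem_mem hi
  rw [List.getD_eq_getElem _ _ hi]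
  generalize (D.encode S T A)[i] = x at hmem
  unfold encode at hmem
  split at hmem
  · have : T.card ≤ n := by simpa using Finset.card_le_univ T
    simp at hmem
    omega
  · obtain ⟨a, rfl⟩ := (List.mem_ofFn' _ _).1 hmem
    have := (D.head a).isLt
    show (D.head a : ℕ) ≤ _
    omega
  · obtain ⟨k, rfl⟩ := (List.mem_ofFn' _ _).1 hmem
    have := D.start_mono (Nat.lt_succ_iff.1 k.isLt)
    exact this.trans (by omega)
  · simp only [List.mem_flatMap, List.mem_map] at hmem
    obtain ⟨_, _, v, _, rfl⟩ := hmem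
    omega
  · obtain ⟨a, rfl⟩ := (List.mem_ofFn' _ _).1 hmem
    show (if a ∈ S then 1 else 0) ≤ _
    split_ifs <;> omega
  · simp only [List.mem_map] at hmem
    obtain ⟨v, _, rfl⟩ := hmem
    omega
  · simp at hmem

/-- The last number below `k` at which `h` takes the value `v`, and `m + 1` if there is none. -/
def lastIndex (h : ℕ → ℕ) (m v : ℕ) : ℕ → ℕ
  | 0 => m + 1
  | k + 1 => if h k = v then k else lastIndex h m v k

theorem lastIndex_cases (h : ℕ → ℕ) (m v k : ℕ) :
    (lastIndex h m v k = m + 1 ∧ ∀ j < k, h j ≠ v) ∨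
      (lastIndex h m v k < k ∧ h (lastIndex h m v k) = v) := by
  induction k with
  | zero => simp [lastIndex]
  | succ k ih =>
    unfold lastIndex
    split_ifs with hk
    · exact .inr ⟨Nat.lt_succ_self _, hk⟩
    · rcases ih with ih | ih
      · refine .inl ⟨ih.1, fun j hj => ?_⟩
        rcases Nat.lt_succ_iff_lt_or_eq.1 hj with h' | rfl
        · exact ih.2 j h'
        · exact hk
      · exact .inr ⟨by omega, ih.2⟩

/-- A name for the vertex `v`: the vertices in `S` are called `m`, a vertex outside `S` that is a
head is called by a hyperarc with this head, and all others are called `m + 1`. -/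
def cls (v : ℕ) : ℕ :=
  if (D.encode S T 4).getD v 0 = 0 then
    lastIndex (fun j => (D.encode S T 1).getD j 0) m v m else m

theorem cls_le (v : ℕ) : D.cls S T v ≤ m + 1 := by
  unfold cls
  split_ifs
  · rcases lastIndex_cases (fun j => (D.encode S T 1).getD j 0) m v m with h | h <;> omega
  · omega

/-- All names of vertices outside `S` are below `m` or equal to `m + 1`, so `m` is reserved for `S`.
-/
theorem cls_eq_iff_mem (v : Fin n) : D.cls S T v = m ↔ v ∈ S := by
  unfold cls
  rw [encode_mem]
  by_cases hv : v ∈ S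
  · simp [hv]
  · simp only [hv, if_false, iff_false, if_true]
    rcases lastIndex_cases (fun j => (D.encode S T 1).getD j 0) m v m with h | h <;> omega

/-- A name below `m` is a hyperarc whose head is the vertex, so it determines the vertex. Only heads
outside `S` need to be told apart from all other vertices, since only these are ever newly reached.
-/
theorem cls_eq_cls_head_iff {a : Fin m} (ha : D.head a ∉ S) (v : Fin n) :
    D.cls S T v = D.cls S T (D.head a) ↔ v = D.head a := by
  refine ⟨fun h => ?_, fun h => by rw [h]⟩
  have hav : D.cls S T v ≠ m := by rw [h]; rwa [Ne, cls_eq_iff_mem]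
  have hlt : D.cls S T (D.head a) < m ∧
      (D.encode S T 1).getD (D.cls S T (D.head a)) 0 = D.head a := by
    unfold cls
    rw [encode_mem, if_neg ha, if_pos rfl]
    refine (lastIndex_cases (fun j => (D.encode S T 1).getD j 0) m (D.head a) m).resolve_left
      fun h' => h'.2 a a.isLt (D.encode_head S T a)
  have hv : v ∉ S := by rwa [Ne, cls_eq_iff_mem] at hav
  rw [← h] at hlt
  rcases lastIndex_cases (fun j => (D.encode S T 1).getD j 0) m v m with h' | h'
  · have : D.cls S T v = m + 1 := by
      unfold cls; rw [encode_mem, if_neg hv, if_pos rfl]; exact h'.1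
    omega
  · have hc : D.cls S T v = lastIndex (fun j => (D.encode S T 1).getD j 0) m v m := by
      unfold cls; rw [encode_mem, if_neg hv, if_pos rfl]
    rw [hc] at hlt
    exact Fin.ext (h'.2.symm.trans hlt.2)

end Encoding

end BHypergraph

/-! ### Computing the names, and decoding the stack of decisions -/

namespace WordRAM

open BHypergraph

variable {n m : ℕ} {D : BHypergraph (Fin n) (Fin m)} {S T : Finset (Fin n)} {M : Limits}
  {r : ℕ → ℕ} {w : ℕ → ℕ → ℕ} {Q : (ℕ → ℕ) → (ℕ → ℕ → ℕ) → ℕ → Prop}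

/-- The limits suffice for the hypergraph `D`. -/
structure Roomy (M : Limits) (D : BHypergraph (Fin n) (Fin m)) : Prop where
  cells : m + D.start m + 2 ≤ M.cells
  word : n + m + D.start m + 5 ≤ M.maxWord

theorem Roomy.inputFits (h : Roomy M D) : InputFits M (D.encode S T) :=
  ⟨by have := h.word; omega, fun A i => (D.encode_le S T A i).trans (by have := h.word; omega)⟩

/-- For all `i < N`, store in cell `i` of the work array `A` the name of the vertex in cell `i` of
the input array `src`. -/
def classify (src : ℕ) (N : Expr) (A : ℕ) : Cmd :=
  forLoop 6 (.const 0) N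
    (.seq (.assign 7 (.add (.reg 0) (.const 1)))
    (.seq (forLoop 8 (.const 0) (.reg 0)
      (.ite (.eq (.input 1 (.reg 8)) (.input src (.reg 6))) (.assign 7 (.reg 8)) .skip))
    (.seq (.ite (.input 4 (.input src (.reg 6))) (.assign 7 (.reg 0)) .skip)
      (.store A (.reg 6) (.reg 7)))))

theorem does_classify (hM : Roomy M D) {src A len : ℕ} {N : Expr} (h0 : r 0 = m)
    (hN : ∀ r' w', (∀ y < 6, r' y = r y) →
      N.Ok M (D.encode S T) r' w' ∧ N.val (D.encode S T) r' w' = len)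
    (hc : N.cost ≤ 2) (hlen : len ≤ m + D.start m)
    (hQ : ∀ r' t, (∀ y < 6, r' y = r y) → t ≤ (16 * m + 50) * len + 10 →
      Q r' (Function.update w A fun k =>
        if k < len then D.cls S T ((D.encode S T src).getD k 0) else w A k) t) :
    Does M (D.encode S T) (classify src N A) r w Q := by
  have hcells := hM.cells
  have hword := hM.word
  refine does_for (fun i r' w' => (∀ y < 6, r' y = r y) ∧
    w' = Function.update w A fun k =>
      if k < i then D.cls S T ((D.encode S T src).getD k 0) else w A k) 0 len
    (fun i => (16 * m + 50) * i) (by simp [Expr.Ok]) rfl (Nat.zero_le _) (by omega) ?_ ?_ ?_ ?_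
  · exact ⟨fun y hy => by simp [hy.ne], by simp⟩
  · exact fun i r' w' h => hN r' w' h.1
  · rintro i r' w' - hi rfl ⟨hr, rfl⟩
    have hr0 : r' 0 = m := by rw [hr 0 (by omega), h0]
    set w₁ := Function.update w A fun k =>
      if k < r' 6 then D.cls S T ((D.encode S T src).getD k 0) else w A k with hw₁
    set v := (D.encode S T src).getD (r' 6) 0 with hv
    refine does_seq (does_assign ⟨trivial, by simp only [Expr.Ok]; omega,
      by simp only [Expr.val]; omega⟩ ?_)
    refine does_seq (does_for (fun j r'' w'' => (∀ y < 7, r'' y = r' y) ∧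
      r'' 7 = lastIndex (fun j => (D.encode S T 1).getD j 0) m v j ∧ w'' = w₁) 0 m
      (fun j => 16 * j) (by simp [Expr.Ok]) rfl (Nat.zero_le _) (by omega) ?_ ?_ ?_ ?_)
    · refine ⟨fun y hy => by simp (disch := omega) only [Function.update_of_ne], ?_, rfl⟩
      simp [Expr.val, lastIndex, hr0]
    · rintro j r'' w'' ⟨h1, -, -⟩
      exact ⟨trivial, by simp only [Expr.val]; rw [h1 0 (by omega), hr0]⟩
    · rintro j r'' w'' - hj rfl ⟨h1, h2, rfl⟩
      have hr6 := h1 6 (by omega)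
      refine does_ite ⟨trivial, trivial⟩ (fun hne => does_assign trivial ?_)
        (fun hz => does_skip ?_)
      · simp only [Expr.val, hr6] at hne
        have hh : (D.encode S T 1).getD (r'' 8) 0 = v := by
          by_contra hh; exact hne (if_neg hh)
        refine ⟨by simp, ⟨fun y hy => by
          simp (disch := omega) only [Function.update_of_ne, h1], ?_, rfl⟩,
          by simp only [Expr.cost]; omega⟩
        simp only [Expr.val]
        rw [lastIndex, if_pos hh]
        simp
      · simp only [Expr.val, hr6] at hz
        have hh : (D.encode S T 1).getD (r'' 8) 0 ≠ v := fun hh => by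
          rw [if_pos hh] at hz; omega
        refine ⟨rfl, ⟨fun y hy => by
          simp (disch := omega) only [Function.update_of_ne, h1], ?_, rfl⟩,
          by simp only [Expr.cost]; omega⟩
        rw [lastIndex, if_neg hh]
        simp [h2]
    · rintro r₂ _ t₂ - ⟨h1, h2, rfl⟩ ht₂
      have hr6 : r₂ 6 = r' 6 := h1 6 (by omega)
      have store : ∀ (r₃ : ℕ → ℕ) (t₃ : ℕ), (∀ y < 7, r₃ y = r' y) → r₃ 7 = D.cls S T v →
          t₃ ≤ 6 → Does M (D.encode S T) (.store A (.reg 6) (.reg 7)) r₃ w₁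
            fun r'' w'' t => r'' 6 = r' 6 ∧ ((∀ y < 6, Function.update r'' 6 (r' 6 + 1) y = r y) ∧
              w'' = Function.update w A fun k => if k < r' 6 + 1 then
                D.cls S T ((D.encode S T src).getD k 0) else w A k) ∧
              (16 * m + 50) * r' 6 + (1 + (Expr.add (.reg 0) (.const 1)).cost + (t₂ + (t₃ + t))) +
                7 + N.cost ≤ (16 * m + 50) * (r' 6 + 1) := by
        intro r₃ t₃ h3 h7 ht₃
        have h6 : r₃ 6 = r' 6 := h3 6 (by omega)
        refine does_store trivial trivial (by simp only [Expr.val]; omega) ⟨h6,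
          ⟨fun y hy => by simp [hy.ne, h3 y (by omega), hr y hy], ?_⟩, ?_⟩
        · simp only [Expr.val, h6, h7, hw₁, Function.update_self, Function.update_idem]
          congr 1
          funext k
          rcases lt_trichotomy k (r' 6) with h | h | h
          · simp [h, h.ne, Nat.lt_succ_of_lt h]
          · simp [h, hv]
          · rw [Function.update_of_ne h.ne', if_neg (by omega), if_neg (by omega)]
        · simp only [Expr.cost] at ht₂ ⊢
          rw [Nat.mul_succ]
          omega
      refine does_seq (does_ite trivial (fun hne => does_assign trivial ?_) fun hz => does_skip ?_)
      · simp only [Expr.val, hr6] at hne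
        refine store _ _ (fun y hy => by simp [hy.ne, h1 y hy]) ?_ (by simp [Expr.cost])
        simp only [Function.update_self, Expr.val]
        rw [h1 0 (by omega), hr0, cls, if_neg hne]
      · simp only [Expr.val, hr6] at hz
        refine store _ _ h1 ?_ (by simp [Expr.cost])
        rw [h2, cls, if_pos hz]
  · rintro r' w' t - ⟨hr, rfl⟩ ht
    exact hQ r' t hr (by simp only [Expr.cost] at ht; omega)

/-- Registers and work arrays contain the parameters of the input and the names of the heads, tails
and targets. -/
structure Ready (D : BHypergraph (Fin n) (Fin m)) (S T : Finset (Fin n)) (r : ℕ → ℕ)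
    (w : ℕ → ℕ → ℕ) : Prop where
  arcs : r 0 = m
  card : r 1 = T.card
  head : ∀ a : Fin m, w 0 a = D.cls S T (D.head a)
  tail : ∀ q < D.start m, w 1 q = D.cls S T ((D.encode S T 3).getD q 0)
  target : ∀ i < T.card, w 2 i = D.cls S T ((D.encode S T 5).getD i 0)

theorem Ready.congr {r' : ℕ → ℕ} {w' : ℕ → ℕ → ℕ} (h : Ready D S T r w)
    (hr : ∀ y < 2, r' y = r y) (hw : ∀ B < 3, w' B = w B) : Ready D S T r' w' := by
  refine ⟨?_, ?_, ?_, ?_, ?_⟩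
  · rw [hr 0 (by omega), h.arcs]
  · rw [hr 1 (by omega), h.card]
  · rw [hw 0 (by omega)]; exact h.head
  · rw [hw 1 (by omega)]; exact h.tail
  · rw [hw 2 (by omega)]; exact h.target

/-- Compute the names of all heads, tails and targets. -/
def setup : Cmd :=
  .seq (classify 1 (.reg 0) 0) (.seq (classify 3 (.input 2 (.reg 0)) 1) (classify 5 (.reg 1) 2))

theorem le_mul_self' (a b : ℕ) (h : a = 0 → b = 0) : b ≤ a * b := by
  rcases Nat.eq_zero_or_pos a with h0 | h0
  · simp [h h0]
  · exact Nat.le_mul_of_pos_left b h0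

theorem start_le_mul (D : BHypergraph (Fin n) (Fin m)) : D.start m ≤ m * D.start m :=
  le_mul_self' _ _ fun h => by subst h; exact D.start_zero

/-- Each name takes one scan of the `m` heads, and there are `m + D.start m + T.card` names to
compute, with `T.card ≤ m`. -/
theorem does_setup (hM : Roomy M D) (h0 : r 0 = m) (h1 : r 1 = T.card) (hT : T.card ≤ m)
    (hQ : ∀ r' w' t, Ready D S T r' w' → (∀ y < 6, r' y = r y) →
      t ≤ 140 * (m * m + m * D.start m + 1) → Q r' w' t) :
    Does M (D.encode S T) setup r w Q := by
  have hword := hM.word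
  refine does_seq (does_classify hM h0 (len := m) (fun r' w' h => ⟨trivial, ?_⟩) (by simp [Expr.cost])
    (by omega) fun r₁ t₁ hr₁ ht₁ => ?_)
  · simp [Expr.val, h 0, h0]
  refine does_seq (does_classify hM (by rw [hr₁ 0 (by omega), h0]) (len := D.start m)
    (fun r' w' h => ⟨trivial, ?_⟩) (by simp [Expr.cost]) (by omega) fun r₂ t₂ hr₂ ht₂ => ?_)
  · simp only [Expr.val]
    rw [h 0 (by omega), hr₁ 0 (by omega), h0, encode_start _ _ _ le_rfl]
  refine does_classify hM (by rw [hr₂ 0 (by omega), hr₁ 0 (by omega), h0]) (len := T.card)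
    (fun r' w' h => ⟨trivial, ?_⟩) (by simp [Expr.cost]) (by omega) fun r₃ t₃ hr₃ ht₃ => ?_
  · simp only [Expr.val]
    rw [h 1 (by omega), hr₂ 1 (by omega), hr₁ 1 (by omega), h1]
  have hr : ∀ y < 6, r₃ y = r y := fun y hy => by rw [hr₃ y hy, hr₂ y hy, hr₁ y hy]
  refine hQ _ _ _ ⟨by rw [hr 0 (by omega), h0], by rw [hr 1 (by omega), h1], ?_, ?_, ?_⟩ hr ?_
  · intro a
    simp [← D.encode_head S T a]
  · intro q hq
    simp [hq]
  · intro q hq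
    simp [hq]
  · have e1 := start_le_mul D
    have e2 := Nat.le_mul_self m
    have e3 : (16 * m + 50) * T.card ≤ (16 * m + 50) * m := Nat.mul_le_mul_left _ hT
    have e4 : (16 * m + 50) * m = 16 * (m * m) + 50 * m := by ring
    have e5 : (16 * m + 50) * D.start m = 16 * (m * D.start m) + 50 * D.start m := by ring
    omega

/-- The stack in the work arrays `3` and `4` contains the decisions in the list `ds`: the hyperarc
that was branched on, and whether it is used. -/
structure Stack (ds : List (Fin m × Bool)) (r : ℕ → ℕ) (w : ℕ → ℕ → ℕ) : Prop where
  length : r 2 = ds.length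
  arc : ∀ (i : ℕ) (h : i < ds.length), w 3 i = ds[i].1
  used : ∀ (i : ℕ) (h : i < ds.length), w 4 i = if ds[i].2 then 1 else 0

theorem Stack.congr {ds : List (Fin m × Bool)} {r' : ℕ → ℕ} {w' : ℕ → ℕ → ℕ} (h : Stack ds r w)
    (hr : r' 2 = r 2) (h3 : w' 3 = w 3) (h4 : w' 4 = w 4) : Stack ds r' w' :=
  ⟨hr.trans h.length, h3 ▸ h.arc, h4 ▸ h.used⟩

/-- The effect of a decision on the sets of available and of contracted hyperarcs. -/
def decideStep (D : BHypergraph (Fin n) (Fin m)) (p : Finset (Fin m) × Finset (Fin m))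
    (x : Fin m × Bool) : Finset (Fin m) × Finset (Fin m) :=
  if x.2 then (insert x.1 (p.1.filter fun b => D.head b ≠ D.head x.1), p.2 ∪ {x.1})
  else (p.1.erase x.1, p.2)

/-- The sets of available and of contracted hyperarcs after a list of decisions. -/
def available (D : BHypergraph (Fin n) (Fin m)) (ds : List (Fin m × Bool)) :
    Finset (Fin m) × Finset (Fin m) :=
  ds.foldl (decideStep D) (Finset.univ, ∅)

theorem available_concat (ds : List (Fin m × Bool)) (x : Fin m × Bool) :
    available D (ds ++ [x]) = decideStep D (available D ds) x := by
  simp [available]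

/-- The work array `f` is the characteristic vector of `A`. -/
def Holds (f : ℕ → ℕ) (A : Finset (Fin m)) : Prop :=
  ∀ b : Fin m, f b = if b ∈ A then 1 else 0

theorem Holds.update {f : ℕ → ℕ} {A A' : Finset (Fin m)} {a : Fin m} {v : ℕ} (h : Holds f A)
    (ha : v = if a ∈ A' then 1 else 0) (hA : ∀ b ≠ a, (b ∈ A' ↔ b ∈ A)) :
    Holds (Function.update f a v) A' := by
  intro b
  by_cases hb : b = a
  · subst hb; rw [Function.update_self, ha]
  · rw [Function.update_of_ne (fun h => hb (Fin.ext h)), h b]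
    exact if_congr (hA b hb).symm rfl rfl

/-- Compute the sets of available and of contracted hyperarcs from the stack. -/
def rebuild : Cmd :=
  .seq (fill 6 (.reg 0) 5 1) (.seq (fill 6 (.reg 0) 6 0)
    (forLoop 6 (.const 0) (.reg 2) (.ite (.work 4 (.reg 6))
      (.seq (forLoop 7 (.const 0) (.reg 0)
        (.ite (.eq (.input 1 (.reg 7)) (.input 1 (.work 3 (.reg 6))))
          (.store 5 (.reg 7) (.const 0)) .skip))
        (.seq (.store 5 (.work 3 (.reg 6)) (.const 1)) (.store 6 (.work 3 (.reg 6)) (.const 1))))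
      (.store 5 (.work 3 (.reg 6)) (.const 0)))))

/-- At most `m` decisions with one scan of the heads each cost `O(m² + 1)` steps, which is
affordable in every round. In return nothing has to be undone when a decision is revised. -/
theorem does_rebuild (hM : Roomy M D) (h0 : r 0 = m) {ds : List (Fin m × Bool)}
    (hs : Stack ds r w) (hd : ds.length ≤ m)
    (hQ : ∀ r' w' t, (∀ y < 6, r' y = r y) → (∀ B < 5, w' B = w B) →
      Holds (w' 5) (available D ds).1 → Holds (w' 6) (available D ds).2 →
      t ≤ 90 * (m * m + m * D.start m + 1) → Q r' w' t) :
    Does M (D.encode S T) rebuild r w Q := by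
  have hcells := hM.cells
  have hword := hM.word
  refine does_seq (does_fill (n := m) (fun r' w' h => ⟨trivial, by simp [Expr.val, h 0, h0]⟩)
    (by omega) (by omega) (by omega) fun r₁ t₁ hr₁ ht₁ => ?_)
  refine does_seq (does_fill (n := m)
    (fun r' w' h => ⟨trivial, by simp [Expr.val, h 0, hr₁ 0, h0]⟩)
    (by omega) (by omega) (by omega) fun r₂ t₂ hr₂ ht₂ => ?_)
  refine does_for (fun i r' w' => (∀ y < 6, r' y = r y) ∧ (∀ B < 5, w' B = w B) ∧
    Holds (w' 5) (available D (ds.take i)).1 ∧ Holds (w' 6) (available D (ds.take i)).2) 0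
    ds.length (fun i => (18 * m + 40) * i) (by simp [Expr.Ok]) rfl (Nat.zero_le _) (by omega)
    ?_ ?_ ?_ ?_
  · refine ⟨fun y hy => by simp [hy.ne, hr₂ y hy, hr₁ y hy],
      fun B hB => by simp (disch := omega) only [Function.update_of_ne],
      fun b => by simp [available], fun b => by simp [available]⟩
  · rintro i r' w' ⟨h, -⟩
    exact ⟨trivial, by simp only [Expr.val]; rw [h 2 (by omega), hs.length]⟩
  · rintro i r' w' - hi rfl ⟨hr, hw, h5, h6⟩
    have hav : available D (ds.take (r' 6 + 1)) =
        decideStep D (available D (ds.take (r' 6))) ds[r' 6] := by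
      rw [← available_concat, List.take_append_getElem]
    have h3 : w' 3 (r' 6) = ds[r' 6].1 := by rw [hw 3 (by omega)]; exact hs.arc _ hi
    have h4 : w' 4 (r' 6) = if ds[r' 6].2 then 1 else 0 := by
      rw [hw 4 (by omega)]; exact hs.used _ hi
    have hr0 : r' 0 = m := by rw [hr 0 (by omega), h0]
    set a := ds[r' 6].1 with ha
    have ham := a.isLt
    rw [hav]
    have hok : (Expr.work 3 (.reg 6)).Ok M (D.encode S T) r' w' :=
      ⟨trivial, by simp only [Expr.val]; omega⟩
    refine does_ite ⟨trivial, by simp only [Expr.val]; omega⟩ (fun hne => ?_) (fun hz => ?_)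
    · have hu : ds[r' 6].2 = true := by
        by_contra hu
        simp [Expr.val, h4, hu] at hne
      have hst : decideStep D (available D (ds.take (r' 6))) ds[r' 6] =
        (insert a ((available D (ds.take (r' 6))).1.filter fun b => D.head b ≠ D.head a),
          (available D (ds.take (r' 6))).2 ∪ {a}) := if_pos hu
      rw [hst]
      -- Only the hyperarcs below `j` have been compared with `a`, hence the implication inside the
      -- filter.
      refine does_seq (does_for (fun j r'' w'' => (∀ y < 7, r'' y = r' y) ∧
        (∀ B, B ≠ 5 → w'' B = w' B) ∧ Holds (w'' 5)
          ((available D (ds.take (r' 6))).1.filter fun b => b < j → D.head b ≠ D.head a)) 0 m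
        (fun j => 18 * j) (by simp [Expr.Ok]) rfl (Nat.zero_le _) (by omega) ?_ ?_ ?_ ?_)
      · exact ⟨fun y hy => by simp [hy.ne], fun _ _ => rfl, by simpa using h5⟩
      · rintro j r'' w'' ⟨h1, -⟩
        exact ⟨trivial, by simp only [Expr.val]; rw [h1 0 (by omega), hr0]⟩
      · rintro j r'' w'' - hj rfl ⟨h1, h2, h3'⟩
        have hr6 := h1 6 (by omega)
        have hv3 : w'' 3 (r'' 6) = a := by rw [h2 3 (by omega), hr6, h3]
        have hea := D.encode_head S T a
        have heb := D.encode_head S T ⟨r'' 7, hj⟩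
        refine does_ite ⟨trivial, trivial, by simp only [Expr.val]; omega⟩
          (fun hne => does_store trivial (by simp [Expr.Ok]) (by simp only [Expr.val]; omega) ?_)
          (fun hz => does_skip ?_)
        · simp only [Expr.val, hv3, hea] at hne
          have hh : D.head ⟨r'' 7, hj⟩ = D.head a := by
            by_contra hh
            exact hne (if_neg fun h' => hh (Fin.ext (heb.symm.trans h')))
          refine ⟨rfl, ⟨fun y hy => by simp [hy.ne, h1 y hy], fun B hB => by simp [hB, h2 B hB],
            ?_⟩, by simp only [Expr.cost]; omega⟩
          simp only [Function.update_self, Expr.val]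
          refine h3'.update (a := ⟨r'' 7, hj⟩) (by simp [hh]) fun b hb => ?_
          have : (b : ℕ) ≠ r'' 7 := fun h' => hb (Fin.ext h')
          simp only [Finset.mem_filter]
          rw [show (b : ℕ) < r'' 7 + 1 ↔ (b : ℕ) < r'' 7 by omega]
        · simp only [Expr.val, hv3, hea] at hz
          have hh : D.head ⟨r'' 7, hj⟩ ≠ D.head a := fun hh => by
            rw [if_pos (heb.trans (congrArg _ hh))] at hz; omega
          refine ⟨rfl, ⟨fun y hy => by simp [hy.ne, h1 y hy], h2, ?_⟩,
            by simp only [Expr.cost]; omega⟩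
          intro b
          rw [h3' b]
          refine if_congr ?_ rfl rfl
          simp only [Finset.mem_filter]
          refine and_congr_right fun _ => ⟨fun h hb => ?_, fun h hb => h (by omega)⟩
          rcases Nat.lt_succ_iff_lt_or_eq.1 hb with h' | h'
          · exact h h'
          · rwa [show b = ⟨r'' 7, hj⟩ from Fin.ext h']
      · rintro r₃ w₃ t₃ - ⟨h1, h2, h3'⟩ ht₃
        have hr6 := h1 6 (by omega)
        have hv3 : w₃ 3 (r₃ 6) = a := by rw [h2 3 (by omega), hr6, h3]
        -- The scan has removed `a` as well, so it is put back.
        refine does_seq (does_store ⟨trivial, by simp only [Expr.val]; omega⟩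
          (by simp only [Expr.Ok]; omega) (by simp only [Expr.val]; omega) ?_)
        refine does_store ⟨trivial, by simp only [Expr.val]; omega⟩
          (by simp only [Expr.Ok]; omega) (by simp [Expr.val, hv3]; omega) ?_
        refine ⟨hr6, ⟨fun y hy => by simp [hy.ne, h1 y (by omega), hr y hy], fun B hB => ?_, ?_,
          ?_⟩, ?_⟩
        · simp (disch := omega) only [Function.update_of_ne, h2, hw]
        · simp only [Expr.val, hv3]
          rw [Function.update_of_ne (by omega), Function.update_self]
          refine h3'.update (a := a) (by simp) fun b hb => ?_
          simp [hb]
        · have h36 := h2 6 (by omega)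
          simp only [Expr.val]
          rw [Function.update_self, Function.update_of_ne (by omega),
            Function.update_of_ne (by omega), hv3, h36]
          refine h6.update (a := a) (by simp) fun b hb => ?_
          simp [hb]
        · simp only [Expr.cost] at ht₃ ⊢
          rw [Nat.mul_succ]
          omega
    · have hu : ds[r' 6].2 = false := by
        by_contra hu
        simp [Expr.val, h4, hu] at hz
      have hst : decideStep D (available D (ds.take (r' 6))) ds[r' 6] =
        ((available D (ds.take (r' 6))).1.erase a, (available D (ds.take (r' 6))).2) :=
        if_neg (by simp [hu])
      rw [hst]
      refine does_store hok (by simp [Expr.Ok]) (by simp only [Expr.val]; omega) ⟨rfl,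
        ⟨fun y hy => by simp [hy.ne, hr y hy], fun B hB => ?_, ?_, by simpa using h6⟩, ?_⟩
      · simp (disch := omega) only [Function.update_of_ne, hw]
      · simp only [Function.update_self, Expr.val, h3]
        exact h5.update (a := a) (by simp) fun b hb => by simp [hb]
      · simp only [Expr.cost]
        rw [Nat.mul_succ]
        omega
  · rintro r' w' t - ⟨hr, hw, h5, h6⟩ ht
    rw [List.take_length] at h5 h6
    refine hQ _ _ _ hr hw h5 h6 ?_
    have e2 := Nat.le_mul_self m
    have e3 : (18 * m + 40) * ds.length ≤ (18 * m + 40) * m := Nat.mul_le_mul_left _ hd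
    have e4 : (18 * m + 40) * m = 18 * (m * m) + 40 * m := by ring
    simp only [Expr.cost] at ht ht₁ ht₂
    omega

end WordRAM

/-! ### Forward search on the machine -/

namespace WordRAM

open BHypergraph

variable {n m : ℕ} {D : BHypergraph (Fin n) (Fin m)} {S T : Finset (Fin n)} {M : Limits}
  {r : ℕ → ℕ} {w : ℕ → ℕ → ℕ} {Q : (ℕ → ℕ) → (ℕ → ℕ → ℕ) → ℕ → Prop} {A : Finset (Fin m)}
  {L : List (Fin m)}

/-- The work array `f` tells which vertices are in `S` or heads of hyperarcs in the list `L`. -/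
def Reached (D : BHypergraph (Fin n) (Fin m)) (S T : Finset (Fin n)) (f : ℕ → ℕ)
    (L : List (Fin m)) : Prop :=
  ∀ v : Fin n, f (D.cls S T v) = if v ∈ S ∨ v ∈ L.map D.head then 1 else 0

/-- The list `L` is stored in the work array `8`, and the vertices that it reaches are marked in the
work array `7`. -/
structure Fired (D : BHypergraph (Fin n) (Fin m)) (S T : Finset (Fin n)) (L : List (Fin m))
    (r : ℕ → ℕ) (w : ℕ → ℕ → ℕ) : Prop where
  reached : Reached D S T (w 7) L
  length : r 4 = L.length
  arc : ∀ (i : ℕ) (h : i < L.length), w 8 i = L[i]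

theorem Reached.le_one {f : ℕ → ℕ} (h : Reached D S T f L) (v : Fin n) : f (D.cls S T v) ≤ 1 := by
  rw [h v]; split_ifs <;> omega

/-- Programs run through positions, specifications through vertices; the positions from `D.start b`
up to `D.start (b + 1)` enumerate `D.tail b`. -/
theorem Ready.forall_tail (h : Ready D S T r w) (b : Fin m) (p : ℕ → Prop) :
    (∀ q, D.start b ≤ q → q < D.start (b + 1) → p (w 1 q)) ↔
      ∀ u ∈ D.tail b, p (D.cls S T u) := by
  have hb : ∀ q, q < D.start (b + 1) → q < D.start m := fun q hq =>
    hq.trans_le (D.start_mono (by omega))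
  constructor
  · intro hp u hu
    obtain ⟨q, h₁, h₂, hq⟩ := D.exists_encode_tail S T b hu
    have := hp q h₁ h₂
    rwa [h.tail q (hb q h₂), hq] at this
  · intro hp q h₁ h₂
    obtain ⟨u, hu, hq⟩ := D.encode_tail_mem S T b h₁ h₂
    rw [h.tail q (hb q h₂), hq]
    exact hp u hu

theorem Ready.forall_target (h : Ready D S T r w) (p : ℕ → Prop) :
    (∀ q, 0 ≤ q → q < T.card → p (w 2 q)) ↔ ∀ u ∈ T, p (D.cls S T u) := by
  constructor
  · intro hp u hu
    obtain ⟨q, h₂, hq⟩ := D.exists_encode_target S T hu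
    have := hp q (Nat.zero_le _) h₂
    rwa [h.target q h₂, hq] at this
  · intro hp q _ h₂
    obtain ⟨u, hu, hq⟩ := D.encode_target_mem S T h₂
    rw [h.target q h₂, hq]
    exact hp u hu

theorem Roomy.cls_lt (hM : Roomy M D) (v : ℕ) : D.cls S T v < M.cells := by
  have := D.cls_le S T v
  have := hM.cells
  omega

theorem _root_.BHypergraph.Reaching.length_le (h : D.Reaching S A L) : L.length ≤ m := by
  simpa using (List.Nodup.of_map _ h.nodup).length_le_card

/-- Append the hyperarc in register `7` to the list if it reaches a new vertex. -/
def tryFire : Cmd :=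
  .seq (.assign 8 (.mul (.work 5 (.reg 7)) (.sub (.const 1) (.work 7 (.work 0 (.reg 7))))))
    (.seq (testAll 9 (.input 2 (.reg 7)) (.input 2 (.add (.reg 7) (.const 1))) 8 7 1)
      (.ite (.reg 8) (.seq (.store 7 (.work 0 (.reg 7)) (.const 1))
        (.seq (.store 8 (.reg 4) (.reg 7)) (.assign 4 (.add (.reg 4) (.const 1))))) .skip))

/-- The time is kept proportional to the tail size, so that one pass over all hyperarcs costs `O(m +
D.start m)` and the `m` passes stay within the time of a round. -/
theorem does_tryFire (hM : Roomy M D) (hR : Ready D S T r w) (hA : Holds (w 5) A)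
    (hF : Fired D S T L r w) (hL : D.Reaching S A L) {b : Fin m} (hb : r 7 = b)
    (hQ : ∀ r' w' t, (∀ y < 8, y ≠ 4 → r' y = r y) → (∀ B < 7, w' B = w B) →
      Fired D S T (D.fire S A L b) r' w' → t ≤ 60 + 20 * (D.tail b).card → Q r' w' t) :
    Does M (D.encode S T) tryFire r w Q := by
  have hcells := hM.cells
  have hword := hM.word
  have hbm := b.isLt
  have hLm := hL.length_le
  have hreached := hF.reached (D.head b)
  have h5 := hA b
  have hcls : D.cls S T (D.head b) < M.cells := hM.cls_lt _
  have h0 := hR.head b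
  have hst := D.start_succ b
  have hse := D.start_mono (j := b + 1) (k := m) (by omega)
  classical
  refine does_seq (does_assign ?_ ?_)
  · refine ⟨⟨trivial, ?_⟩, ⟨by simp only [Expr.Ok]; omega, ⟨trivial, ?_⟩, ?_⟩, ?_⟩
    · simp only [Expr.val, hb]; omega
    · simp only [Expr.val, hb]; omega
    · simp only [Expr.val, hb, h0]; exact hcls
    · simp only [Expr.val, hb, h0, h5, hreached]; split_ifs <;> omega
  refine does_seq (does_testAll (n := D.start (b + 1)) (a := D.start b)
    (p := b ∈ A ∧ ¬ (D.head b ∈ S ∨ D.head b ∈ L.map D.head)) (by omega) trivial ?_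
    (by omega) ?_ (by omega) (by omega) (by omega) ?_ ?_ fun r₁ t₁ hr₁ hr8 ht₁ => ?_)
  · simp only [Expr.val, Function.update_of_ne (show 7 ≠ 8 by omega), hb]
    exact encode_start _ _ _ (by omega)
  · intro r' w' hr'
    have h7 : r' 7 = b := by
      rw [hr' 7 (by omega) (by omega), Function.update_of_ne (by omega), hb]
    refine ⟨⟨trivial, by simp only [Expr.Ok]; omega, by simp only [Expr.val]; omega⟩, ?_⟩
    simp only [Expr.val, h7]
    exact encode_start _ _ _ (by omega)
  · exact (hR.forall_tail b fun k => k < M.cells ∧ w 7 k ≤ 1).2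
      fun u _ => ⟨hM.cls_lt _, hF.reached.le_one u⟩
  · simp only [Function.update_self, Expr.val, hb, h0, h5, hreached]
    by_cases h₁ : b ∈ A <;> by_cases h₂ : D.head b ∈ S ∨ D.head b ∈ L.map D.head <;>
      simp only [h₁, h₂, if_true, if_false, not_true, not_false_eq_true, and_self, and_false,
        false_and]
  have htail := hR.forall_tail b fun k => w 7 k = 1
  have hcond : (∀ q, D.start b ≤ q → q < D.start (b + 1) → w 7 (w 1 q) = 1) ↔
      ∀ u ∈ D.tail b, u ∈ S ∨ u ∈ L.map D.head := by
    rw [htail]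
    exact forall₂_congr fun u _ => by rw [hF.reached u, ite_eq_one_iff]
  rw [hcond, and_assoc] at hr8
  have hr : ∀ y < 8, r₁ y = r y := fun y hy => by
    rw [hr₁ y (by omega) (by omega), Function.update_of_ne (by omega)]
  have hr4 := (hr 4 (by omega)).trans hF.length
  have hr7 := (hr 7 (by omega)).trans hb
  simp only [Expr.cost] at ht₁
  refine does_ite trivial (fun hne => ?_) (fun hz => does_skip ?_)
  · have hf := hr8.1 hne
    have hhS : D.head b ∉ S := fun h => hf.2.1 (.inl h)
    have hfire : D.fire S A L b = L ++ [b] := if_pos hf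
    refine does_seq (does_store ⟨trivial, by simp only [Expr.val]; omega⟩
      (by simp only [Expr.Ok]; omega) (by simp only [Expr.val, hr7, h0]; exact hcls) ?_)
    refine does_seq (does_store trivial trivial (by simp only [Expr.val]; omega) ?_)
    refine does_assign ⟨trivial, by simp only [Expr.Ok]; omega, by simp only [Expr.val]; omega⟩ ?_
    refine hQ _ _ _ (fun y hy hy4 => ?_) (fun B hB => ?_) ?_ ?_
    · simp (disch := omega) only [Function.update_of_ne, hr]
    · simp (disch := omega) only [Function.update_of_ne]
    · rw [hfire]
      refine ⟨fun v => ?_, ?_, fun i hi => ?_⟩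
      · simp only [Expr.val, hr7, h0]
        rw [Function.update_of_ne (by omega), Function.update_self]
        by_cases hv : v = D.head b
        · subst hv
          simp
        -- Marking the name of `head b` marks no other vertex, because `head b ∉ S`.
        · rw [Function.update_of_ne (fun h => hv ((D.cls_eq_cls_head_iff S T hhS v).1 h)),
            hF.reached v]
          simp [hv]
      · simp [Expr.val, hr4]
      · simp only [Expr.val, hr7, hr4, Function.update_self]
        rcases Nat.lt_or_ge i L.length with h | h
        · rw [Function.update_of_ne h.ne, Function.update_of_ne (by omega), hF.arc i h,
            List.getElem_append_left h]
        · have : i = L.length := by simp at hi; omega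
          subst this
          simp
    · simp only [Expr.cost]
      omega
  · have hf := fun hf => hr8.2 hf hz
    have hfire : D.fire S A L b = L := if_neg hf
    refine hQ _ _ _ (fun y hy _ => hr y hy) (fun _ _ => rfl) ?_ ?_
    · rw [hfire]
      exact ⟨hF.reached, hr4, hF.arc⟩
    · simp only [Expr.cost]
      omega

/-- List available hyperarcs that reach new vertices in `m` rounds. -/
def search : Cmd :=
  .seq (fill 6 (.add (.reg 0) (.const 2)) 7 0) (.seq (.store 7 (.reg 0) (.const 1))
    (.seq (.assign 4 (.const 0))
      (forLoop 6 (.const 0) (.reg 0) (forLoop 7 (.const 0) (.reg 0) tryFire))))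

theorem does_search (hM : Roomy M D) (hR : Ready D S T r w) (hA : Holds (w 5) A)
    (hQ : ∀ r' w' t, (∀ y < 6, y ≠ 4 → r' y = r y) → (∀ B < 7, w' B = w B) →
      Fired D S T (D.forward S A (List.finRange m) m) r' w' →
      t ≤ 150 * (m * m + m * D.start m + 1) → Q r' w' t) :
    Does M (D.encode S T) search r w Q := by
  have hcells := hM.cells
  have hword := hM.word
  have h0 := hR.arcs
  refine does_seq (does_fill (n := m + 2) (fun r' w' h => ⟨⟨trivial, ?_, ?_⟩, ?_⟩)
    (by omega) (by omega) (by omega) fun r₁ t₁ hr₁ ht₁ => ?_)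
  · simp only [Expr.Ok]; omega
  · simp only [Expr.val]; rw [h 0 (by omega)]; omega
  · simp only [Expr.val]; rw [h 0 (by omega)]; omega
  have hr0 : r₁ 0 = m := (hr₁ 0 (by omega)).trans h0
  -- Cell `m` stands for all vertices of `S`, so a single store marks them all.
  refine does_seq (does_store trivial (by simp only [Expr.Ok]; omega)
    (by simp only [Expr.val]; omega) ?_)
  refine does_seq (does_assign (by simp only [Expr.Ok]; omega) ?_)
  refine does_for (fun i r' w' => (∀ y < 6, y ≠ 4 → r' y = r y) ∧ (∀ B < 7, w' B = w B) ∧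
    Fired D S T (D.forward S A (List.finRange m) i) r' w') 0 m
    (fun i => (70 * m + 20 * D.start m + 20) * i) (by simp [Expr.Ok]) rfl (Nat.zero_le _)
    (by omega) ?_ ?_ ?_ ?_
  · refine ⟨fun y hy hy4 => ?_, fun B hB => ?_, ⟨fun v => ?_, ?_, ?_⟩⟩
    · simp (disch := omega) only [Function.update_of_ne, hr₁]
    · simp (disch := omega) only [Function.update_of_ne]
    · have hv := D.cls_le S T v
      simp only [Expr.val, hr0, Function.update_self]
      by_cases hvS : v ∈ S
      · rw [(D.cls_eq_iff_mem S T v).2 hvS]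
        simp [hvS]
      · rw [Function.update_of_ne (fun h => hvS ((D.cls_eq_iff_mem S T v).1 h)),
          if_pos (by omega)]
        simp [forward, hvS]
    · simp [forward, Expr.val]
    · intro i hi
      simp [forward] at hi
  · rintro i r' w' ⟨h, -⟩
    exact ⟨trivial, by simp only [Expr.val]; rw [h 0 (by omega) (by omega), h0]⟩
  · rintro i r' w' - hi rfl ⟨hr, hw, hF⟩
    set L₀ := D.forward S A (List.finRange m) (r' 6) with hL₀
    have hreach : D.Reaching S A L₀ := reaching_forward _ _
    -- The potential contains `D.start j`, the total size of the first `j` tail sets, because the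
    -- turns have unequal length.
    refine does_for (fun j r'' w'' => (∀ y < 7, y ≠ 4 → r'' y = r' y) ∧
      (∀ B < 7, w'' B = w B) ∧
      Fired D S T (((List.finRange m).take j).foldl (D.fire S A) L₀) r'' w'') 0 m
      (fun j => 70 * j + 20 * D.start j) (by simp [Expr.Ok]) rfl (Nat.zero_le _)
      (by omega) ?_ ?_ ?_ ?_
    · refine ⟨fun y hy hy4 => ?_, hw, hF.reached, ?_, hF.arc⟩
      · simp (disch := omega) only [Function.update_of_ne]
      · simpa using hF.length
    · rintro j r'' w'' ⟨h, -⟩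
      refine ⟨trivial, by simp only [Expr.val]; rw [h 0 (by omega) (by omega),
        hr 0 (by omega) (by omega), h0]⟩
    · rintro j r'' w'' - hj rfl ⟨h1, h2, h3⟩
      have hrr : ∀ y < 2, r'' y = r y := fun y hy => by
        rw [h1 y (by omega) (by omega), hr y (by omega) (by omega)]
      refine does_tryFire hM (hR.congr hrr fun B hB => h2 B (by omega))
        (by rw [h2 5 (by omega)]; exact hA) h3 (hreach.foldl_fire _) (b := ⟨r'' 7, hj⟩) rfl
        fun r₃ w₃ t₃ hr₃ hw₃ hF₃ ht₃ => ?_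
      refine ⟨hr₃ 7 (by omega) (by omega), ⟨fun y hy hy4 => ?_, fun B hB => ?_, ?_⟩, ?_⟩
      · simp (disch := omega) only [Function.update_of_ne, hr₃, h1]
      · rw [hw₃ B hB, h2 B hB]
      · have hlen : r'' 7 < (List.finRange m).length := by simpa using hj
        rw [← List.take_append_getElem hlen, List.foldl_append]
        simp only [List.foldl_cons, List.foldl_nil, List.getElem_finRange]
        exact ⟨hF₃.reached, by simpa using hF₃.length, hF₃.arc⟩
      · have := D.start_succ ⟨r'' 7, hj⟩
        simp only [Expr.cost] at this ht₃ ⊢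
        omega
    · rintro r₃ w₃ t₃ - ⟨h1, h2, h3⟩ ht₃
      refine ⟨h1 6 (by omega) (by omega), ⟨fun y hy hy4 => ?_, h2, ?_⟩, ?_⟩
      · simp (disch := omega) only [Function.update_of_ne, h1, hr]
      · rw [List.take_of_length_le (by simp)] at h3
        rw [forward_succ]
        exact ⟨h3.reached, by simpa using h3.length, h3.arc⟩
      · simp only [Expr.cost] at ht₃ ⊢
        rw [Nat.mul_succ]
        omega
  · rintro r₃ w₃ t₃ - ⟨h1, h2, h3⟩ ht₃
    refine hQ _ _ _ h1 h2 h3 ?_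
    have e1 := start_le_mul D
    have e2 := Nat.le_mul_self m
    have e5 : (70 * m + 20 * D.start m + 20) * m = 70 * (m * m) + 20 * (m * D.start m) + 20 * m := by
      ring
    simp only [Expr.cost] at ht₁ ht₃ ⊢
    omega

/-- Test whether all targets are reached. -/
def check : Cmd :=
  .seq (.assign 6 (.const 1)) (testAll 7 (.const 0) (.reg 1) 6 7 2)

theorem does_check (hM : Roomy M D) (hR : Ready D S T r w) (hT : T.card ≤ m)
    (hF : Reached D S T (w 7) L)
    (hQ : ∀ r' t, (∀ y < 6, r' y = r y) →
      (r' 6 ≠ 0 ↔ ∀ t ∈ T, t ∈ S ∨ t ∈ L.map D.head) →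
      t ≤ 30 * (m * m + m * D.start m + 1) → Q r' w t) :
    Does M (D.encode S T) check r w Q := by
  have hcells := hM.cells
  have hword := hM.word
  classical
  refine does_seq (does_assign (by simp only [Expr.Ok]; omega) ?_)
  refine does_testAll (n := T.card) (a := 0) (p := True) (by omega) (by simp [Expr.Ok]) rfl
    (Nat.zero_le _) (fun r' w' h => ⟨trivial, ?_⟩) (by omega) (by omega) (by omega) ?_
    (by simp [Expr.val]) fun r₁ t₁ hr₁ hr6 ht₁ => ?_
  · simp only [Expr.val]
    rw [h 1 (by omega) (by omega), Function.update_of_ne (by omega), hR.card]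
  · exact (hR.forall_target fun k => k < M.cells ∧ w 7 k ≤ 1).2
      fun u _ => ⟨hM.cls_lt _, hF.le_one u⟩
  · refine hQ _ _ (fun y hy => ?_) ?_ ?_
    · rw [hr₁ y (by omega) (by omega), Function.update_of_ne (by omega)]
    · rw [hr6, hR.forall_target fun k => w 7 k = 1, true_and]
      have : (∀ u ∈ T, w 7 (D.cls S T u) = 1) ↔ ∀ u ∈ T, u ∈ S ∨ u ∈ L.map D.head :=
        forall₂_congr fun u _ => by rw [hF u, ite_eq_one_iff]
      rw [this]
    · have e2 := Nat.le_mul_self m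
      simp only [Expr.cost] at ht₁ ⊢
      omega

end WordRAM

/-! ### Backward selection on the machine, and the hyperarc to branch on -/

namespace WordRAM

open BHypergraph

variable {n m : ℕ} {D : BHypergraph (Fin n) (Fin m)} {S T : Finset (Fin n)} {M : Limits}
  {r : ℕ → ℕ} {w : ℕ → ℕ → ℕ} {Q : (ℕ → ℕ) → (ℕ → ℕ → ℕ) → ℕ → Prop} {A P : Finset (Fin m)}
  {L K : List (Fin m)}

/-- The last hyperarc of the list that is not in `P`, and `m` if there is none. -/
def lastNew (P : Finset (Fin m)) (K : List (Fin m)) : ℕ :=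
  ((K.filter (· ∉ P)).getLast?.map Fin.val).getD m

/-- The selection runs backwards, so the first new hyperarc it meets is the last one of the final
list and must not be overwritten. The value `m` is no hyperarc and marks that none was met yet. -/
theorem lastNew_cons (b : Fin m) :
    lastNew P (b :: K) = if lastNew P K = m ∧ b ∉ P then (b : ℕ) else lastNew P K := by
  unfold lastNew
  by_cases hb : b ∈ P
  · simp [hb]
  · rw [List.filter_cons_of_pos (by simpa using hb), List.getLast?_cons]
    rcases (K.filter (· ∉ P)).getLast? with _ | c
    · simp [hb]
    · simp [c.isLt.ne]

theorem lastNew_eq_iff : lastNew P K = m ↔ K.filter (· ∉ P) = [] := by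
  unfold lastNew
  rw [← List.getLast?_eq_none_iff]
  rcases (K.filter (· ∉ P)).getLast? with _ | c
  · simp
  · simp [c.isLt.ne]

theorem lastNew_of_eq_concat {a : Fin m} (h : K.filter (· ∉ P) = L ++ [a]) :
    lastNew P K = a := by
  unfold lastNew
  rw [h]
  simp

/-- The state of the selection of needed hyperarcs: needed vertices are marked in the work array
`9`, selected hyperarcs in the work array `10`. -/
structure Selected (D : BHypergraph (Fin n) (Fin m)) (S T : Finset (Fin n)) (P : Finset (Fin m))
    (p : Finset (Fin n) × List (Fin m)) (r : ℕ → ℕ) (w : ℕ → ℕ → ℕ) : Prop where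
  need : ∀ a : Fin m, D.head a ∉ S →
    w 9 (D.cls S T (D.head a)) = if D.head a ∈ p.1 then 1 else 0
  kept : Holds (w 10) p.2.toFinset
  last : r 5 = lastNew P p.2

theorem Ready.exists_tail_iff (h : Ready D S T r w) (b : Fin m) {a : Fin m} (ha : D.head a ∉ S) :
    (∃ q, D.start b ≤ q ∧ q < D.start (b + 1) ∧ w 1 q = D.cls S T (D.head a)) ↔
      D.head a ∈ D.tail b := by
  have := (h.forall_tail b fun k => k ≠ D.cls S T (D.head a)).not
  push Not at this
  rw [this]
  simp only [D.cls_eq_cls_head_iff S T ha]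
  exact ⟨fun ⟨u, hu, hua⟩ => hua ▸ hu, fun h => ⟨_, h, rfl⟩⟩

theorem Ready.exists_target_iff (h : Ready D S T r w) {a : Fin m} (ha : D.head a ∉ S) :
    (∃ q, 0 ≤ q ∧ q < T.card ∧ w 2 q = D.cls S T (D.head a)) ↔ D.head a ∈ T := by
  have := (h.forall_target fun k => k ≠ D.cls S T (D.head a)).not
  push Not at this
  rw [this]
  simp only [D.cls_eq_cls_head_iff S T ha]
  exact ⟨fun ⟨u, hu, hua⟩ => hua ▸ hu, fun h => ⟨_, h, rfl⟩⟩

/-- Select the hyperarc at position `cnt - 1 - i` of the list if its head is needed, where `cnt` is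
in register `4` and `i` in register `7`. -/
def selectStep : Cmd :=
  .seq (.assign 8 (.work 8 (.sub (.sub (.reg 4) (.reg 7)) (.const 1))))
    (.ite (.work 9 (.work 0 (.reg 8)))
      (.seq (.store 10 (.reg 8) (.const 1))
        (.seq (mark 9 (.input 2 (.reg 8)) (.input 2 (.add (.reg 8) (.const 1))) 9 1)
          (.ite (.mul (.eq (.reg 5) (.reg 0)) (.eq (.work 6 (.reg 8)) (.const 0)))
            (.assign 5 (.reg 8)) .skip)))
      .skip)

/-- Array `9` is consulted only at names of heads outside `S`, which are unambiguous. Tails in `S`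
or without a hyperarc leading to them may set the cells `m` and `m + 1`, but these are never read.
-/
theorem does_selectStep (hM : Roomy M D) (hR : Ready D S T r w) (hP : Holds (w 6) P)
    {p : Finset (Fin n) × List (Fin m)} (hs : Selected D S T P p r w) {b : Fin m}
    (hb : w 8 (r 4 - r 7 - 1) = b) (hcell : r 4 ≤ m) (hbS : D.head b ∉ S)
    (hQ : ∀ r' w' t, (∀ y < 8, y ≠ 5 → r' y = r y) → (∀ B < 9, w' B = w B) →
      Selected D S T P (D.pruneStep b p) r' w' → t ≤ 20 * D.start m + 60 → Q r' w' t) :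
    Does M (D.encode S T) selectStep r w Q := by
  have hcells := hM.cells
  have hword := hM.word
  have hbm := b.isLt
  have hcls : D.cls S T (D.head b) < M.cells := hM.cls_lt _
  have h0 := hR.head b
  have hneed := hs.need b hbS
  have hst := D.start_succ b
  have hse := D.start_mono (j := b + 1) (k := m) (by omega)
  have hval : (Expr.work 8 (.sub (.sub (.reg 4) (.reg 7)) (.const 1))).val (D.encode S T) r w = b :=
    hb
  classical
  refine does_seq (does_assign ⟨⟨⟨trivial, trivial⟩, by simp only [Expr.Ok]; omega⟩,
    by simp only [Expr.val]; omega⟩ ?_)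
  rw [hval]
  refine does_ite ⟨⟨trivial, ?_⟩, ?_⟩ (fun hne => ?_) (fun hz => does_skip ?_)
  · simp only [Expr.val, Function.update_self]; omega
  · simp only [Expr.val, Function.update_self, h0]; exact hcls
  · simp only [Expr.val, Function.update_self, h0, hneed] at hne
    rw [ite_ne_zero_iff] at hne
    have hstep : D.pruneStep b p = (p.1 ∪ D.tail b, b :: p.2) := if_pos hne
    refine does_seq (does_store trivial (by simp only [Expr.Ok]; omega)
      (by simp only [Expr.val, Function.update_self]; omega) ?_)
    simp only [Expr.val, Function.update_self]
    refine does_seq (does_mark (a := D.start b) (n := D.start (b + 1)) (by omega) trivial ?_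
      (by omega) ?_ (by omega) (by omega) (by omega) ?_ fun r₁ t₁ hr₁ ht₁ => ?_)
    · simp only [Expr.val, Function.update_self]
      exact encode_start _ _ _ (by omega)
    · intro r' w' hr'
      have h8 : r' 8 = b := by rw [hr' 8 (by omega), Function.update_self]
      refine ⟨⟨trivial, by simp only [Expr.Ok]; omega, by simp only [Expr.val]; omega⟩, ?_⟩
      simp only [Expr.val, h8]
      exact encode_start _ _ _ (by omega)
    · simp only [Function.update_of_ne (show 1 ≠ 10 by omega)]
      exact (hR.forall_tail b fun k => k < M.cells).2 fun u _ => hM.cls_lt _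
    have hr : ∀ y < 8, r₁ y = r y := fun y hy => by
      rw [hr₁ y (by omega), Function.update_of_ne (by omega)]
    have hr8 : r₁ 8 = b := by rw [hr₁ 8 (by omega), Function.update_self]
    have hr5 := (hr 5 (by omega)).trans hs.last
    have hr0 := (hr 0 (by omega)).trans hR.arcs
    have hPb := hP b
    simp only [Expr.cost] at ht₁
    -- The two outcomes of the last test leave the same arrays and differ, as far as it matters,
    -- only in register `5`.
    have fin : ∀ (r' : ℕ → ℕ) (t : ℕ), (∀ y < 8, y ≠ 5 → r' y = r y) →
        r' 5 = (if lastNew P p.2 = m ∧ b ∉ P then (b : ℕ) else lastNew P p.2) → t ≤ 10 →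
        Q r' (Function.update (Function.update w 10 (Function.update (w 10) b 1)) 9
          fun k => if ∃ q, D.start b ≤ q ∧ q < D.start (b + 1) ∧
            Function.update w 10 (Function.update (w 10) b 1) 1 q = k then 1
            else Function.update w 10 (Function.update (w 10) b 1) 9 k)
          (1 + (Expr.work 8 (.sub (.sub (.reg 4) (.reg 7)) (.const 1))).cost +
            (1 + (Expr.work 9 (.work 0 (.reg 8))).cost +
              (1 + (Expr.reg 8).cost + (Expr.const 1).cost +
                (t₁ + (1 + (Expr.mul (.eq (.reg 5) (.reg 0))
                  (.eq (.work 6 (.reg 8)) (.const 0))).cost + t))))) := by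
      intro r' t h1 h5 ht
      refine hQ _ _ _ h1 (fun B hB => ?_) ?_ ?_
      · simp (disch := omega) only [Function.update_of_ne]
      · rw [hstep]
        refine ⟨fun a ha => ?_, ?_, ?_⟩
        · simp (disch := omega) only [Function.update_of_ne, Function.update_self]
          rw [hs.need a ha]
          by_cases h : D.head a ∈ D.tail b
          · rw [if_pos ((hR.exists_tail_iff b ha).2 h), if_pos (by simp [h])]
          · rw [if_neg (fun h' => h ((hR.exists_tail_iff b ha).1 h'))]
            simp [h]
        · rw [Function.update_of_ne (by omega), Function.update_self]
          exact hs.kept.update (a := b) (by simp) fun c hc => by simp [hc]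
        · rw [h5, lastNew_cons]
      · simp only [Expr.cost]
        omega
    refine does_ite ⟨⟨trivial, trivial⟩, ⟨⟨trivial, ?_⟩, ?_⟩, ?_⟩ (fun hne' => does_assign trivial ?_)
      (fun hz' => does_skip ?_)
    · simp only [Expr.val]; omega
    · simp only [Expr.Ok]; omega
    · exact (Nat.mul_le_mul ite_le_one ite_le_one).trans (by omega)
    · simp (disch := omega) only [Expr.val, Function.update_of_ne, hr5, hr0, hr8, hPb] at hne'
      refine fin _ _ (fun y hy hy5 => by rw [Function.update_of_ne hy5, hr y hy]) ?_
        (by simp [Expr.cost])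
      rw [Function.update_self, if_pos]
      · exact hr8
      · by_contra h
        apply hne'
        by_cases h1 : lastNew P p.2 = m <;> by_cases h2 : b ∈ P <;> simp_all
    · simp (disch := omega) only [Expr.val, Function.update_of_ne, hr5, hr0, hr8, hPb] at hz'
      refine fin _ _ (fun y hy _ => hr y hy) ?_ (by omega)
      rw [hr5, if_neg]
      rintro ⟨h1, h2⟩
      simp [h1, h2] at hz'
  · simp only [Expr.val, Function.update_self, h0, hneed] at hz
    have hh : D.head b ∉ p.1 := fun hh => by rw [if_pos hh] at hz; omega
    have hstep : D.pruneStep b p = p := if_neg hh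
    refine hQ _ _ _ (fun y hy _ => by rw [Function.update_of_ne (by omega)]) (fun _ _ => rfl) ?_ ?_
    · rw [hstep]
      exact ⟨hs.need, hs.kept, by rw [Function.update_of_ne (by omega)]; exact hs.last⟩
    · simp only [Expr.cost]
      omega

/-- Select the hyperarcs of the list that are needed to reach the targets. -/
def select : Cmd :=
  .seq (fill 7 (.add (.reg 0) (.const 2)) 9 0) (.seq (mark 7 (.const 0) (.reg 1) 9 2)
    (.seq (fill 7 (.reg 0) 10 0) (.seq (.assign 5 (.reg 0))
      (forLoop 7 (.const 0) (.reg 4) selectStep))))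

theorem does_select (hM : Roomy M D) (hR : Ready D S T r w) (hT : T.card ≤ m)
    (hP : Holds (w 6) P) (hF : Fired D S T L r w) (hL : D.Reaching S A L)
    (hQ : ∀ r' w' t, (∀ y < 5, r' y = r y) → (∀ B < 9, w' B = w B) →
      Holds (w' 10) (D.prune L T).toFinset → r' 5 = lastNew P (D.prune L T) →
      t ≤ 200 * (m * m + m * D.start m + 1) → Q r' w' t) :
    Does M (D.encode S T) select r w Q := by
  have hcells := hM.cells
  have hword := hM.word
  have h0 := hR.arcs
  have hLm := hL.length_le
  refine does_seq (does_fill (n := m + 2) (fun r' w' h => ⟨⟨trivial, ?_, ?_⟩, ?_⟩)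
    (by omega) (by omega) (by omega) fun r₁ t₁ hr₁ ht₁ => ?_)
  · simp only [Expr.Ok]; omega
  · simp only [Expr.val]; rw [h 0 (by omega)]; omega
  · simp only [Expr.val]; rw [h 0 (by omega)]; omega
  refine does_seq (does_mark (a := 0) (n := T.card) (by omega) (by simp [Expr.Ok]) rfl
    (by omega) (fun r' w' h => ⟨trivial, ?_⟩) (by omega) (by omega) (by omega) ?_
    fun r₂ t₂ hr₂ ht₂ => ?_)
  · simp only [Expr.val]; rw [h 1 (by omega), hr₁ 1 (by omega), hR.card]
  · simp only [Function.update_of_ne (show 2 ≠ 9 by omega)]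
    exact (hR.forall_target fun k => k < M.cells).2 fun u _ => hM.cls_lt _
  refine does_seq (does_fill (n := m) (fun r' w' h => ⟨trivial, ?_⟩)
    (by omega) (by omega) (by omega) fun r₃ t₃ hr₃ ht₃ => ?_)
  · simp only [Expr.val]; rw [h 0 (by omega), hr₂ 0 (by omega), hr₁ 0 (by omega), h0]
  refine does_seq (does_assign trivial ?_)
  have hr : ∀ y < 7, r₃ y = r y := fun y hy => by rw [hr₃ y hy, hr₂ y hy, hr₁ y hy]
  -- After `i` turns exactly the last `i` hyperarcs of `L` have been treated.
  refine does_for (fun i r' w' => (∀ y < 5, r' y = r y) ∧ (∀ B < 9, w' B = w B) ∧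
    Selected D S T P ((L.drop (L.length - i)).foldr D.pruneStep (T, [])) r' w') 0 L.length
    (fun i => (20 * D.start m + 80) * i) (by simp [Expr.Ok]) rfl (Nat.zero_le _)
    (by omega) ?_ ?_ ?_ ?_
  · refine ⟨fun y hy => ?_, fun B hB => ?_, ⟨fun a ha => ?_, fun b => ?_, ?_⟩⟩
    · simp (disch := omega) only [Function.update_of_ne, hr]
    · simp (disch := omega) only [Function.update_of_ne]
    · have hle := D.cls_le S T (D.head a)
      simp (disch := omega) only [Function.update_of_ne, Function.update_self]
      simp only [Nat.sub_zero, List.drop_length, List.foldr_nil]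
      rw [if_pos (show D.cls S T (D.head a) < m + 2 by omega)]
      have hT' : (∃ q, 0 ≤ q ∧ q < T.card ∧ Function.update w 9
          (fun k => if k < m + 2 then 0 else w 9 k) 2 q = D.cls S T (D.head a)) ↔ D.head a ∈ T := by
        rw [Function.update_of_ne (by omega)]
        exact hR.exists_target_iff ha
      split_ifs with h1 h2 h2
      · rfl
      · exact absurd (hT'.1 h1) h2
      · exact absurd (hT'.2 h2) h1
      · rfl
    · simp
    · simp [lastNew, Expr.val, hr 0, h0]
  · rintro i r' w' ⟨h, -⟩
    exact ⟨trivial, by simp only [Expr.val]; rw [h 4 (by omega), hF.length]⟩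
  · rintro i r' w' - hi rfl ⟨h1, h2, hs⟩
    have hr4 : r' 4 = L.length := by rw [h1 4 (by omega), hF.length]
    have hlt : L.length - (r' 7 + 1) < L.length := by omega
    refine does_selectStep hM (hR.congr (fun y hy => h1 y (by omega)) fun B hB => h2 B (by omega))
      (by rw [h2 6 (by omega)]; exact hP) hs (b := L[L.length - (r' 7 + 1)]) ?_ (by omega)
      (hL.head_notMem _ (List.getElem_mem _)) fun r₄ w₄ t₄ hr₄ hw₄ hs₄ ht₄ => ?_
    · rw [h2 8 (by omega), hr4, Nat.sub_sub]
      exact hF.arc _ hlt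
    · refine ⟨hr₄ 7 (by omega) (by omega), ⟨fun y hy => ?_, fun B hB => ?_, ?_⟩, ?_⟩
      · simp (disch := omega) only [Function.update_of_ne, hr₄, h1]
      · rw [hw₄ B hB, h2 B hB]
      · rw [List.drop_eq_getElem_cons hlt, show L.length - (r' 7 + 1) + 1 = L.length - r' 7 by omega]
        exact ⟨hs₄.need, hs₄.kept, by rw [Function.update_of_ne (by omega)]; exact hs₄.last⟩
      · simp only [Expr.cost]
        rw [Nat.mul_succ]
        omega
  · rintro r₄ w₄ t₄ - ⟨h1, h2, hs⟩ ht₄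
    rw [Nat.sub_self, List.drop_zero] at hs
    refine hQ _ _ _ h1 h2 hs.kept hs.last ?_
    have e1 := start_le_mul D
    have e2 := Nat.le_mul_self m
    have e3 : (20 * D.start m + 80) * L.length ≤ (20 * D.start m + 80) * m :=
      Nat.mul_le_mul_left _ hLm
    have e4 : (20 * D.start m + 80) * m = 20 * (m * D.start m) + 80 * m := by ring
    simp only [Expr.cost] at ht₁ ht₂ ht₃ ht₄ ⊢
    omega

end WordRAM

/-! ### Rounds of the main loop -/

namespace WordRAM

open BHypergraph

section Rounds

variable {n m : ℕ} {D : BHypergraph (Fin n) (Fin m)} {S T : Finset (Fin n)} {M : Limits}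
  {r : ℕ → ℕ} {w : ℕ → ℕ → ℕ} {Q : (ℕ → ℕ) → (ℕ → ℕ → ℕ) → ℕ → Prop} {A P : Finset (Fin m)}
  {L K : List (Fin m)} {ds : List (Fin m × Bool)} {σ : State}

/-- The list of hyperarcs from which the hyperpath is selected. -/
def searchList (D : BHypergraph (Fin n) (Fin m)) (S : Finset (Fin n)) (A : Finset (Fin m)) :
    List (Fin m) :=
  D.forward S A (List.finRange m) m

theorem reaching_searchList : D.Reaching S A (searchList D S A) := reaching_forward _ _

theorem connects_iff_searchList :
    D.Connects S T A ↔ ∀ t ∈ T, t ∈ S ∨ t ∈ (searchList D S A).map D.head :=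
  forall₂_congr fun _ _ => bConnected_iff_forward _ (fun b _ => List.mem_finRange b)
    (by simpa using Finset.card_le_univ A)

theorem isPath_searchList (h : D.Connects S T A) :
    D.IsPath S T A (D.prune (searchList D S A) T) :=
  reaching_searchList.isPath_prune (connects_iff_searchList.1 h)

/-- Search for a hyperpath among the available hyperarcs. -/
def find : Cmd := .seq rebuild (.seq search check)

theorem does_find (hM : Roomy M D) (hR : Ready D S T r w) (hT : T.card ≤ m)
    (hs : Stack ds r w) (hd : ds.length ≤ m)
    (hQ : ∀ r' w' t, Ready D S T r' w' → Stack ds r' w' → r' 3 = r 3 →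
      Holds (w' 6) (available D ds).2 →
      Fired D S T (searchList D S (available D ds).1) r' w' →
      (r' 6 ≠ 0 ↔ D.Connects S T (available D ds).1) →
      t ≤ 270 * (m * m + m * D.start m + 1) → Q r' w' t) :
    Does M (D.encode S T) find r w Q := by
  refine does_seq (does_rebuild hM hR.arcs hs hd fun r₁ w₁ t₁ hr₁ hw₁ h5 h6 ht₁ => ?_)
  have hR₁ := hR.congr (fun y hy => hr₁ y (by omega)) fun B hB => hw₁ B (by omega)
  refine does_seq (does_search hM hR₁ h5 fun r₂ w₂ t₂ hr₂ hw₂ hF ht₂ => ?_)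
  have hR₂ := hR₁.congr (fun y hy => hr₂ y (by omega) (by omega)) fun B hB => hw₂ B (by omega)
  refine does_check hM hR₂ hT hF.reached fun r₃ t₃ hr₃ h ht₃ => ?_
  refine hQ _ _ _ (hR₂.congr (fun y hy => hr₃ y (by omega)) fun _ _ => rfl) (hs.congr ?_ ?_ ?_) ?_
    (by rwa [hw₂ 6 (by omega)]) ⟨hF.reached, (hr₃ 4 (by omega)).trans hF.length, hF.arc⟩ ?_ ?_
  · rw [hr₃ 2 (by omega), hr₂ 2 (by omega) (by omega), hr₁ 2 (by omega)]
  · rw [hw₂ 3 (by omega), hw₁ 3 (by omega)]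
  · rw [hw₂ 4 (by omega), hw₁ 4 (by omega)]
  · rw [hr₃ 3 (by omega), hr₂ 3 (by omega) (by omega), hr₁ 3 (by omega)]
  · rw [h, connects_iff_searchList]; rfl
  · omega

/-- Print the selected hyperarcs and turn to the next decision to be revised. -/
def output : Cmd :=
  .seq (forLoop 6 (.const 0) (.reg 0) (.ite (.work 10 (.reg 6)) (.emit (.reg 6)) .skip))
    (.seq .flush (.assign 3 (.const 1)))

/-- Decide not to use the hyperarc in register `5`. -/
def push : Cmd :=
  .seq (.store 3 (.reg 2) (.reg 5)) (.seq (.store 4 (.reg 2) (.const 0))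
    (.assign 2 (.add (.reg 2) (.const 1))))

/-- Search for a hyperpath in the current hypergraph, and output it or branch on it. -/
def descend : Cmd :=
  .seq find (.ite (.reg 6) (.seq select (.ite (.eq (.reg 5) (.reg 0)) output push))
    (.assign 3 (.const 1)))

/-- Revise the last decision. -/
def ascend : Cmd :=
  .ite (.work 4 (.sub (.reg 2) (.const 1))) (.assign 2 (.sub (.reg 2) (.const 1)))
    (.seq (.store 4 (.sub (.reg 2) (.const 1)) (.const 1)) (.assign 3 (.const 0)))

/-- One round of the main loop. -/
def body : Cmd := .ite (.reg 3) ascend descend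

/-- The condition of the main loop. -/
def guard : Expr := .add (.eq (.reg 3) (.const 0)) (.lt (.const 0) (.reg 2))

/-- The state between two rounds of the main loop, after the decisions `ds`: with `phase = 0` if a
hyperpath has to be searched for, and with `phase = 1` if all outputs for these decisions have been
made. -/
structure At (M : Limits) (D : BHypergraph (Fin n) (Fin m)) (S T : Finset (Fin n))
    (ds : List (Fin m × Bool)) (phase : ℕ) (σ : State) : Prop where
  ready : Ready D S T σ.reg σ.work
  stack : Stack ds σ.reg σ.work
  phase : σ.reg 3 = phase
  fits : Fits M σ.reg σ.work
  buffer : σ.buffer = []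

/-- An upper bound for the duration of a round. -/
def period (D : BHypergraph (Fin n) (Fin m)) : ℕ := 700 * (m * m + m * D.start m + 1)

/-- The main loop passes from one state to the other in one round. -/
def Round (M : Limits) (inp : ℕ → List ℕ) (σ σ' : State) : Prop :=
  guard.Safe M inp σ ∧ guard.eval inp σ ≠ 0 ∧ Exec M inp body (σ.tick (1 + guard.cost)) σ'

theorem guard_safe (hM : Roomy M D) (hf : Fits M σ.reg σ.work) :
    guard.Safe M (D.encode S T) σ := by
  have hword := hM.word
  refine Expr.Ok.safe hM.inputFits hf ⟨⟨trivial, ?_⟩, ⟨?_, trivial⟩, ?_⟩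
  · simp only [Expr.Ok]; omega
  · simp only [Expr.Ok]; omega
  · exact (Nat.add_le_add ite_le_one ite_le_one).trans (by omega)

theorem guard_eval_ne_zero (inp : ℕ → List ℕ) :
    guard.eval inp σ ≠ 0 ↔ σ.reg 3 = 0 ∨ 0 < σ.reg 2 := by
  simp only [guard, Expr.eval]
  by_cases h1 : σ.reg 3 = 0 <;> by_cases h2 : 0 < σ.reg 2 <;> simp [h1, h2]

/-- This covers the rounds without output, since `Does` leaves buffer and log unchanged. The summand
`8` pays for the test of the main loop. -/
theorem round_of_does (hM : Roomy M D) (hf : Fits M σ.reg σ.work)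
    (hg : σ.reg 3 = 0 ∨ 0 < σ.reg 2) (hb : σ.buffer = []) {phase : ℕ}
    (h : Does M (D.encode S T) body σ.reg σ.work fun r' w' t =>
      Ready D S T r' w' ∧ Stack ds r' w' ∧ r' 3 = phase ∧ t + 8 ≤ period D) :
    ∃ σ', Round M (D.encode S T) σ σ' ∧ At M D S T ds phase σ' ∧ σ'.log = σ.log ∧
      σ'.time ≤ σ.time + period D := by
  obtain ⟨r', w', t, he, hf', h1, h2, h3, h4⟩ := h hM.inputFits hf
    (σ.time + (1 + guard.cost)) σ.buffer σ.log
  refine ⟨_, ⟨guard_safe hM hf, (guard_eval_ne_zero _).2 hg, he⟩, ⟨h1, h2, h3, hf', hb⟩, rfl, ?_⟩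
  have : 1 + guard.cost = 8 := rfl
  simp only [this]
  omega

/-- Both calls that branch on `a` are finished, so control returns to the caller. -/
theorem round_pop (hM : Roomy M D) {a : Fin m} (hd : ds.length < m)
    (h : At M D S T (ds ++ [(a, true)]) 1 σ) :
    ∃ σ', Round M (D.encode S T) σ σ' ∧ At M D S T ds 1 σ' ∧ σ'.log = σ.log ∧
      σ'.time ≤ σ.time + period D := by
  have hcells := hM.cells
  have hword := hM.word
  have h2 := h.stack.length
  have h4 := h.stack.used ds.length (by simp)
  simp only [List.length_append, List.length_singleton] at h2
  simp only [List.getElem_concat_length, if_true] at h4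
  refine round_of_does hM h.fits (.inr (by omega)) h.buffer ?_
  refine does_ite trivial (fun _ => ?_) (fun hz => absurd (h.phase.symm.trans hz) (by omega))
  refine does_ite ⟨⟨trivial, by simp only [Expr.Ok]; omega⟩, by simp only [Expr.val]; omega⟩
    (fun _ => does_assign ⟨trivial, by simp only [Expr.Ok]; omega⟩ ?_) fun hz => ?_
  · refine ⟨h.ready.congr (fun y hy => ?_) fun _ _ => rfl, ⟨?_, fun i hi => ?_, fun i hi => ?_⟩, ?_, ?_⟩
    · rw [Function.update_of_ne (by omega)]
    · simp [Expr.val, h2]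
    · rw [h.stack.arc i (by simp; omega), List.getElem_append_left hi]
    · rw [h.stack.used i (by simp; omega), List.getElem_append_left hi]
    · rw [Function.update_of_ne (by omega), h.phase]
    · simp only [Expr.cost, period]
      omega
  · simp only [Expr.val, h2, Nat.add_sub_cancel, h4] at hz
    omega

/-- The call without `a` is finished; the call that uses `a` begins. -/
theorem round_flip (hM : Roomy M D) {a : Fin m} (hd : ds.length < m)
    (h : At M D S T (ds ++ [(a, false)]) 1 σ) :
    ∃ σ', Round M (D.encode S T) σ σ' ∧ At M D S T (ds ++ [(a, true)]) 0 σ' ∧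
      σ'.log = σ.log ∧ σ'.time ≤ σ.time + period D := by
  have hcells := hM.cells
  have hword := hM.word
  have h2 := h.stack.length
  have h4 := h.stack.used ds.length (by simp)
  simp only [List.length_append, List.length_singleton] at h2
  simp only [List.getElem_concat_length, Bool.false_eq_true, if_false] at h4
  refine round_of_does hM h.fits (.inr (by omega)) h.buffer ?_
  refine does_ite trivial (fun _ => ?_) (fun hz => absurd (h.phase.symm.trans hz) (by omega))
  refine does_ite ⟨⟨trivial, by simp only [Expr.Ok]; omega⟩, by simp only [Expr.val]; omega⟩
    (fun hne => ?_) fun hz => ?_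
  · simp only [Expr.val, h2, Nat.add_sub_cancel, h4] at hne
    omega
  · refine does_seq (does_store ⟨trivial, by simp only [Expr.Ok]; omega⟩
      (by simp only [Expr.Ok]; omega) (by simp only [Expr.val]; omega) ?_)
    refine does_assign (by simp only [Expr.Ok]; omega) ?_
    refine ⟨h.ready.congr (fun y hy => ?_) fun B hB => ?_, ⟨?_, fun i hi => ?_, fun i hi => ?_⟩,
      ?_, ?_⟩
    · rw [Function.update_of_ne (by omega)]
    · rw [Function.update_of_ne (by omega)]
    · simp [h2]
    · have hi' : i < (ds ++ [(a, false)]).length := by simpa using hi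
      rw [Function.update_of_ne (by omega), h.stack.arc i hi']
      rcases Nat.lt_or_ge i ds.length with hlt | hge
      · rw [List.getElem_append_left hlt, List.getElem_append_left hlt]
      · have : i = ds.length := by simp at hi'; omega
        subst this
        simp
    · have hi' : i < (ds ++ [(a, false)]).length := by simpa using hi
      simp only [Function.update_self, Expr.val, h2, Nat.add_sub_cancel]
      rcases Nat.lt_or_ge i ds.length with hlt | hge
      · rw [Function.update_of_ne hlt.ne, h.stack.used i hi', List.getElem_append_left hlt,
          List.getElem_append_left hlt]
      · have : i = ds.length := by simp at hi'; omega
        subst this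
        simp
    · rw [Function.update_self]; rfl
    · simp only [Expr.cost, period]
      omega

theorem round_fail (hM : Roomy M D) (hT : T.card ≤ m) (hd : ds.length ≤ m)
    (h : At M D S T ds 0 σ) (hc : ¬ D.Connects S T (available D ds).1) :
    ∃ σ', Round M (D.encode S T) σ σ' ∧ At M D S T ds 1 σ' ∧ σ'.log = σ.log ∧
      σ'.time ≤ σ.time + period D := by
  have hword := hM.word
  refine round_of_does hM h.fits (.inl h.phase) h.buffer ?_
  refine does_ite trivial (fun hne => absurd h.phase hne) fun _ => ?_
  refine does_seq (does_find hM h.ready hT h.stack hd fun r₁ w₁ t₁ hR hS h3 _ _ h6 ht => ?_)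
  refine does_ite trivial (fun hne => absurd (h6.1 hne) hc) fun _ => ?_
  refine does_assign (by simp only [Expr.Ok]; omega) ⟨hR.congr (fun y hy => ?_) fun _ _ => rfl,
    hS.congr ?_ rfl rfl, ?_, ?_⟩
  · rw [Function.update_of_ne (by omega)]
  · rw [Function.update_of_ne (by omega)]
  · rw [Function.update_self]; rfl
  · simp only [Expr.cost, period]
    omega

/-- The last hyperarc of the hyperpath outside `P` is the one to branch on. The call without it
comes first, hence `false`. -/
theorem round_push (hM : Roomy M D) (hT : T.card ≤ m) (hd : ds.length ≤ m)
    (h : At M D S T ds 0 σ) (hc : D.Connects S T (available D ds).1) {a : Fin m}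
    (ha : (D.prune (searchList D S (available D ds).1) T).filter (· ∉ (available D ds).2) =
      L ++ [a]) :
    ∃ σ', Round M (D.encode S T) σ σ' ∧ At M D S T (ds ++ [(a, false)]) 0 σ' ∧
      σ'.log = σ.log ∧ σ'.time ≤ σ.time + period D := by
  have hcells := hM.cells
  have hword := hM.word
  refine round_of_does hM h.fits (.inl h.phase) h.buffer ?_
  refine does_ite trivial (fun hne => absurd h.phase hne) fun _ => ?_
  refine does_seq (does_find hM h.ready hT h.stack hd fun r₁ w₁ t₁ hR hS h3 hP hF h6 ht => ?_)
  refine does_ite trivial (fun _ => ?_) fun hz => absurd hz (h6.2 hc)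
  refine does_seq (does_select hM hR hT hP hF reaching_searchList
    fun r₂ w₂ t₂ hr₂ hw₂ _ h5 ht₂ => ?_)
  have hR₂ := hR.congr (fun y hy => hr₂ y (by omega)) fun B hB => hw₂ B (by omega)
  have hS₂ : Stack ds r₂ w₂ := hS.congr (hr₂ 2 (by omega)) (hw₂ 3 (by omega)) (hw₂ 4 (by omega))
  rw [lastNew_of_eq_concat ha] at h5
  refine does_ite ⟨trivial, trivial⟩ (fun hne => ?_) fun _ => ?_
  · simp only [Expr.val, h5, hR₂.arcs] at hne
    exact absurd (if_neg a.isLt.ne) hne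
  · have h2 := hS₂.length
    refine does_seq (does_store trivial trivial (by simp only [Expr.val]; omega) ?_)
    refine does_seq (does_store trivial (by simp only [Expr.Ok]; omega)
      (by simp only [Expr.val]; omega) ?_)
    refine does_assign ⟨trivial, by simp only [Expr.Ok]; omega, by simp only [Expr.val]; omega⟩ ?_
    refine ⟨hR₂.congr (fun y hy => ?_) fun B hB => ?_, ⟨?_, fun i hi => ?_, fun i hi => ?_⟩,
      ?_, ?_⟩
    · rw [Function.update_of_ne (by omega)]
    · simp (disch := omega) only [Function.update_of_ne]
    · simp [Expr.val, h2]
    · rw [Function.update_of_ne (show 3 ≠ 4 by omega), Function.update_self]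
      simp only [Expr.val, h2, h5]
      rcases Nat.lt_or_ge i ds.length with hlt | hge
      · rw [Function.update_of_ne hlt.ne, hS₂.arc i hlt, List.getElem_append_left hlt]
      · have : i = ds.length := by simp at hi; omega
        subst this
        simp
    · rw [Function.update_self, Function.update_of_ne (show 4 ≠ 3 by omega)]
      simp only [Expr.val, h2]
      rcases Nat.lt_or_ge i ds.length with hlt | hge
      · rw [Function.update_of_ne hlt.ne, hS₂.used i hlt, List.getElem_append_left hlt]
      · have : i = ds.length := by simp at hi; omega
        subst this
        simp
    · rw [Function.update_of_ne (by omega), hr₂ 3 (by omega), h3, h.phase]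
    · simp only [Expr.cost, period]
      omega

/-- Printing changes the buffer, which `Does` keeps fixed, so this loop is followed directly, by
induction on the number `k` of remaining turns. -/
theorem exec_emit_loop (hM : Roomy M D) {B : Finset (Fin m)} (hB : Holds (w 10) B) :
    ∀ (k i : ℕ) (r : ℕ → ℕ) (τ : ℕ) (buf : List ℕ) (lg : List (ℕ × List ℕ)), i + k = m →
      r 0 = m → r 6 = i → Fits M r w → ∃ r' t,
        Exec M (D.encode S T) (.loop (.lt (.reg 6) (.reg 0))
          (.seq (.ite (.work 10 (.reg 6)) (.emit (.reg 6)) .skip)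
            (.assign 6 (.add (.reg 6) (.const 1))))) ⟨r, w, τ, buf, lg⟩
          ⟨r', w, τ + t, buf ++ (((List.finRange m).drop i).filter (· ∈ B)).map Fin.val, lg⟩ ∧
        (∀ y < 6, r' y = r y) ∧ Fits M r' w ∧ t ≤ 20 * k + 4 := by
  have hcells := hM.cells
  have hword := hM.word
  have hi : InputFits M (D.encode S T) := hM.inputFits
  intro k
  induction k with
  | zero =>
    intro i r τ buf lg hk h0 h6 hf
    obtain rfl : i = m := by omega
    refine ⟨r, 4, ?_, fun _ _ => rfl, hf, le_rfl⟩
    rw [List.drop_of_length_le (by simp)]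
    simp only [List.filter_nil, List.map_nil, List.append_nil]
    exact .loopFalse _ _ _ (Expr.Ok.safe (σ := ⟨r, w, τ, buf, lg⟩) hi hf ⟨trivial, trivial⟩)
      (by simp [Expr.eval, h0, h6])
  | succ k ih =>
    intro i r τ buf lg hk h0 h6 hf
    have him : i < m := by omega
    have hi' : i < (List.finRange m).length := by simpa using him
    have hb := hB ⟨i, him⟩
    simp only at hb
    have hs : (Expr.work 10 (.reg 6)).Safe M (D.encode S T) ⟨r, w, τ + 4, buf, lg⟩ :=
      Expr.Ok.safe hi hf ⟨trivial, by simp only [Expr.val]; omega⟩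
    have hev : (Expr.work 10 (.reg 6)).eval (D.encode S T) ⟨r, w, τ + 4, buf, lg⟩ =
        if (⟨i, him⟩ : Fin m) ∈ B then 1 else 0 := by
      simp only [Expr.eval, h6, hb]
    have hprint : ∃ t, t ≤ 6 ∧ Exec M (D.encode S T)
        (.ite (.work 10 (.reg 6)) (.emit (.reg 6)) .skip) ⟨r, w, τ + 4, buf, lg⟩
        ⟨r, w, τ + 4 + t, buf ++ if (⟨i, him⟩ : Fin m) ∈ B then [i] else [], lg⟩ := by
      by_cases hB' : (⟨i, him⟩ : Fin m) ∈ B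
      · rw [if_pos hB'] at hev ⊢
        refine ⟨5, by omega, .iteTrue _ _ _ _ _ hs (by omega) ?_⟩
        rw [← h6]
        exact .emit _ _ (Expr.Ok.safe (e := .reg 6) hi hf trivial)
      · rw [if_neg hB'] at hev ⊢
        refine ⟨4, by omega, .iteFalse _ _ _ _ _ hs hev ?_⟩
        rw [List.append_nil]
        exact .skip _
    obtain ⟨t₁, ht₁, h₁⟩ := hprint
    have hinc : Does M (D.encode S T) (.assign 6 (.add (.reg 6) (.const 1))) r w fun r' w' t =>
        r' = Function.update r 6 (i + 1) ∧ w' = w ∧ t = 4 :=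
      does_assign ⟨trivial, by simp only [Expr.Ok]; omega, by simp only [Expr.val]; omega⟩
        ⟨by simp only [Expr.val, h6], rfl, rfl⟩
    obtain ⟨r₂, w₂, t₂, h₂, hf₂, rfl, rfl, rfl⟩ := hinc hi hf (τ + 4 + t₁)
      (buf ++ if (⟨i, him⟩ : Fin m) ∈ B then [i] else []) lg
    obtain ⟨r₃, t₃, h₃, hr₃, hf₃, ht₃⟩ := ih (i + 1) (Function.update r 6 (i + 1))
      (τ + 4 + t₁ + 4) (buf ++ if (⟨i, him⟩ : Fin m) ∈ B then [i] else []) lg (by omega)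
      (by simp [h0]) (by simp) hf₂
    refine ⟨r₃, 4 + t₁ + 4 + t₃, ?_, fun y hy => ?_, hf₃, by omega⟩
    · refine .loopTrue _ _ _ _ _
        (Expr.Ok.safe (σ := ⟨r, w₂, τ, buf, lg⟩) hi hf ⟨trivial, trivial⟩)
        (by simp only [Expr.eval, h0, h6, if_pos him]; omega) (.seq _ _ _ _ _ h₁ h₂) ?_
      have hl : buf ++ (((List.finRange m).drop i).filter (· ∈ B)).map Fin.val =
          (buf ++ if (⟨i, him⟩ : Fin m) ∈ B then [i] else []) ++
            (((List.finRange m).drop (i + 1)).filter (· ∈ B)).map Fin.val := by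
        rw [List.drop_eq_getElem_cons hi', List.append_assoc]
        by_cases hB' : (⟨i, him⟩ : Fin m) ∈ B <;> simp [hB']
      rw [hl, show τ + (4 + t₁ + 4 + t₃) = τ + 4 + t₁ + 4 + t₃ by omega]
      exact h₃
    · rw [hr₃ y hy, Function.update_of_ne (by omega)]

theorem listsArcs_filter (B : Finset (Fin m)) :
    ListsArcs (((List.finRange m).filter (· ∈ B)).map Fin.val) B := by
  refine ⟨((List.nodup_finRange m).filter _).map Fin.val_injective, fun k => ?_⟩
  simp only [List.mem_map, List.mem_filter, List.mem_finRange, true_and, decide_eq_true_eq]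

theorem round_output (hM : Roomy M D) (hT : T.card ≤ m) (hd : ds.length ≤ m)
    (h : At M D S T ds 0 σ) (hc : D.Connects S T (available D ds).1)
    (hn : (D.prune (searchList D S (available D ds).1) T).filter (· ∉ (available D ds).2) = []) :
    ∃ σ' t out, Round M (D.encode S T) σ σ' ∧ At M D S T ds 1 σ' ∧
      σ'.log = σ.log ++ [(t, out)] ∧
      ListsArcs out (D.prune (searchList D S (available D ds).1) T).toFinset ∧
      σ.time ≤ t ∧ t ≤ σ'.time ∧ σ'.time ≤ σ.time + period D := by
  have hcells := hM.cells
  have hword := hM.word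
  have hi : InputFits M (D.encode S T) := hM.inputFits
  set B := (D.prune (searchList D S (available D ds).1) T).toFinset with hBdef
  have hfind : Does M (D.encode S T) find σ.reg σ.work fun r' w' t =>
      Ready D S T r' w' ∧ Stack ds r' w' ∧ Holds (w' 6) (available D ds).2 ∧
      Fired D S T (searchList D S (available D ds).1) r' w' ∧ r' 6 ≠ 0 ∧
      t ≤ 270 * (m * m + m * D.start m + 1) :=
    does_find hM h.ready hT h.stack hd fun r₁ w₁ t₁ hR hS _ hP hF h6 ht =>
      ⟨hR, hS, hP, hF, h6.2 hc, ht⟩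
  obtain ⟨r₁, w₁, t₁, he₁, hf₁, hR, hS, hP, hF, h6, ht₁⟩ :=
    hfind hi h.fits (σ.time + 8 + 2) σ.buffer σ.log
  have hsel : Does M (D.encode S T) select r₁ w₁ fun r' w' t =>
      Ready D S T r' w' ∧ Stack ds r' w' ∧ Holds (w' 10) B ∧ r' 5 = m ∧
      t ≤ 200 * (m * m + m * D.start m + 1) :=
    does_select hM hR hT hP hF reaching_searchList fun r₂ w₂ t₂ hr₂ hw₂ h10 h5 ht₂ =>
      ⟨hR.congr (fun y hy => hr₂ y (by omega)) fun B hB => hw₂ B (by omega),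
        hS.congr (hr₂ 2 (by omega)) (hw₂ 3 (by omega)) (hw₂ 4 (by omega)), h10,
        h5.trans (lastNew_eq_iff.2 hn), ht₂⟩
  obtain ⟨r₂, w₂, t₂, he₂, hf₂, hR₂, hS₂, h10, h5, ht₂⟩ :=
    hsel hi hf₁ (σ.time + 8 + 2 + t₁ + 2) σ.buffer σ.log
  -- The main loop test takes `8` steps, the tests of registers `3` and `6` take `2` each, and the
  -- comparison of registers `5` and `0` takes `4`.
  set τ := σ.time + 8 + 2 + t₁ + 2 + t₂ + 4 with hτ
  have hzero : Does M (D.encode S T) (.assign 6 (.const 0)) r₂ w₂ fun r' w' t =>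
      r' = Function.update r₂ 6 0 ∧ w' = w₂ ∧ t = 2 :=
    does_assign (by simp only [Expr.Ok]; omega) ⟨rfl, rfl, rfl⟩
  obtain ⟨r₃, w₃, t₃, he₃, hf₃, rfl, rfl, rfl⟩ := hzero hi hf₂ τ σ.buffer σ.log
  obtain ⟨r₄, t₄, he₄, hr₄, hf₄, ht₄⟩ := exec_emit_loop (S := S) (T := T) hM h10 m 0 _ (τ + 2)
    σ.buffer σ.log (by omega) (by simp [hR₂.arcs]) (by simp) hf₃
  have hlast : Does M (D.encode S T) (.assign 3 (.const 1)) r₄ w₃ fun r' w' t =>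
      r' = Function.update r₄ 3 1 ∧ w' = w₃ ∧ t = 2 :=
    does_assign (by simp only [Expr.Ok]; omega) ⟨rfl, rfl, rfl⟩
  set out := (((List.finRange m).drop 0).filter (· ∈ B)).map Fin.val with hout
  obtain ⟨r₅, w₅, t₅, he₅, hf₅, rfl, rfl, rfl⟩ := hlast hi hf₄ (τ + 2 + t₄ + 1) []
    (σ.log ++ [(τ + 2 + t₄ + 1, out)])
  have hr : ∀ y < 6, r₄ y = r₂ y := fun y hy => by
    rw [hr₄ y hy, Function.update_of_ne (by omega)]
  refine ⟨⟨Function.update r₄ 3 1, w₅, τ + 2 + t₄ + 1 + 2, [],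
    σ.log ++ [(τ + 2 + t₄ + 1, out)]⟩, τ + 2 + t₄ + 1, out, ⟨guard_safe hM h.fits,
    (guard_eval_ne_zero _).2 (.inl h.phase), ?_⟩, ⟨hR₂.congr (fun y hy => ?_) fun _ _ => rfl,
    hS₂.congr ?_ rfl rfl, ?_, hf₅, rfl⟩, rfl, ?_, ?_, ?_, ?_⟩
  · refine .iteFalse _ _ _ _ _ (Expr.Ok.safe (e := .reg 3) hi h.fits trivial) h.phase ?_
    refine .seq _ _ _ _ _ he₁ ?_
    refine .iteTrue _ _ _ _ _ (Expr.Ok.safe (e := .reg 6) hi hf₁ trivial) h6 ?_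
    refine .seq _ _ _ _ _ he₂ ?_
    refine .iteTrue _ _ _ _ _ (Expr.Ok.safe (e := .eq (.reg 5) (.reg 0)) hi hf₂
      ⟨trivial, trivial⟩) (by simp [Expr.eval, h5, hR₂.arcs]) ?_
    refine .seq _ _ _ _ _ (.seq _ _ _ _ _ he₃ he₄) (.seq _ _ _ _ _ (.flush _) ?_)
    rw [h.buffer]
    exact he₅
  · simp only
    rw [Function.update_of_ne (by omega), hr y (by omega)]
  · simp only
    rw [Function.update_of_ne (by omega), hr 2 (by omega)]
  · simp
  · exact listsArcs_filter B
  · omega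
  · simp only; omega
  · simp only [period]
    have := Nat.le_mul_self m
    omega

end Rounds

end WordRAM

/-! ### Exploration of the recursion tree, and the delay -/

namespace WordRAM

open BHypergraph Relation

section Exploration

variable {n m : ℕ} {D : BHypergraph (Fin n) (Fin m)} {S T : Finset (Fin n)} {M : Limits}

/-- Output times `ts` of a part of a run that lasts from time `s` to time `e`, where outputs are
made at intervals of at most `d`, the first one by time `f`, and the part ends at most `l` after the
last one, or at most `c` after `s` if there is no output. -/
structure Timely (c d f l s : ℕ) (ts : List ℕ) (e : ℕ) : Prop where
  none : ts = [] → e ≤ s + c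
  chain : ts.IsChain fun x y => y ≤ x + d
  first : ∀ x ∈ ts.head?, x ≤ s + f
  last : ∀ x ∈ ts.getLast?, e ≤ x + l

/-- Two recursive calls are surrounded and separated by three rounds of length at most `c`. A first
call without output itself lasts at most `c`, which explains `f + 3 * c`; the gap between the two
groups of outputs is at most `l + c + f`. -/
theorem Timely.append {c d f l s s₁ e₀ s₂ e₁ e f' l' : ℕ} {ts₀ ts₁ : List ℕ}
    (h₀ : Timely c d f l s₁ ts₀ e₀) (h₁ : Timely c d f l s₂ ts₁ e₁) (hne : ts₁ ≠ [])
    (hs₁ : s₁ ≤ s + c) (hs₂ : s₂ ≤ e₀ + c) (he : e ≤ e₁ + c) (hd : l + c + f ≤ d)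
    (hf : f + 3 * c ≤ f') (hl : l + c ≤ l') : Timely c d f' l' s (ts₀ ++ ts₁) e := by
  refine ⟨fun h => absurd (List.append_eq_nil_iff.1 h).2 hne,
    List.isChain_append.2 ⟨h₀.chain, h₁.chain, fun x hx y hy => ?_⟩, fun x hx => ?_, fun x hx => ?_⟩
  · have := h₀.last x hx
    have := h₁.first y hy
    omega
  · rcases ts₀ with _ | ⟨y, ts₀⟩
    · have := h₀.none rfl
      have := h₁.first x hx
      omega
    · have := h₀.first x hx
      omega
  · rw [List.getLast?_append_of_ne_nil _ hne] at hx
    have := h₁.last x hx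
    omega

theorem Timely.mono {c d f l s e f' l' : ℕ} {ts : List ℕ} (h : Timely c d f l s ts e)
    (hf : f ≤ f') (hl : l ≤ l') : Timely c d f' l' s ts e :=
  ⟨h.none, h.chain, fun x hx => (h.first x hx).trans (by omega),
    fun x hx => (h.last x hx).trans (by omega)⟩

theorem available_used {ds : List (Fin m × Bool)} {a : Fin m} :
    available D (ds ++ [(a, true)]) =
      (insert a ((available D ds).1.filter fun b => D.head b ≠ D.head a),
        (available D ds).2 ∪ {a}) := by
  rw [available_concat]; rfl

theorem available_unused {ds : List (Fin m × Bool)} {a : Fin m} :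
    available D (ds ++ [(a, false)]) = ((available D ds).1.erase a, (available D ds).2) := by
  rw [available_concat]; rfl

/-- Induction on a bound `k` for the number of current hyperarcs, which also bounds the further
growth of the stack. Counted in rounds, the wait for the first output grows by at most three per
level and the time after the last output by at most one, so `3 * k + 1` and `2 * k + 1` suffice. One
level up, the outputs of the two calls are then at most `(2 * k + 1) + 1 + (3 * k + 1) = 5 * k + 3`
rounds apart. The claim `new ≠ []` is carried along because the call that uses `a` must not be
silent. -/
theorem explore (hM : Roomy M D) (hT : T.card ≤ m) (k : ℕ) :
    ∀ (D' : BHypergraph (Fin n) (Fin m)) (T' : Finset (Fin n)) (ds : List (Fin m × Bool))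
      (σ : State), Node D T S D' T' (available D ds).2 (available D ds).1 → D'.arcs.card ≤ k →
      ds.length + k ≤ m → At M D S T ds 0 σ →
      ∃ out σ' new, ReflTransGen (Round M (D.encode S T)) σ σ' ∧ At M D S T ds 1 σ' ∧
        σ'.log = σ.log ++ new ∧ EnumHyperpaths S D' T' (available D ds).2 out ∧
        List.Forall₂ ListsArcs (new.map Prod.snd) out ∧
        (D.Connects S T (available D ds).1 → new ≠ []) ∧
        Timely (period D) ((5 * m + 3) * period D) ((3 * k + 1) * period D)
          ((2 * k + 1) * period D) σ.time (new.map Prod.fst) σ'.time := by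
  induction k with
  | zero =>
    intro D' T' ds σ hN hk hd hσ
    by_cases hc : D.Connects S T (available D ds).1
    · have hK := isPath_searchList hc
      rcases List.eq_nil_or_concat' ((D.prune (searchList D S (available D ds).1) T).filter
        (· ∉ (available D ds).2)) with hn | ⟨L, a, hL⟩
      · obtain ⟨σ', t, o, hr, hat, hlog, hlist, h1, h2, h3⟩ :=
          round_output hM hT (by omega) hσ hc hn
        obtain ⟨rfl, hKP⟩ := hN.eq_empty_of_filter_eq_nil hK hn
        rw [hKP] at hlist
        exact ⟨_, σ', _, .single hr, hat, hlog, .output _ _, .cons hlist .nil, by simp,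
          ⟨by simp, by simp, by simp; omega, by simp; omega⟩⟩
      · have hb := (hL ▸ hN.isOrderedHyperpath hK).branches.mem
        rw [Finset.card_eq_zero.1 (Nat.le_zero.1 hk)] at hb
        simp at hb
    · obtain ⟨σ', hr, hat, hlog, ht⟩ := round_fail hM hT (by omega) hσ hc
      obtain ⟨hne, hno⟩ := hN.not_connects hc
      exact ⟨[], σ', [], .single hr, hat, by simp [hlog], .none _ _ _ hne hno, .nil,
        fun h => absurd h hc, ⟨fun _ => ht, by simp, by simp, by simp⟩⟩
  | succ k ih =>
    intro D' T' ds σ hN hk hd hσ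
    by_cases hc : D.Connects S T (available D ds).1
    · have hK := isPath_searchList hc
      rcases List.eq_nil_or_concat' ((D.prune (searchList D S (available D ds).1) T).filter
        (· ∉ (available D ds).2)) with hn | ⟨L, a, hL⟩
      · obtain ⟨σ', t, o, hr, hat, hlog, hlist, h1, h2, h3⟩ :=
          round_output hM hT (by omega) hσ hc hn
        obtain ⟨rfl, hKP⟩ := hN.eq_empty_of_filter_eq_nil hK hn
        rw [hKP] at hlist
        refine ⟨_, σ', _, .single hr, hat, hlog, .output _ _, .cons hlist .nil, by simp, ?_⟩
        refine Timely.mono (f := period D) (l := period D) ⟨by simp, by simp, by simp; omega,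
          by simp; omega⟩ ?_ ?_ <;> exact Nat.le_mul_of_pos_left _ (by omega)
      · have ho := hL ▸ hN.isOrderedHyperpath hK
        have hb := ho.branches
        have hlt₀ := card_delete_lt hb.mem
        have hlt₁ := card_contract_lt hb.mem
        obtain ⟨σ₁, hr₁, hat₁, hlog₁, ht₁⟩ := round_push hM hT (by omega) hσ hc hL
        obtain ⟨out₀, σ₂, new₀, hs₂, hat₂, hlog₂, hen₂, hf₂, -, htm₂⟩ :=
          ih (D'.delete a) T' (ds ++ [(a, false)]) σ₁
            (by rw [available_unused]; exact hN.delete hb.mem) (by omega) (by simp; omega) hat₁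
        obtain ⟨σ₃, hr₃, hat₃, hlog₃, ht₃⟩ := round_flip hM (by omega) hat₂
        obtain ⟨out₁, σ₄, new₁, hs₄, hat₄, hlog₄, hen₄, hf₄, hne₄, htm₄⟩ :=
          ih (D'.contract a) (D'.newTargets S T' a) (ds ++ [(a, true)]) σ₃
            (by rw [available_used]; exact hN.contract hb) (by omega) (by simp; omega) hat₃
        obtain ⟨σ₅, hr₅, hat₅, hlog₅, ht₅⟩ := round_pop hM (by omega) hat₄
        have haK : a ∈ D.prune (searchList D S (available D ds).1) T :=
          (List.mem_filter.1 (hL ▸ List.mem_concat_self : a ∈ List.filter _ _)).1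
        have hne : new₁ ≠ [] := hne₄ (by
          rw [available_used]; exact hK.connects_of_mem haK)
        rw [available_unused] at hen₂
        rw [available_used] at hen₄
        refine ⟨out₀ ++ out₁, σ₅, new₀ ++ new₁,
          ((((ReflTransGen.single hr₁).trans hs₂).tail hr₃).trans hs₄).tail hr₅, hat₅, ?_,
          .branch _ _ _ L a out₀ out₁ (hN.ne_empty_of_filter hK hL) ho hen₂ hen₄, ?_, ?_, ?_⟩
        · rw [hlog₅, hlog₄, hlog₃, hlog₂, hlog₁, List.append_assoc]
        · rw [List.map_append]
          exact List.rel_append hf₂ hf₄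
        · simp [hne]
        · rw [List.map_append]
          refine Timely.append htm₂ htm₄ (by simpa using hne) ht₁ ht₃ ht₅ ?_ ?_ ?_
          · have : (2 * k + 1) * period D + period D + (3 * k + 1) * period D =
              (5 * k + 3) * period D := by ring
            rw [this]
            exact Nat.mul_le_mul_right _ (by omega)
          · exact (by ring : (3 * k + 1) * period D + 3 * period D =
              (3 * (k + 1) + 1) * period D).le
          · have : (2 * k + 1) * period D + period D = (2 * k + 2) * period D := by ring
            rw [this]
            exact Nat.mul_le_mul_right _ (by omega)
    · obtain ⟨σ', hr, hat, hlog, ht⟩ := round_fail hM hT (by omega) hσ hc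
      obtain ⟨hne, hno⟩ := hN.not_connects hc
      exact ⟨[], σ', [], .single hr, hat, by simp [hlog], .none _ _ _ hne hno, .nil,
        fun h => absurd h hc, ⟨fun _ => ht, by simp, by simp, by simp⟩⟩

theorem exec_loop_of_rounds {inp : ℕ → List ℕ} {σ σ' : State}
    (h : ReflTransGen (Round M inp) σ σ') (hs : guard.Safe M inp σ')
    (hz : guard.eval inp σ' = 0) :
    Exec M inp (.loop guard body) σ (σ'.tick (1 + guard.cost)) := by
  induction h using ReflTransGen.head_induction_on with
  | refl => exact .loopFalse _ _ _ hs hz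
  | head hr _ ih => exact .loopTrue _ _ _ _ _ hr.1 hr.2.1 hr.2.2 ih

/-- The program that enumerates all hyperpaths. -/
def enumProgram : Cmd :=
  .seq (.assign 0 (.input 0 (.const 1))) (.seq (.assign 1 (.input 0 (.const 2)))
    (.ite (.lt (.reg 0) (.reg 1)) .skip (.seq setup (.loop guard body))))

/-- The longest gaps inside the exploration are `5 * m + 3` periods. The rest of `6 * m + 6` leaves
room for the setup before the first output and for the final test; the setup bound is a fifth of a
period. -/
theorem exec_enumProgram (hM : Roomy M D) (hD : D.arcs = Finset.univ) (hST : Disjoint S T) :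
    ∃ (σ : State) (out : List (Finset (Fin m))),
      Exec M (D.encode S T) enumProgram State.init σ ∧ EnumHyperpaths S D T ∅ out ∧
      σ.buffer = [] ∧ List.Forall₂ ListsArcs (σ.log.map Prod.snd) out ∧
      σ.DelayAtMost ((6 * m + 6) * period D) := by
  have hword := hM.word
  have hi : InputFits M (D.encode S T) := hM.inputFits
  have hfit : Fits M (fun _ => 0) (fun _ _ => 0) := ⟨by simp, by simp⟩
  have hper : 700 ≤ period D := Nat.le_mul_of_pos_right _ (by omega)
  have h₀ : Does M (D.encode S T) (.assign 0 (.input 0 (.const 1))) (fun _ => 0) (fun _ _ => 0)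
      fun r' w' t => r' = Function.update (fun _ => 0) 0 m ∧ w' = (fun _ _ => 0) ∧ t = 3 :=
    does_assign (by simp only [Expr.Ok]; omega) ⟨rfl, rfl, rfl⟩
  obtain ⟨r₁, w₁, t₁, he₁, hf₁, rfl, rfl, rfl⟩ := h₀ hi hfit 0 [] []
  have h₁ : Does M (D.encode S T) (.assign 1 (.input 0 (.const 2)))
      (Function.update (fun _ => 0) 0 m) (fun _ _ => 0) fun r' w' t =>
        r' = Function.update (Function.update (fun _ => 0) 0 m) 1 T.card ∧
          w' = (fun _ _ => 0) ∧ t = 3 :=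
    does_assign (by simp only [Expr.Ok]; omega) ⟨rfl, rfl, rfl⟩
  obtain ⟨r₂, w₂, t₂, he₂, hf₂, rfl, rfl, rfl⟩ := h₁ hi hf₁ (0 + 3) [] []
  set r := Function.update (Function.update (fun _ => 0) 0 m) 1 T.card with hr
  have hs : (Expr.lt (.reg 0) (.reg 1)).Safe M (D.encode S T) ⟨r, fun _ _ => 0, 0 + 3 + 3, [], []⟩ :=
    Expr.Ok.safe hi hf₂ ⟨trivial, trivial⟩
  -- With more targets than hyperarcs the empty output sequence is correct, and the program stops at
  -- once.
  by_cases hlt : m < T.card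
  · refine ⟨_, [], .seq _ _ _ _ _ he₁ (.seq _ _ _ _ _ he₂ (.iteTrue _ _ _ _ _ hs ?_ (.skip _))),
      .none _ _ _ ?_ ?_, rfl, .nil, ?_⟩
    · simp [Expr.eval, hr, hlt]
    · rintro rfl
      simp at hlt
    · rintro ⟨P, hP⟩
      exact absurd (card_le_of_disjoint_of_forall hST hP.connects) (by omega)
    · have : (6 : ℕ) * period D ≤ (6 * m + 6) * period D := Nat.mul_le_mul_right _ (by omega)
      simp [State.DelayAtMost, State.tick, Expr.cost]
      omega
  · have h₂ : Does M (D.encode S T) setup r (fun _ _ => 0) fun r' w' t =>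
        Ready D S T r' w' ∧ (∀ y < 6, r' y = r y) ∧ t ≤ 140 * (m * m + m * D.start m + 1) :=
      does_setup hM (by simp [hr]) (by simp [hr]) (by omega) fun _ _ _ h1 h2 h3 => ⟨h1, h2, h3⟩
    obtain ⟨r₃, w₃, t₃, he₃, hf₃, hR, hr₃, ht₃⟩ := h₂ hi hf₂ (0 + 3 + 3 + 4) [] []
    have hN : Node D T S D T (available D []).2 (available D []).1 := by
      have := Node.root (D := D) (S := S) (T := T) fun h =>
        (Finset.disjoint_self_iff_empty _).1 (hST.mono_left h)
      rw [hD] at this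
      exact this
    have hat : At M D S T [] 0 ⟨r₃, w₃, 0 + 3 + 3 + 4 + t₃, [], []⟩ :=
      ⟨hR, ⟨by simp [hr₃ 2, hr], by simp, by simp⟩, by simp [hr₃ 3, hr], hf₃, rfl⟩
    obtain ⟨out, σ, new, hsteps, hat', hlog, hen, hfo, -, htm⟩ :=
      explore hM (by omega) m D T [] _ hN (by simpa using Finset.card_le_univ D.arcs) (by simp) hat
    have hz : guard.eval (D.encode S T) σ = 0 := by
      by_contra hz
      rcases (guard_eval_ne_zero _).1 hz with h | h
      · exact absurd (h.symm.trans hat'.phase) (by omega)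
      · have := hat'.stack.length
        simp at this
        omega
    have hlog : σ.log = new := by simpa using hlog
    refine ⟨_, out, .seq _ _ _ _ _ he₁ (.seq _ _ _ _ _ he₂ (.iteFalse _ _ _ _ _ hs ?_
      (.seq _ _ _ _ _ he₃ (exec_loop_of_rounds hsteps (guard_safe hM hat'.fits) hz)))), hen,
      hat'.buffer, ?_, ?_⟩
    · simp [Expr.eval, hr, hlt]
    · simpa [State.tick, hlog] using hfo
    · have hg : 1 + guard.cost = 8 := rfl
      have hu : 140 * (m * m + m * D.start m + 1) * 5 = period D := by rw [period]; ring
      have e1 : (6 * m + 6) * period D = 6 * (m * period D) + 6 * period D := by ring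
      have e2 : (3 * m + 1) * period D = 3 * (m * period D) + period D := by ring
      have e3 : (2 * m + 1) * period D = 2 * (m * period D) + period D := by ring
      have e4 : (5 * m + 3) * period D = 5 * (m * period D) + 3 * period D := by ring
      rw [State.DelayAtMost, e1]
      rw [e2, e3, e4] at htm
      simp only [State.tick, hg, hlog]
      rcases hnew : new.map Prod.fst with _ | ⟨x, ts⟩
      · have := htm.none hnew
        simp only at this
        simp
        omega
      · rw [hnew] at htm
        have hx := htm.first x (by simp)
        simp only at hx
        rw [List.cons_append, List.isChain_cons_cons, ← List.cons_append, List.isChain_append]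
        refine ⟨by omega, htm.chain.imp fun a b h => by omega, by simp, fun y hy z hz => ?_⟩
        have := htm.last y hy
        simp at hz
        omega

end Exploration

end WordRAM

/-- First part: called with `P = ∅`, the backtracking procedure terminates, and however the
hyperpaths are chosen that it branches on, it outputs every `S`-`T` hyperpath exactly once and
nothing else. Second part: it can be implemented on a word RAM (words of `O(log (n + ‖A‖))` bits)
with delay `O(m² ‖A‖)` and `O(m ‖A‖)` cells of work space. The summand `1` matters only if there are
no hyperarcs. -/
theorem mainTheorem4 :
    (∀ (V : Type*) (ι : Type*) [DecidableEq V] [DecidableEq ι]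
        (D : BHypergraph V ι) (S T : Finset V), (T ⊆ S → T = ∅) →
      Acc (BHypergraph.RecCall S) (D, T) ∧
      (∃ out, BHypergraph.EnumHyperpaths S D T ∅ out) ∧
      ∀ out, BHypergraph.EnumHyperpaths S D T ∅ out →
        out.Nodup ∧ ∀ P : Finset ι, P ∈ out ↔ D.IsHyperpath S T P) ∧
    (∃ (prog : WordRAM.Cmd) (C : ℕ), ∀ (n m : ℕ) (D : BHypergraph (Fin n) (Fin m))
        (S T : Finset (Fin n)), D.arcs = Finset.univ → Disjoint S T →
      ∃ (σ : WordRAM.State) (out : List (Finset (Fin m))),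
        WordRAM.Exec ⟨C * (m * D.size + 1), (n + D.size + 2) ^ C⟩ (D.encode S T) prog
          WordRAM.State.init σ ∧
        BHypergraph.EnumHyperpaths S D T ∅ out ∧
        σ.buffer = [] ∧
        List.Forall₂ ListsArcs (σ.log.map Prod.snd) out ∧
        σ.DelayAtMost (C * (m ^ 2 * D.size + 1))) := by
  refine ⟨fun V ι _ _ D S T hT => ⟨BHypergraph.acc_recCall D S T,
    BHypergraph.exists_enumHyperpaths D S T ∅ hT, fun out h => ?_⟩, ?_⟩
  · have := h.correct (Finset.disjoint_empty_left _)
    exact ⟨this.1, fun P => by simp [this.2]⟩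
  -- The delay is the critical requirement: `(6 * m + 6) * 700 * (m * D.size + 1)` expands into four
  -- terms with coefficient `4200`, and `4 * 4200 ≤ 20000`.
  · obtain ⟨C, hC⟩ : ∃ C, C = 20000 := ⟨_, rfl⟩
    refine ⟨WordRAM.enumProgram, C, fun n m D S T hD hST => ?_⟩
    have hsize := D.size_eq hD
    have hle : D.size ≤ m * D.size := WordRAM.le_mul_self' _ _ fun h => by
      subst h; rw [hsize, D.start_zero]
    have hM : WordRAM.Roomy ⟨C * (m * D.size + 1), (n + D.size + 2) ^ C⟩ D := by
      constructor
      · have : 2 * (m * D.size + 1) ≤ C * (m * D.size + 1) := Nat.mul_le_mul_right _ (by omega)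
        show m + D.start m + 2 ≤ C * (m * D.size + 1)
        omega
      · have h3 : (n + D.size + 2) ^ 3 ≤ (n + D.size + 2) ^ C :=
          Nat.pow_le_pow_right (by omega) (by omega)
        -- The largest word is at most `n + D.size + 5`, hence below four times the base, and two
        -- factors of the base are at least `2`; the exponent `3` would do.
        have h4 : 2 * 2 * (n + D.size + 2) ≤ (n + D.size + 2) ^ 3 := by
          rw [pow_three, ← mul_assoc]
          gcongr <;> omega
        show n + m + D.start m + 5 ≤ (n + D.size + 2) ^ C
        omega
    obtain ⟨σ, out, h1, h2, h3, h4, h5⟩ := WordRAM.exec_enumProgram hM hD hST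
    refine ⟨σ, out, h1, h2, h3, h4, List.IsChain.imp (fun s t h => h.trans ?_) h5⟩
    have hb : (6 * m + 6) * WordRAM.period D ≤ C * (m ^ 2 * D.size + 1) := by
      have : WordRAM.period D = 700 * (m * D.size + 1) := by rw [WordRAM.period, hsize]; ring
      rw [this, hC]
      rcases Nat.eq_zero_or_pos m with rfl | hm
      · simp
      · have h6 : m ≤ m ^ 2 * D.size := by
          calc m = m * 1 * 1 := by ring
            _ ≤ m * m * D.size := by gcongr <;> omega
            _ = _ := by ring
        have h7 : m * D.size ≤ m ^ 2 * D.size := by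
          rw [pow_two, mul_assoc]; exact Nat.le_mul_of_pos_left _ hm
        calc (6 * m + 6) * (700 * (m * D.size + 1))
            = 4200 * (m ^ 2 * D.size) + 4200 * m + 4200 * (m * D.size) + 4200 := by ring
          _ ≤ 20000 * (m ^ 2 * D.size + 1) := by omega
    omega
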